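/- **Setting.** Let $d\ge 1$, $S\ge 2$, let $q_{\mathrm{data}}=q_0$ be a distribution on $[S]^d$, and let $\mathcal X=([S]\cup\{\mathrm{MASK}\})^d$. The masking noising process is the continuous-time Markov chain on $\mathcal X$ started from $q_0$ in which each unmasked coordinate jumps to $\mathrm{MASK}$ at rate $1$, independently of the others; $Q$ is its rate matrix, $q_t$ its law at time $t$, and $s_t(y,x)=q_t(y)/q_t(x)$ its score. For $x\in\mathcal X$, $x\odot_i a$ is $x$ with the $i$-th coordinate replaced by $a$. With Shannon entropy $\mathcal H$ and (conditional) mutual information $\mathrm I$ define, for $x\sim q_0$ and $x_t\sim q_t$, $$\mathcal C=\sum_i \mathcal H(x^i)-\mathcal H(x),\qquad \mathcal B=\mathcal H(x)-\sum_i\mathcal H(x^i\mid x^{-i}),\qquad \mathcal D=\int_0^\infty \min(1,t)\sum_{i\ne j}\mathrm I\big(x_t^i;x_t^j\mid x_t^{-(i,j)}\big)\,dt$$ (total correlation, dual total correlation, effective total correlation), where $x^{-i}$ denotes the coordinates of $x$ other than $i$ and $x_t^{-(i,j)}$ the collection of unmasked entries of $x_t$ other than the $i$-th and $j$-th. Let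 $0<\varepsilon<d\log S$, $T=\log(d\log(S)/\varepsilon)$, $N\ge 1$, $0=t_0<t_1<\dots<t_N=T$ with $\max_k(t_{k+1}-t_k)\le\Delta_0$, and let $\widehat s_{T-t_k}:\mathcal X\times\mathcal X\to[0,\infty)$, $0\le k<N$, be score estimates with $$\sum_{k=0}^{N-1}(t_{k+1}-t_k)\,\mathbb E_{x\sim q_{T-t_k}}\sum_{y\ne x}Q(y,x)\,s_{T-t_k}(y,x)\,D\big(\widehat s_{T-t_k}(y,x),s_{T-t_k}(y,x)\big)\le\varepsilon_{\mathrm{score}},\qquad D(a,b)=\tfrac ab-1-\log\tfrac ab,$$ where $b\,D(a,b)$ is read as $a$ if $b=0$ and as $\infty$ if $a=0<b$. **Sampler.** Draw $x_{t_0}$ from $\big((1-e^{-T})\delta_{\mathrm{MASK}}+S^{-1}e^{-T}\sum_{a\in[S]}\delta_a\big)^{\otimes d}$. For $k=0,\dots,N-1$, given $x=x_{t_k}$, keep the unmasked coordinates and update the masked coordinates $i$ independently: with $\widehat Q^i(a)=\widehat s_{T-t_k}(x\odot_i a,x)$, coordinate $i$ stays masked with probability $P$ and becomes $a\in[S]$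 with probability $(1-P)\,\widehat Q^i(a)/\sum_b\widehat Q^i(b)$, where $P=0$ if $k=N-1$ and otherwise $$P=\exp\Big(-\sum_{a}\widehat Q^i(a)\,(e^{T-t_k}-1)\log\frac{e^T-e^{t_k}}{e^T-e^{t_{k+1}}}\Big).$$ (If all $\widehat Q^i(a)$ vanish in the last step, the new token is uniform on $[S]$.) Let $p_{\mathrm{output}}$ be the law of $x_{t_N}$. **Claim.** For every $\Delta_0>0$ there is a constant $K=K(\Delta_0)>0$, depending on nothing else, such that $$\mathsf{KL}(q_{\mathrm{data}}\,\|\,p_{\mathrm{output}})\le K(\varepsilon_{\mathrm{score}}+\varepsilon)$$ holds in each of the following two cases. 1. (Constant step size.) $t_{k+1}-t_k=T/N$ for all $0\le k<N$, and $N\ge T\,\mathcal B(q_{\mathrm{data}})/\varepsilon$; since $T$ is logarithmic in $d,S,1/\varepsilon$, this is a requirement $N=\widetilde O(\mathcal B(q_{\mathrm{data}})/\varepsilon)$. 2. (Exponential-then-constant step size.) $t_{k+1}-t_k\le\kappa\min(1,T-t_{k+1})$ for $0\le k\le N-2$, $T-t_{N-1}=\varepsilon/(d\log S)$, $\kappa=N^{-1}\big(T+\log(\varepsilon^{-1}d\log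 S)\big)$, and $N\ge\big(T+\log(\varepsilon^{-1}d\log S)\big)\,\mathcal D(q_{\mathrm{data}})/\varepsilon$, i.e. $N=\widetilde O(\mathcal D(q_{\mathrm{data}})/\varepsilon)$. Moreover the integral defining $\mathcal D(q_{\mathrm{data}})$ converges and $\mathcal D(q_{\mathrm{data}})\le\min\{\mathcal B(q_{\mathrm{data}}),\mathcal C(q_{\mathrm{data}})\}$, so that the second requirement is at most $\widetilde O(\min\{\mathcal B,\mathcal C\}/\varepsilon)$. Finally, a discretization as in case 2, with all steps at most $1$, exists whenever $\varepsilon/(d\log S)<T$ and $N\ge 4(1+T)^2$. -/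

import Mathlib

open scoped ENNReal NNReal

noncomputable section

namespace MaskingDiffusion

/-! ### Entropies of finitely valued random variables

A distribution on a finite type `Ω` is given by its mass function `μ : Ω → ℝ`. -/

open scoped Classical in
/-- `Pr(f = a)` under the mass function `μ`. -/
def law {Ω α : Type*} [Fintype Ω] (μ : Ω → ℝ) (f : Ω → α) (a : α) : ℝ :=
  ∑ ω, if f ω = a then μ ω else 0

/-- Shannon entropy `H(f)` (natural logarithm). -/
def entropy {Ω α : Type*} [Fintype Ω] [Fintype α] (μ : Ω → ℝ) (f : Ω → α) : ℝ :=
  ∑ a, Real.negMulLog (law μ f a)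

/-- Conditional entropy `H(f | g) = ∑_b Pr(g = b) H(f | g = b)`. -/
def condEntropy {Ω α β : Type*} [Fintype Ω] [Fintype α] [Fintype β]
    (μ : Ω → ℝ) (f : Ω → α) (g : Ω → β) : ℝ :=
  ∑ b, law μ g b *
    ∑ a, Real.negMulLog (law μ (fun ω => (f ω, g ω)) (a, b) / law μ g b)

/-- Conditional mutual information `I(f ; g | h) = H(f | h) - H(f | g, h)`. -/
def condMutualInfo {Ω α β γ : Type*} [Fintype Ω] [Fintype α] [Fintype β] [Fintype γ]
    (μ : Ω → ℝ) (f : Ω → α) (g : Ω → β) (h : Ω → γ) : ℝ :=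
  condEntropy μ f h - condEntropy μ f (fun ω => (g ω, h ω))

/-- The mass function of a distribution on `[S]^d`. -/
def massOf {d S : ℕ} (q : PMF (Fin d → Fin S)) (z : Fin d → Fin S) : ℝ := (q z).toReal

/-- Total correlation `C(q) = ∑ᵢ H(xⁱ) - H(x)`. -/
def totalCorrelation {d S : ℕ} (q : PMF (Fin d → Fin S)) : ℝ :=
  (∑ i, entropy (massOf q) (fun z => z i)) - entropy (massOf q) (fun z => z)

/-- Dual total correlation `B(q) = H(x) - ∑ᵢ H(xⁱ | x⁻ⁱ)`. -/
def dualTotalCorrelation {d S : ℕ} (q : PMF (Fin d → Fin S)) : ℝ :=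
  entropy (massOf q) (fun z => z) -
    ∑ i, condEntropy (massOf q) (fun z => z i) (fun z => fun j : {j : Fin d // j ≠ i} => z j)

/-! ### The masking noising process -/

/-- The state space `([S] ∪ {MASK})^d`; `none` is `MASK`. -/
abbrev State (d S : ℕ) : Type := Fin d → Option (Fin S)

/-- Token rates: `Q^tok(a, b) = 1` if `a ≠ MASK` and `b = MASK`, and `0` otherwise
(used for `a ≠ b` only). -/
def tokenRate {S : ℕ} (a b : Option (Fin S)) : ℝ := if a ≠ none ∧ b = none then 1 else 0

/-- Off-diagonal rates: `Q^tok(xⁱ, yⁱ)` if `x` and `y` differ exactly in coordinate `i`,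
and `0` if they differ in at least two coordinates. -/
def offDiagRate {d S : ℕ} (x y : State d S) : ℝ :=
  if hammingDist x y = 1 then ∑ i with x i ≠ y i, tokenRate (x i) (y i) else 0

/-- The rate matrix `Q` of the masking noising process. -/
def rateMatrix (d S : ℕ) : Matrix (State d S) (State d S) ℝ :=
  Matrix.of fun x y => if x = y then -∑ z with z ≠ x, offDiagRate x z else offDiagRate x y

/-- The data distribution as a mass function on `([S] ∪ {MASK})^d`, supported on `[S]^d`. -/
def dataMass {d S : ℕ} (q : PMF (Fin d → Fin S)) (x : State d S) : ℝ :=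
  ∑ z : Fin d → Fin S, if x = (fun i => some (z i)) then massOf q z else 0

/-- The marginals `q_t = q₀ exp(tQ)` of the masking noising process started from `q`, i.e. the
solution of the Kolmogorov forward equation `dq_t/dt = Qᵀ q_t`, `q₀ = q`. -/
def marginal {d S : ℕ} (q : PMF (Fin d → Fin S)) (t : ℝ) : State d S → ℝ :=
  Matrix.vecMul (dataMass q) (NormedSpace.exp (t • rateMatrix d S))

/-- `I(t) = ∑_{i ≠ j} I(x_tⁱ ; x_tʲ | x_t^{-(i,j)})` for `x_t ∼ q_t`. The collection of the
unmasked entries of `x_t` outside `i, j` is recorded as the restriction of `x_t` to the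
coordinates other than `i, j`, the masked ones carrying the symbol `MASK`. -/
def infoAt {d S : ℕ} (q : PMF (Fin d → Fin S)) (t : ℝ) : ℝ :=
  ∑ i : Fin d, ∑ j : Fin d, if i ≠ j then
    condMutualInfo (marginal q t) (fun x => x i) (fun x => x j)
      (fun x => fun k : {k : Fin d // k ≠ i ∧ k ≠ j} => x k) else 0

/-- Effective total correlation `D(q) = ∫₀^∞ min(1, t) I(t) dt`. -/
def effectiveTotalCorrelation {d S : ℕ} (q : PMF (Fin d → Fin S)) : ℝ :=
  ∫ t in Set.Ioi (0 : ℝ), min 1 t * infoAt q t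

/-! ### Score and score entropy loss -/

/-- The score `s_t(y, x) = q_t(y) / q_t(x)`. -/
def score {d S : ℕ} (q : PMF (Fin d → Fin S)) (t : ℝ) (y x : State d S) : ℝ :=
  marginal q t y / marginal q t x

/-- The Bregman divergence `D(a, b) = a/b - 1 - log (a/b)`, for `a, b > 0`. -/
def bregman (a b : ℝ) : ℝ := a / b - 1 - Real.log (a / b)

/-- The product `b · D(a, b) = a - b - b log (a/b)` for `a, b ≥ 0`, with its limiting values `a`
at `b = 0` and `∞` at `a = 0 < b`. -/
def weightedBregman (a b : ℝ) : ℝ≥0∞ :=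
  if b = 0 then ENNReal.ofReal a
  else if a = 0 then ⊤
  else ENNReal.ofReal (b * bregman a b)

/-- The score entropy loss
`E_{x ∼ q_t} ∑_{y ≠ x} Q(y, x) s_t(y, x) D(ŝ(y, x), s_t(y, x))`. -/
def scoreEntropyLoss {d S : ℕ} (q : PMF (Fin d → Fin S)) (t : ℝ)
    (sHat : State d S → State d S → ℝ≥0) : ℝ≥0∞ :=
  ∑ x : State d S, ENNReal.ofReal (marginal q t x) *
    ∑ y with y ≠ x, ENNReal.ofReal (rateMatrix d S y x) *
      weightedBregman (sHat y x) (score q t y x)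

/-- The time discretizations `0 = t₀ < t₁ < ⋯ < t_N = T`. -/
def IsTimeGrid (N : ℕ) (T : ℝ) (t : ℕ → ℝ) : Prop :=
  t 0 = 0 ∧ t N = T ∧ ∀ k < N, t k < t (k + 1)

/-- The aggregated score error `∑_k (t_{k+1} - t_k) L_SE(T - t_k, ŝ_{T-t_k}, s_{T-t_k})`. The
estimate `ŝ_u(y, x)` is `sHat u y x`. -/
def totalScoreError {d S : ℕ} (q : PMF (Fin d → Fin S)) (N : ℕ) (T : ℝ) (t : ℕ → ℝ)
    (sHat : ℝ → State d S → State d S → ℝ≥0) : ℝ≥0∞ :=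
  ∑ k ∈ Finset.range N, ENNReal.ofReal (t (k + 1) - t k) *
    scoreEntropyLoss q (T - t k) (sHat (T - t k))

/-! ### The sampler (modified truncated τ-leaping) -/

/-- The initial distribution `((1 - e^{-T}) δ_MASK + S⁻¹ e^{-T} ∑_a δ_a)^{⊗ d}`. -/
def initMass (d S : ℕ) (T : ℝ) (x : State d S) : ℝ :=
  ∏ i, match x i with
    | none => 1 - Real.exp (-T)
    | some _ => (S : ℝ)⁻¹ * Real.exp (-T)

/-- `Q̂ᵢ(a) = ŝ(x ⊙ᵢ a, x)` for `a ∈ [S]`. -/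
def unmaskRate {d S : ℕ} (sHat : State d S → State d S → ℝ≥0) (x : State d S) (i : Fin d)
    (a : Fin S) : ℝ :=
  sHat (Function.update x i (some a)) x

/-- `Δ_k = (e^{T-t_k} - 1) log ((e^T - e^{t_k}) / (e^T - e^{t_{k+1}}))`. -/
def stepWeight (T : ℝ) (t : ℕ → ℝ) (k : ℕ) : ℝ :=
  (Real.exp (T - t k) - 1) *
    Real.log ((Real.exp T - Real.exp (t k)) / (Real.exp T - Real.exp (t (k + 1))))

/-- `P_k`: the probability that the masked coordinate `i` stays masked in step `k`. It is
`exp(-Δ_k ∑_a Q̂ᵢ(a))` before the last step and `0` in the last step. -/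
def stayProb {d S : ℕ} (N : ℕ) (T : ℝ) (t : ℕ → ℝ) (sHat : State d S → State d S → ℝ≥0)
    (k : ℕ) (x : State d S) (i : Fin d) : ℝ :=
  if k + 1 < N then Real.exp ((-∑ a, unmaskRate sHat x i a) * stepWeight T t k) else 0

/-- The law of coordinate `i` after step `k`, given the state `x` before the step. Unmasked
coordinates do not move. If a masked coordinate has to be unmasked although all its rates vanish
(possible in the last step only, where the normalization is `0/0`), the token is uniform. -/
def coordLaw {d S : ℕ} (N : ℕ) (T : ℝ) (t : ℕ → ℝ) (sHat : State d S → State d S → ℝ≥0)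
    (k : ℕ) (x : State d S) (i : Fin d) (b : Option (Fin S)) : ℝ :=
  match x i, b with
  | some c, b => if b = some c then 1 else 0
  | none, none => stayProb N T t sHat k x i
  | none, some a =>
      (if ∑ c, unmaskRate sHat x i c = 0 then (S : ℝ)⁻¹
        else unmaskRate sHat x i a / ∑ c, unmaskRate sHat x i c) *
      (1 - stayProb N T t sHat k x i)

/-- The law of the state `x_{t_k}` of the sampler; in each step all coordinates are drawn
independently given the current state. -/
def samplerMass {d S : ℕ} (N : ℕ) (T : ℝ) (t : ℕ → ℝ)
    (sHat : ℝ → State d S → State d S → ℝ≥0) : ℕ → State d S → ℝ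
  | 0 => initMass d S T
  | k + 1 => fun y => ∑ x, samplerMass N T t sHat k x *
      ∏ i, coordLaw N T t (sHat (T - t k)) k x i (y i)

/-- The measure with a given mass function on a finite type with all subsets measurable. -/
def massMeasure {Ω : Type*} [Fintype Ω] (μ : Ω → ℝ) : @MeasureTheory.Measure Ω ⊤ :=
  ∑ x, ENNReal.ofReal (μ x) • @MeasureTheory.Measure.dirac Ω ⊤ x

/-- `KL(q_data ‖ p_output)`, where `p_output` is the law of the output `x_{t_N}`. -/
def outputKL {d S : ℕ} (q : PMF (Fin d → Fin S)) (N : ℕ) (T : ℝ) (t : ℕ → ℝ)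
    (sHat : ℝ → State d S → State d S → ℝ≥0) : ℝ≥0∞ :=
  @InformationTheory.klDiv (State d S) ⊤ (massMeasure (dataMass q))
    (massMeasure (samplerMass N T t sHat N))

/-! ### Step size schedules -/

/-- Constant step size `T / N`. -/
def IsConstantSchedule (N : ℕ) (T : ℝ) (t : ℕ → ℝ) : Prop :=
  ∀ k < N, t (k + 1) - t k = T / N

/-- Exponential-then-constant step sizes: `t_{k+1} - t_k ≤ κ min(1, T - t_{k+1})` for
`0 ≤ k ≤ N - 2`, and `T - t_{N-1} = δ`. -/
def IsExpConstSchedule (N : ℕ) (T κ δ : ℝ) (t : ℕ → ℝ) : Prop :=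
  (∀ k, k + 1 < N → t (k + 1) - t k ≤ κ * min 1 (T - t (k + 1))) ∧ T - t (N - 1) = δ

end MaskingDiffusion

end

namespace MaskingDiffusion

/-! ### Laws and entropies -/

section Law

variable {Ω α β γ δ : Type*} [Fintype Ω] {μ : Ω → ℝ}

/-! At time t every token of the data has been kept, independently, with probability p = e^{-t}
(`marginal_eq`). So everything is governed by the set function U ↦ H(x^U) (`revealEntropy`) and by
its average φ(p) over a random set containing each coordinate with probability p (`bernAvg`). This φ
is a polynomial; φ' and -φ'' are the averages of the first and of the mixed second differences, and
submodularity of entropy makes φ concave on [0,1]. For t > 0 the information rate is ρ(t) = -e^{-2t}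
φ''(e^{-t}) (`infoAt_eq`). Explicit primitives give ∫ρ = φ(1) - φ(0) - φ'(1) = B and ∫(e^t - 1)ρ =
φ'(0) + φ(0) - φ(1) = C, so min(1,t) ≤ min(1, e^t - 1) yields D ≤ min(B, C).

For one reverse step from time u to v put p = e^{-u} < r = e^{-v}, and couple the two kept sets as U
⊆ V. The chain rule and data processing bound the growth of the relative entropy by two costs
(`relEntropy_step_le`). The first is that the tokens revealed together are dependent while the
sampler draws them independently: it equals (r-p)φ'(p) - (φ(r) - φ(p)), the gap at r between φ and
its tangent at p, which is ∫_v^u (e^{s-v} - 1)ρ(s) ds (`integral_curvRate_step`). The second is the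
error of the coordinate laws. The score is a conditional token probability divided by e^u - 1
(`score_eq`), and a tangent inequality for log((1 - e^{-x})/x) (`stay_move_log_le`) bounds this
error by e^{u-v} - 1 times the score entropy loss.

It remains to add up. The initial law costs at most e^{-T} d log S = ε. With h = u - v ≤ Δ₀, both
e^{s-v} - 1 and e^h - 1 are at most h e^{Δ₀}. Constant steps therefore cost at most (T/N) e^{Δ₀} B.
When h ≤ κ min(1, v), the cost is at most κ e^{Δ₀} D; the last step is outside this regime and is
bounded directly by its length times d log S, which is ε. Exponential-then-constant grids are
obtained by equal steps in a parameter z for which the remaining time is e^z up to z = 0 and 1 + z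
afterwards. -/

theorem law_eq [DecidableEq α] (μ : Ω → ℝ) (f : Ω → α) (a : α) :
    law μ f a = ∑ ω, if f ω = a then μ ω else 0 := by
  unfold law
  congr!

theorem law_nonneg (hμ : ∀ ω, 0 ≤ μ ω) (f : Ω → α) (a : α) : 0 ≤ law μ f a := by
  classical
  rw [law_eq]
  exact Finset.sum_nonneg fun ω _ => by split_ifs <;> simp [hμ]

theorem le_law (hμ : ∀ ω, 0 ≤ μ ω) (f : Ω → α) (ω : Ω) : μ ω ≤ law μ f (f ω) := by
  classical
  rw [law_eq]
  have := Finset.single_le_sum (f := fun ω' => if f ω' = f ω then μ ω' else 0)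
    (fun ω' _ => by split_ifs <;> simp [hμ]) (Finset.mem_univ ω)
  simpa using this

theorem law_pos (hμ : ∀ ω, 0 ≤ μ ω) (f : Ω → α) {ω : Ω} (h : 0 < μ ω) : 0 < law μ f (f ω) :=
  h.trans_le (le_law hμ f ω)

theorem law_congr {f : Ω → α} {g : Ω → β} {a : α} {b : β} (h : ∀ ω, f ω = a ↔ g ω = b) :
    law μ f a = law μ g b := by
  classical
  simp [law_eq, h]

theorem law_mono (hμ : ∀ ω, 0 ≤ μ ω) {f : Ω → α} {g : Ω → β} {a : α} {b : β}
    (h : ∀ ω, f ω = a → g ω = b) : law μ f a ≤ law μ g b := by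
  classical
  simp only [law_eq]
  refine Finset.sum_le_sum fun ω _ => ?_
  by_cases h1 : f ω = a
  · simp [h1, h ω h1]
  · simp only [h1, if_false]
    split_ifs <;> simp [hμ]

theorem exists_of_law_ne_zero {f : Ω → α} {a : α} (h : law μ f a ≠ 0) : ∃ ω, f ω = a ∧ μ ω ≠ 0 := by
  classical
  rw [law_eq] at h
  obtain ⟨ω, -, hω⟩ := Finset.exists_ne_zero_of_sum_ne_zero h
  refine ⟨ω, ?_⟩
  split_ifs at hω with h1
  · exact ⟨h1, hω⟩
  · exact absurd rfl hω

/-- The mass of a class, normalized, is at most one. -/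
theorem sum_div_law_le_one (hμ : ∀ ω, 0 ≤ μ ω) (f : Ω → α) (s : Finset Ω)
    (hs : ∀ ω ∈ s, ∀ ω' ∈ s, f ω' = f ω) : ∑ ω ∈ s, μ ω / law μ f (f ω) ≤ 1 := by
  classical
  rcases s.eq_empty_or_nonempty with rfl | ⟨ω₀, h0⟩
  · simp
  rw [Finset.sum_congr rfl fun ω hω => by rw [hs ω₀ h0 ω hω], ← Finset.sum_div]
  refine div_le_one_of_le₀ ?_ (law_nonneg hμ _ _)
  rw [law_eq, ← Finset.sum_filter]
  exact Finset.sum_le_sum_of_subset_of_nonneg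
    (fun ω hω => by simpa using hs ω₀ h0 ω hω) fun ω _ _ => hμ ω

variable [Fintype α] [Fintype β] [Fintype γ] [Fintype δ]

theorem sum_law_mul (μ : Ω → ℝ) (f : Ω → α) (g : α → ℝ) :
    ∑ a, law μ f a * g a = ∑ ω, μ ω * g (f ω) := by
  classical
  simp only [law_eq, Finset.sum_mul]
  rw [Finset.sum_comm]
  simp [ite_mul]

theorem sum_law (μ : Ω → ℝ) (f : Ω → α) : ∑ a, law μ f a = ∑ ω, μ ω := by
  simpa using sum_law_mul μ f fun _ => 1

/-- As an average over Ω the entropy visibly depends on `f` only through its level sets. All later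
comparisons are between such partitions, so variables with different codomains can be exchanged
freely. -/
theorem entropy_eq (μ : Ω → ℝ) (f : Ω → α) :
    entropy μ f = -∑ ω, μ ω * Real.log (law μ f (f ω)) := by
  rw [← sum_law_mul μ f fun a => Real.log (law μ f a), entropy, ← Finset.sum_neg_distrib]
  simp [Real.negMulLog]

theorem entropy_congr {f : Ω → α} {g : Ω → β} (h : ∀ ω ω', f ω' = f ω ↔ g ω' = g ω) :
    entropy μ f = entropy μ g := by
  rw [entropy_eq, entropy_eq]
  congr 1
  exact Finset.sum_congr rfl fun ω _ => by rw [law_congr (h ω)]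

theorem entropy_mono (hμ : ∀ ω, 0 ≤ μ ω) {f : Ω → α} {g : Ω → β}
    (h : ∀ ω ω', f ω' = f ω → g ω' = g ω) : entropy μ g ≤ entropy μ f := by
  rw [entropy_eq, entropy_eq, neg_le_neg_iff]
  refine Finset.sum_le_sum fun ω _ => ?_
  rcases (hμ ω).eq_or_lt with h0 | h0
  · simp [← h0]
  · exact mul_le_mul_of_nonneg_left
      (Real.log_le_log (law_pos hμ f h0) (law_mono hμ (h ω))) h0.le

theorem entropy_const (hμ1 : ∑ ω, μ ω = 1) {f : Ω → α} (h : ∀ ω ω', f ω' = f ω) :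
    entropy μ f = 0 := by
  classical
  rw [entropy_eq]
  have : ∀ ω, law μ f (f ω) = 1 := fun ω => by simp [law_eq, h ω, hμ1]
  simp [this]

theorem entropy_nonneg (hμ : ∀ ω, 0 ≤ μ ω) (hμ1 : ∑ ω, μ ω = 1) (f : Ω → α) :
    0 ≤ entropy μ f := by
  rw [← entropy_const (μ := μ) (f := fun _ => ()) hμ1 (by simp)]
  exact entropy_mono hμ (by simp)

theorem sum_law_pair {κ : Type*} (μ : Ω → ℝ) (f : Ω → α) (g : Ω → κ) (b : κ) :
    ∑ a, law μ (fun ω => (f ω, g ω)) (a, b) = law μ g b := by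
  classical
  simp only [law_eq, Prod.mk.injEq]
  rw [Finset.sum_comm]
  refine Finset.sum_congr rfl fun ω _ => ?_
  by_cases h : g ω = b <;> simp [h]

/-- Chain rule `H(f | g) = H(f, g) - H(g)`. -/
theorem condEntropy_eq (hμ : ∀ ω, 0 ≤ μ ω) (f : Ω → α) (g : Ω → β) :
    condEntropy μ f g = entropy μ (fun ω => (f ω, g ω)) - entropy μ g := by
  have key : ∀ b, law μ g b *
      ∑ a, Real.negMulLog (law μ (fun ω => (f ω, g ω)) (a, b) / law μ g b) =
      ∑ a, Real.negMulLog (law μ (fun ω => (f ω, g ω)) (a, b)) - Real.negMulLog (law μ g b) := by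
    intro b
    have hs := sum_law_pair μ f g b
    have hn : ∀ a, 0 ≤ law μ (fun ω => (f ω, g ω)) (a, b) := fun a => law_nonneg hμ _ _
    rcases eq_or_ne (law μ g b) 0 with h0 | h0
    · rw [h0] at hs ⊢
      have := (Finset.sum_eq_zero_iff_of_nonneg fun a _ => hn a).1 hs
      simp [fun a => this a (Finset.mem_univ a)]
    · rw [Finset.mul_sum]
      have : ∀ a, law μ g b * Real.negMulLog (law μ (fun ω => (f ω, g ω)) (a, b) / law μ g b) =
          Real.negMulLog (law μ (fun ω => (f ω, g ω)) (a, b)) +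
          law μ (fun ω => (f ω, g ω)) (a, b) * Real.log (law μ g b) := by
        intro a
        rcases eq_or_ne (law μ (fun ω => (f ω, g ω)) (a, b)) 0 with h1 | h1
        · simp [h1]
        · rw [Real.negMulLog, Real.negMulLog, Real.log_div h1 h0]
          field_simp
          ring
      simp only [this, Finset.sum_add_distrib, ← Finset.sum_mul, hs]
      rw [Real.negMulLog]
      ring
  rw [condEntropy, entropy, entropy, Fintype.sum_prod_type_right, ← Finset.sum_sub_distrib]
  exact Finset.sum_congr rfl fun b _ => key b

/-- Gibbs' inequality in the form used below. -/
theorem sum_mul_log_nonpos (hμ : ∀ ω, 0 ≤ μ ω) {r : Ω → ℝ} (hr : ∀ ω, 0 < μ ω → 0 < r ω)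
    (h : ∑ ω, μ ω * r ω ≤ ∑ ω, μ ω) : ∑ ω, μ ω * Real.log (r ω) ≤ 0 := by
  have : ∀ ω, μ ω * Real.log (r ω) ≤ μ ω * r ω - μ ω := by
    intro ω
    rcases (hμ ω).eq_or_lt with h0 | h0
    · simp [← h0]
    · have := Real.log_le_sub_one_of_pos (hr ω h0)
      nlinarith
  calc _ ≤ ∑ ω, (μ ω * r ω - μ ω) := Finset.sum_le_sum fun ω _ => this ω
    _ ≤ 0 := by rw [Finset.sum_sub_distrib]; linarith

/-- Shannon's inequality `H(F) + H(C) ≤ H(A) + H(B)`, where `F` is the join of `A` and `B`, and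
`C` is a function of `A` and of `B`. -/
theorem entropy_submodular (hμ : ∀ ω, 0 ≤ μ ω) {F : Ω → α} {A : Ω → β} {B : Ω → γ} {C : Ω → δ}
    (hF : ∀ ω ω', A ω' = A ω → B ω' = B ω → F ω' = F ω)
    (hA : ∀ ω ω', A ω' = A ω → C ω' = C ω) (hB : ∀ ω ω', B ω' = B ω → C ω' = C ω) :
    entropy μ F + entropy μ C ≤ entropy μ A + entropy μ B := by
  classical
  have pF : ∀ ω, 0 < μ ω → 0 < law μ F (F ω) := fun ω h => law_pos hμ F h
  have pA : ∀ ω, 0 < μ ω → 0 < law μ A (A ω) := fun ω h => law_pos hμ A h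
  have pB : ∀ ω, 0 < μ ω → 0 < law μ B (B ω) := fun ω h => law_pos hμ B h
  have pC : ∀ ω, 0 < μ ω → 0 < law μ C (C ω) := fun ω h => law_pos hμ C h
  have key : ∑ ω, μ ω * Real.log (law μ A (A ω) * law μ B (B ω) /
      (law μ F (F ω) * law μ C (C ω))) ≤ 0 := by
    refine sum_mul_log_nonpos hμ (fun ω h => div_pos (mul_pos (pA ω h) (pB ω h))
      (mul_pos (pF ω h) (pC ω h))) ?_
    -- The laws of `A` and `B` in the numerator are expanded over two independent copies ω₁, ω₂.
    have e1 : ∑ ω, μ ω * (law μ A (A ω) * law μ B (B ω) / (law μ F (F ω) * law μ C (C ω))) =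
        ∑ ω₁, ∑ ω₂, μ ω₁ * μ ω₂ * ∑ ω with A ω = A ω₁ ∧ B ω = B ω₂,
          μ ω / law μ F (F ω) / law μ C (C ω) := by
      have : ∀ ω, μ ω * (law μ A (A ω) * law μ B (B ω) / (law μ F (F ω) * law μ C (C ω))) =
          ∑ ω₁, ∑ ω₂, μ ω₁ * μ ω₂ * (if A ω = A ω₁ ∧ B ω = B ω₂ then
            μ ω / law μ F (F ω) / law μ C (C ω) else 0) := by
        intro ω
        have : ∀ ω₁ ω₂, μ ω₁ * μ ω₂ * (if A ω = A ω₁ ∧ B ω = B ω₂ then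
            μ ω / law μ F (F ω) / law μ C (C ω) else 0) =
            (if A ω₁ = A ω then μ ω₁ else 0) * (if B ω₂ = B ω then μ ω₂ else 0) *
              (μ ω / law μ F (F ω) / law μ C (C ω)) := by
          intro ω₁ ω₂
          by_cases h1 : A ω₁ = A ω <;> by_cases h2 : B ω₂ = B ω <;>
            simp [h1, h2, eq_comm (a := A ω), eq_comm (a := B ω)]
        simp only [this, ← Finset.sum_mul, ← Finset.mul_sum, ← law_eq]
        ring
      simp only [this, Finset.sum_filter, Finset.mul_sum]
      rw [Finset.sum_comm]
      exact Finset.sum_congr rfl fun _ _ => Finset.sum_comm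
    -- For fixed ω₁, ω₂ the admissible ω lie in a single class of `F`, so their normalized masses
    -- add up to at most 1; and if there is any, then `C` agrees on ω₁ and ω₂.
    have e2 : ∀ ω₁ ω₂, ∑ ω with A ω = A ω₁ ∧ B ω = B ω₂,
        μ ω / law μ F (F ω) / law μ C (C ω) ≤ if C ω₂ = C ω₁ then 1 / law μ C (C ω₁) else 0 := by
      intro ω₁ ω₂
      have hc : ∀ ω ∈ Finset.univ.filter (fun ω => A ω = A ω₁ ∧ B ω = B ω₂),
          C ω = C ω₁ ∧ C ω₂ = C ω₁ := by
        intro ω hω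
        simp only [Finset.mem_filter, Finset.mem_univ, true_and] at hω
        exact ⟨hA _ _ hω.1, (hB _ _ hω.2.symm).trans (hA _ _ hω.1)⟩
      rw [Finset.sum_congr rfl fun ω hω => by rw [(hc ω hω).1], ← Finset.sum_div]
      rcases (Finset.univ.filter (fun ω => A ω = A ω₁ ∧ B ω = B ω₂)).eq_empty_or_nonempty
        with he | ⟨ω, hω⟩
      · rw [he]
        simp only [Finset.sum_empty, zero_div]
        split_ifs
        · exact div_nonneg zero_le_one (law_nonneg hμ _ _)
        · exact le_rfl
      · rw [if_pos (hc ω hω).2]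
        refine div_le_div_of_nonneg_right ?_ (law_nonneg hμ _ _)
        refine sum_div_law_le_one hμ F _ fun ω hω ω' hω' => ?_
        simp only [Finset.mem_filter, Finset.mem_univ, true_and] at hω hω'
        exact hF _ _ (hω'.1.trans hω.1.symm) (hω'.2.trans hω.2.symm)
    rw [e1]
    calc _ ≤ ∑ ω₁, ∑ ω₂, μ ω₁ * μ ω₂ * (if C ω₂ = C ω₁ then 1 / law μ C (C ω₁) else 0) :=
          Finset.sum_le_sum fun ω₁ _ => Finset.sum_le_sum fun ω₂ _ =>
            mul_le_mul_of_nonneg_left (e2 ω₁ ω₂) (mul_nonneg (hμ _) (hμ _))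
      _ = ∑ ω₁, μ ω₁ * (law μ C (C ω₁) / law μ C (C ω₁)) := by
          refine Finset.sum_congr rfl fun ω₁ _ => ?_
          rw [law_eq μ C, Finset.sum_div, Finset.mul_sum]
          refine Finset.sum_congr rfl fun ω₂ _ => ?_
          split_ifs <;> ring
      _ ≤ ∑ ω₁, μ ω₁ := Finset.sum_le_sum fun ω₁ _ =>
          mul_le_of_le_one_right (hμ _) (div_self_le_one _)
  have e3 : ∑ ω, μ ω * Real.log (law μ A (A ω) * law μ B (B ω) /
      (law μ F (F ω) * law μ C (C ω))) =
      entropy μ F + entropy μ C - (entropy μ A + entropy μ B) := by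
    simp only [entropy_eq]
    have : ∀ ω, μ ω * Real.log (law μ A (A ω) * law μ B (B ω) /
      (law μ F (F ω) * law μ C (C ω))) = μ ω * Real.log (law μ A (A ω)) +
        μ ω * Real.log (law μ B (B ω)) - μ ω * Real.log (law μ F (F ω)) -
        μ ω * Real.log (law μ C (C ω)) := by
      intro ω
      rcases (hμ ω).eq_or_lt with h0 | h0
      · simp [← h0]
      · rw [Real.log_div (mul_pos (pA ω h0) (pB ω h0)).ne' (mul_pos (pF ω h0) (pC ω h0)).ne',
          Real.log_mul (pA ω h0).ne' (pB ω h0).ne', Real.log_mul (pF ω h0).ne' (pC ω h0).ne']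
        ring
    simp only [this, Finset.sum_sub_distrib, Finset.sum_add_distrib]
    ring
  linarith

/-- `H(F) ≤ H(C) + log |α|` if `F` is determined by `C` and an `α`-valued variable. -/
theorem entropy_le_add_log_card [Nonempty α] (hμ : ∀ ω, 0 ≤ μ ω) {F : Ω → β} {C : Ω → γ}
    {a : Ω → α} (hF : ∀ ω ω', a ω' = a ω → C ω' = C ω → F ω' = F ω) :
    entropy μ F ≤ entropy μ C + (∑ ω, μ ω) * Real.log (Fintype.card α) := by
  classical
  have hc : (0 : ℝ) < Fintype.card α := by exact_mod_cast Fintype.card_pos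
  have pF : ∀ ω, 0 < μ ω → 0 < law μ F (F ω) := fun ω h => law_pos hμ F h
  have pC : ∀ ω, 0 < μ ω → 0 < law μ C (C ω) := fun ω h => law_pos hμ C h
  have key : ∑ ω, μ ω * Real.log (law μ C (C ω) / (law μ F (F ω) * Fintype.card α)) ≤ 0 := by
    refine sum_mul_log_nonpos hμ (fun ω h => div_pos (pC ω h) (mul_pos (pF ω h) hc)) ?_
    -- Inside a class of `C`, each value of `a` singles out at most one class of `F`, contributing
    -- at most 1.
    have e2 : ∀ ω₁, ∑ ω with C ω₁ = C ω, μ ω / law μ F (F ω) ≤ Fintype.card α := by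
      intro ω₁
      rw [← Finset.sum_fiberwise _ a]
      refine (Finset.sum_le_sum (g := fun _ => (1 : ℝ)) fun v _ => ?_).trans (by simp)
      refine sum_div_law_le_one hμ F _ fun ω hω ω' hω' => ?_
      simp only [Finset.mem_filter, Finset.mem_univ, true_and] at hω hω'
      exact hF _ _ (hω'.2.trans hω.2.symm) (hω'.1.symm.trans hω.1)
    calc _ = ∑ ω₁, μ ω₁ * ((∑ ω with C ω₁ = C ω, μ ω / law μ F (F ω)) / Fintype.card α) := by
          simp only [law_eq μ C, Finset.sum_div, Finset.mul_sum, Finset.sum_filter]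
          rw [Finset.sum_comm]
          refine Finset.sum_congr rfl fun ω _ => Finset.sum_congr rfl fun ω' _ => ?_
          split_ifs
          · field_simp
          · simp
      _ ≤ ∑ ω₁, μ ω₁ := Finset.sum_le_sum fun ω₁ _ =>
          mul_le_of_le_one_right (hμ _) (div_le_one_of_le₀ (e2 ω₁) hc.le)
  have e3 : ∑ ω, μ ω * Real.log (law μ C (C ω) / (law μ F (F ω) * Fintype.card α)) =
      entropy μ F - entropy μ C - (∑ ω, μ ω) * Real.log (Fintype.card α) := by
    simp only [entropy_eq]
    have : ∀ ω, μ ω * Real.log (law μ C (C ω) / (law μ F (F ω) * Fintype.card α)) =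
        μ ω * Real.log (law μ C (C ω)) - μ ω * Real.log (law μ F (F ω)) -
        μ ω * Real.log (Fintype.card α) := by
      intro ω
      rcases (hμ ω).eq_or_lt with h0 | h0
      · simp [← h0]
      · rw [Real.log_div (pC ω h0).ne' (mul_pos (pF ω h0) hc).ne',
          Real.log_mul (pF ω h0).ne' hc.ne']
        ring
    simp only [this, Finset.sum_sub_distrib, ← Finset.sum_mul]
    ring
  linarith

/-- One step of the chain rule and data processing for the relative entropy: `(X, Y)` is compared
with the pair whose first entry has mass function `P` and whose transition kernel is `L`. -/
theorem sum_log_div_step_le (hμ : ∀ ω, 0 ≤ μ ω) (X : Ω → α) (Y : Ω → β) {P : α → ℝ}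
    {L : α → β → ℝ} (hP : ∀ x, 0 ≤ P x) (hL : ∀ x y, 0 ≤ L x y)
    (hac : ∀ ω, 0 < μ ω → 0 < P (X ω) ∧ 0 < L (X ω) (Y ω)) :
    ∑ ω, μ ω * Real.log (law μ Y (Y ω) / ∑ x, P x * L x (Y ω)) ≤
      ∑ ω, μ ω * Real.log (law μ X (X ω) / P (X ω)) +
      ∑ ω, μ ω * Real.log (law μ (fun ω => (X ω, Y ω)) (X ω, Y ω) /
        (law μ X (X ω) * L (X ω) (Y ω))) := by
  classical
  set R : β → ℝ := fun y => ∑ x, P x * L x y with hR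
  have hR0 : ∀ y, 0 ≤ R y := fun y => Finset.sum_nonneg fun x _ => mul_nonneg (hP x) (hL x y)
  have pR : ∀ ω, 0 < μ ω → 0 < R (Y ω) := fun ω h =>
    (mul_pos (hac ω h).1 (hac ω h).2).trans_le
      (Finset.single_le_sum (f := fun x => P x * L x (Y ω))
        (fun x _ => mul_nonneg (hP x) (hL x _)) (Finset.mem_univ (X ω)))
  set J : α × β → ℝ := law μ (fun ω => (X ω, Y ω)) with hJ
  have pJ : ∀ ω, 0 < μ ω → 0 < J (X ω, Y ω) := fun ω h => law_pos hμ (fun ω => (X ω, Y ω)) h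
  have pX : ∀ ω, 0 < μ ω → 0 < law μ X (X ω) := fun ω h => law_pos hμ X h
  have pY : ∀ ω, 0 < μ ω → 0 < law μ Y (Y ω) := fun ω h => law_pos hμ Y h
  -- The ratio compares the two backward conditional laws of X given Y, namely P·L/R for the model
  -- and J/law(Y) for the truth; the nonnegativity of their conditional relative entropy is what
  -- data processing discards.
  have key : ∑ ω, μ ω * Real.log (law μ Y (Y ω) * (P (X ω) * L (X ω) (Y ω)) /
      (R (Y ω) * J (X ω, Y ω))) ≤ 0 := by
    refine sum_mul_log_nonpos hμ (fun ω h => div_pos (mul_pos (pY ω h)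
      (mul_pos (hac ω h).1 (hac ω h).2)) (mul_pos (pR ω h) (pJ ω h))) ?_
    have := sum_law_mul μ (fun ω => (X ω, Y ω)) fun z : α × β =>
      law μ Y z.2 * (P z.1 * L z.1 z.2) / (R z.2 * J z)
    rw [← this, ← hJ, Fintype.sum_prod_type_right, ← sum_law μ Y]
    refine Finset.sum_le_sum fun y _ => ?_
    calc _ ≤ ∑ x, law μ Y y / R y * (P x * L x y) := by
          refine Finset.sum_le_sum fun x _ => ?_
          dsimp only
          rcases (law_nonneg hμ (fun ω => (X ω, Y ω)) (x, y)).eq_or_lt with h0 | h0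
          · rw [hJ, ← h0, zero_mul]
            exact mul_nonneg (div_nonneg (law_nonneg hμ _ _) (hR0 y)) (mul_nonneg (hP x) (hL x y))
          · rw [← hJ] at h0
            have := h0.ne'
            refine le_of_eq ?_
            rcases eq_or_ne (R y) 0 with h1 | h1
            · simp [h1]
            · field_simp
      _ = law μ Y y / R y * R y := by rw [← Finset.mul_sum]
      _ ≤ law μ Y y := by
          rw [div_mul_eq_mul_div, mul_div_assoc]
          exact mul_le_of_le_one_right (law_nonneg hμ _ _) (div_self_le_one _)
  have e3 : ∑ ω, μ ω * Real.log (law μ Y (Y ω) * (P (X ω) * L (X ω) (Y ω)) /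
      (R (Y ω) * J (X ω, Y ω))) = ∑ ω, μ ω * Real.log (law μ Y (Y ω) / R (Y ω)) -
      ∑ ω, μ ω * Real.log (law μ X (X ω) / P (X ω)) -
      ∑ ω, μ ω * Real.log (J (X ω, Y ω) / (law μ X (X ω) * L (X ω) (Y ω))) := by
    rw [← Finset.sum_sub_distrib, ← Finset.sum_sub_distrib]
    refine Finset.sum_congr rfl fun ω _ => ?_
    rcases (hμ ω).eq_or_lt with h0 | h0
    · simp [← h0]
    have h1 := (pY ω h0).ne'
    have h2 := (pX ω h0).ne'
    have h3 := (pJ ω h0).ne'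
    have h4 := (pR ω h0).ne'
    have h5 := (hac ω h0).1.ne'
    have h6 := (hac ω h0).2.ne'
    rw [Real.log_div (mul_ne_zero h1 (mul_ne_zero h5 h6)) (mul_ne_zero h4 h3),
      Real.log_mul h1 (mul_ne_zero h5 h6), Real.log_mul h5 h6, Real.log_mul h4 h3,
      Real.log_div h1 h4, Real.log_div h2 h5, Real.log_div h3 (mul_ne_zero h2 h6),
      Real.log_mul h2 h6]
    ring
  linarith

end Law

/-! ### Averages of set functions over Bernoulli random sets -/

section Bernoulli

variable {ι : Type*} [Fintype ι] [DecidableEq ι]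

theorem sum_prod_ite_mem {R : Type*} [CommSemiring R] (f g : ι → R) :
    ∑ U : Finset ι, ∏ i, (if i ∈ U then f i else g i) = ∏ i, (f i + g i) := by
  rw [Finset.prod_add, Finset.powerset_univ]
  refine Finset.sum_congr rfl fun U _ => ?_
  rw [Finset.prod_ite]
  congr 1
  · exact Finset.prod_congr (by ext; simp) fun _ _ => rfl
  · exact Finset.prod_congr (by ext; simp) fun _ _ => rfl

theorem sum_prod_ite_mem_mul {R : Type*} [CommSemiring R] (f g : ι → R) (i : ι) (a b : R) :
    ∑ U : Finset ι, (∏ j, if j ∈ U then f j else g j) * (if i ∈ U then a else b) =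
      (f i * a + g i * b) * ∏ j ∈ Finset.univ.erase i, (f j + g j) := by
  have : ∀ U : Finset ι, (∏ j, if j ∈ U then f j else g j) * (if i ∈ U then a else b) =
      ∏ j, if j ∈ U then Function.update f i (f i * a) j else
        Function.update g i (g i * b) j := by
    intro U
    rw [← Finset.mul_prod_erase _ _ (Finset.mem_univ i),
      ← Finset.mul_prod_erase _ (fun j => if j ∈ U then Function.update f i (f i * a) j else
        Function.update g i (g i * b) j) (Finset.mem_univ i)]
    have e : ∏ j ∈ Finset.univ.erase i, (if j ∈ U then Function.update f i (f i * a) j else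
        Function.update g i (g i * b) j) =
        ∏ j ∈ Finset.univ.erase i, (if j ∈ U then f j else g j) :=
      Finset.prod_congr rfl fun j hj => by
        rw [Function.update_of_ne (Finset.ne_of_mem_erase hj),
          Function.update_of_ne (Finset.ne_of_mem_erase hj)]
    rw [e]
    simp only [Function.update_self]
    split_ifs <;> ring
  rw [Finset.sum_congr rfl fun U _ => this U, sum_prod_ite_mem,
    ← Finset.mul_prod_erase _ _ (Finset.mem_univ i)]
  simp only [Function.update_self]
  congr 1
  exact Finset.prod_congr rfl fun j hj => by
    rw [Function.update_of_ne (Finset.ne_of_mem_erase hj),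
      Function.update_of_ne (Finset.ne_of_mem_erase hj)]

theorem sum_finset_eq_sum_notMem {M : Type*} [AddCommMonoid M] (i : ι) (f : Finset ι → M) :
    ∑ U, f U = ∑ U : Finset ι with i ∉ U, (f U + f (insert i U)) := by
  rw [← Finset.sum_filter_add_sum_filter_not Finset.univ (fun U : Finset ι => i ∉ U),
    Finset.sum_add_distrib]
  congr 1
  refine Finset.sum_nbij' (fun U => U.erase i) (fun U => insert i U) ?_ ?_ ?_ ?_ ?_
  · intro U _; simp
  · intro U _; simp
  · intro U hU
    simp only [Finset.mem_filter, Finset.mem_univ, true_and, not_not] at hU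
    exact Finset.insert_erase hU
  · intro U hU
    simp only [Finset.mem_filter, Finset.mem_univ, true_and] at hU
    exact Finset.erase_insert hU
  · intro U hU
    simp only [Finset.mem_filter, Finset.mem_univ, true_and, not_not] at hU
    rw [Finset.insert_erase hU]

/-- The probability of `U` under independent inclusions with probability `p`. -/
def bern (p : ℝ) (U : Finset ι) : ℝ := ∏ i, if i ∈ U then p else 1 - p

/-- The average of `f` over the random set that contains each element with probability `p`. -/
def bernAvg (p : ℝ) (f : Finset ι → ℝ) : ℝ := ∑ U, bern p U * f U

/-- The discrete derivative of a set function, summed over all directions. -/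
def discDeriv (f : Finset ι → ℝ) (U : Finset ι) : ℝ := ∑ i, (f (insert i U) - f (U.erase i))

theorem bern_nonneg {p : ℝ} (h0 : 0 ≤ p) (h1 : p ≤ 1) (U : Finset ι) : 0 ≤ bern p U :=
  Finset.prod_nonneg fun i _ => by split_ifs <;> linarith

theorem bern_pos {p : ℝ} (h0 : 0 < p) (h1 : p < 1) (U : Finset ι) : 0 < bern p U :=
  Finset.prod_pos fun i _ => by split_ifs <;> linarith

theorem sum_bern (p : ℝ) : ∑ U : Finset ι, bern p U = 1 := by
  simp only [bern]
  rw [sum_prod_ite_mem (fun _ => p) fun _ => 1 - p]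
  simp

theorem sum_bern_mul_ite (p : ℝ) (i : ι) (a b : ℝ) :
    ∑ U : Finset ι, bern p U * (if i ∈ U then a else b) = p * a + (1 - p) * b := by
  simp only [bern]
  rw [sum_prod_ite_mem_mul (fun _ => p) (fun _ => 1 - p)]
  simp

theorem bernAvg_card (p : ℝ) : bernAvg p (fun U : Finset ι => (U.card : ℝ)) = p * Fintype.card ι := by
  have : ∀ U : Finset ι, (U.card : ℝ) = ∑ i, if i ∈ U then 1 else 0 := by simp
  simp only [bernAvg, this, Finset.mul_sum]
  rw [Finset.sum_comm]
  simp only [sum_bern_mul_ite]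
  simp [mul_comm]

theorem bernAvg_one (f : Finset ι → ℝ) : bernAvg 1 f = f Finset.univ := by
  rw [bernAvg, Finset.sum_eq_single Finset.univ]
  · simp [bern]
  · intro U _ hU
    obtain ⟨i, hi⟩ : ∃ i, i ∉ U := by
      by_contra! h
      exact hU (Finset.eq_univ_iff_forall.2 h)
    have : bern 1 U = 0 := Finset.prod_eq_zero (Finset.mem_univ i) (by simp [hi])
    simp [this]
  · simp

theorem bernAvg_zero (f : Finset ι → ℝ) : bernAvg 0 f = f ∅ := by
  rw [bernAvg, Finset.sum_eq_single ∅]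
  · simp [bern]
  · intro U _ hU
    obtain ⟨i, hi⟩ := Finset.nonempty_iff_ne_empty.2 hU
    have : bern 0 U = 0 := Finset.prod_eq_zero (Finset.mem_univ i) (by simp [hi])
    simp [this]
  · simp

theorem bernAvg_neg (p : ℝ) (f : Finset ι → ℝ) : bernAvg p (fun U => -f U) = -bernAvg p f := by
  simp [bernAvg]

theorem bernAvg_mono {p : ℝ} (h0 : 0 ≤ p) (h1 : p ≤ 1) {f g : Finset ι → ℝ} (h : ∀ U, f U ≤ g U) :
    bernAvg p f ≤ bernAvg p g :=
  Finset.sum_le_sum fun U _ => mul_le_mul_of_nonneg_left (h U) (bern_nonneg h0 h1 U)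

theorem bernAvg_const (p c : ℝ) : bernAvg p (fun _ : Finset ι => c) = c := by
  rw [bernAvg, ← Finset.sum_mul, sum_bern, one_mul]

theorem bernAvg_nonneg {p : ℝ} (h0 : 0 ≤ p) (h1 : p ≤ 1) {f : Finset ι → ℝ} (h : ∀ U, 0 ≤ f U) :
    0 ≤ bernAvg p f :=
  Finset.sum_nonneg fun U _ => mul_nonneg (bern_nonneg h0 h1 U) (h U)

theorem bern_eq_mul (p : ℝ) (i : ι) (U : Finset ι) : bern p U =
    (if i ∈ U then p else 1 - p) * ∏ j ∈ Finset.univ.erase i, (if j ∈ U then p else 1 - p) :=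
  (Finset.mul_prod_erase _ _ (Finset.mem_univ i)).symm

/-- The average does not see the distinction of the sets with and without `i`. -/
theorem bernAvg_insert_sub_erase (p : ℝ) (f : Finset ι → ℝ) (i : ι) :
    ∑ U, bern p U * (f (insert i U) - f (U.erase i)) =
      ∑ U, (∏ j ∈ Finset.univ.erase i, if j ∈ U then p else 1 - p) *
        (if i ∈ U then 1 else -1) * f U := by
  rw [sum_finset_eq_sum_notMem i, sum_finset_eq_sum_notMem i]
  refine Finset.sum_congr rfl fun U hU => ?_
  simp only [Finset.mem_filter, Finset.mem_univ, true_and] at hU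
  have e : ∏ j ∈ Finset.univ.erase i, (if j ∈ insert i U then p else 1 - p) =
      ∏ j ∈ Finset.univ.erase i, (if j ∈ U then p else 1 - p) :=
    Finset.prod_congr rfl fun j hj => by simp [Finset.ne_of_mem_erase hj]
  rw [bern_eq_mul p i U, bern_eq_mul p i (insert i U), e]
  simp only [hU, Finset.mem_insert_self, if_true, if_false, Finset.insert_idem,
    Finset.erase_insert hU, Finset.erase_eq_of_notMem hU]
  ring

/-- The weight is affine in the inclusion probability of each coordinate. Differentiating the factor
of `i` leaves ±1, that is, the difference of `f` with and without `i`, which no longer depends on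
whether `i` lies in the set. -/
theorem hasDerivAt_bernAvg (f : Finset ι → ℝ) (p : ℝ) :
    HasDerivAt (fun p => bernAvg p f) (bernAvg p (discDeriv f)) p := by
  have h : ∀ U : Finset ι, HasDerivAt (fun p => bern p U * f U)
      ((∑ i, (∏ j ∈ Finset.univ.erase i, if j ∈ U then p else 1 - p) *
        (if i ∈ U then 1 else -1)) * f U) p := by
    intro U
    refine HasDerivAt.mul_const ?_ _
    refine HasDerivAt.fun_finsetProd (f := fun i p => if i ∈ U then p else 1 - p)
      (f' := fun i => if i ∈ U then 1 else -1) fun i _ => ?_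
    split_ifs
    · exact hasDerivAt_id p
    · exact (hasDerivAt_id p).const_sub 1
  have := HasDerivAt.fun_sum (u := Finset.univ) fun U _ => h U
  refine this.congr_deriv (Eq.symm ?_)
  simp only [bernAvg, discDeriv, Finset.mul_sum, Finset.sum_mul]
  rw [Finset.sum_comm]
  exact Eq.trans (Finset.sum_congr rfl fun i _ => bernAvg_insert_sub_erase p f i) Finset.sum_comm

/-- The second difference of a set function in the directions `i` and `j`, with the sign that
makes it nonnegative for submodular functions. -/
def secondDiff (f : Finset ι → ℝ) (i j : ι) (U : Finset ι) : ℝ :=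
  f (insert i (U.erase j)) + f (insert j (U.erase i)) - f ((U.erase i).erase j) -
    f (insert i (insert j U))

/-- The sum of all second differences in two distinct directions. -/
def curvature (f : Finset ι → ℝ) (U : Finset ι) : ℝ :=
  ∑ i, ∑ j, if i ≠ j then secondDiff f i j U else 0

/-- A first difference in direction `i` does not depend on the membership of `i`, so differencing
again in the same direction gives 0 and only mixed pairs survive. -/
theorem discDeriv_discDeriv (f : Finset ι → ℝ) (U : Finset ι) :
    discDeriv (discDeriv f) U = -curvature f U := by
  simp only [discDeriv, curvature, ← Finset.sum_sub_distrib, ← Finset.sum_neg_distrib]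
  refine Finset.sum_congr rfl fun i _ => Finset.sum_congr rfl fun j _ => ?_
  by_cases h : i = j
  · subst h
    have : insert i (U.erase i) = insert i U := by ext; simp; tauto
    simp [this]
  · rw [if_pos h, secondDiff, Finset.erase_insert_of_ne h, Finset.insert_comm j i]
    ring

theorem hasDerivAt_bernAvg_discDeriv (f : Finset ι → ℝ) (p : ℝ) :
    HasDerivAt (fun p => bernAvg p (discDeriv f)) (-bernAvg p (curvature f)) p := by
  have := hasDerivAt_bernAvg (discDeriv f) p
  rwa [funext (discDeriv_discDeriv f), bernAvg_neg] at this

theorem continuous_bernAvg (f : Finset ι → ℝ) : Continuous fun p => bernAvg p f :=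
  continuous_iff_continuousAt.2 fun p => (hasDerivAt_bernAvg f p).continuousAt

/-- The curvature rate `e^{-2t} J(e^{-t})`, with `J` the average of the curvature. -/
noncomputable def curvRate (f : Finset ι → ℝ) (t : ℝ) : ℝ :=
  Real.exp (-t) ^ 2 * bernAvg (Real.exp (-t)) (curvature f)

theorem continuous_curvRate (f : Finset ι → ℝ) : Continuous (curvRate f) := by
  unfold curvRate
  have := (continuous_bernAvg (curvature f)).comp (Real.continuous_exp.comp continuous_neg)
  exact ((Real.continuous_exp.comp continuous_neg).pow 2).mul this

theorem curvRate_nonneg {f : Finset ι → ℝ} (hf : ∀ U, 0 ≤ curvature f U) {t : ℝ} (ht : 0 ≤ t) :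
    0 ≤ curvRate f t :=
  mul_nonneg (sq_nonneg _)
    (bernAvg_nonneg (Real.exp_pos _).le (Real.exp_le_one_iff.2 (by linarith)) hf)

/-- The primitive from which all integrals of the curvature rate are computed. -/
theorem hasDerivAt_curvRate_primitive (f : Finset ι → ℝ) (a b t : ℝ) :
    HasDerivAt (fun t => (a + b * Real.exp (-t)) * bernAvg (Real.exp (-t)) (discDeriv f) -
        b * bernAvg (Real.exp (-t)) f)
      ((a * Real.exp t + b) * curvRate f t) t := by
  have he : HasDerivAt (fun t : ℝ => Real.exp (-t)) (-Real.exp (-t)) t := by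
    simpa using (hasDerivAt_neg t).exp
  have h1 := (hasDerivAt_bernAvg f (Real.exp (-t))).comp t he
  have h2 := (hasDerivAt_bernAvg_discDeriv f (Real.exp (-t))).comp t he
  have h3 := (((he.const_mul b).const_add a).mul h2).sub (h1.const_mul b)
  refine h3.congr_deriv ?_
  have e : Real.exp t * Real.exp (-t) = 1 := by rw [← Real.exp_add]; simp
  simp only [curvRate, Function.comp]
  linear_combination (-a * Real.exp (-t) * bernAvg (Real.exp (-t)) (curvature f)) * e

/-- The discretization cost of a step from `u` down to `v`. -/
theorem integral_curvRate_step (f : Finset ι → ℝ) (u v : ℝ) :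
    ∫ t in v..u, (Real.exp (t - v) - 1) * curvRate f t =
      (Real.exp (-v) - Real.exp (-u)) * bernAvg (Real.exp (-u)) (discDeriv f) -
        (bernAvg (Real.exp (-v)) f - bernAvg (Real.exp (-u)) f) := by
  have h : ∀ t, (Real.exp (t - v) - 1) * curvRate f t =
      (Real.exp (-v) * Real.exp t + -1) * curvRate f t := by
    intro t
    rw [sub_eq_add_neg t v, Real.exp_add]
    ring
  simp only [h]
  rw [intervalIntegral.integral_eq_sub_of_hasDerivAt
    (fun t _ => hasDerivAt_curvRate_primitive f (Real.exp (-v)) (-1) t)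
    (Continuous.intervalIntegrable (by have := continuous_curvRate f; fun_prop) _ _)]
  ring

theorem tendsto_curvRate_primitive (f : Finset ι → ℝ) (a b : ℝ) :
    Filter.Tendsto (fun t => (a + b * Real.exp (-t)) * bernAvg (Real.exp (-t)) (discDeriv f) -
        b * bernAvg (Real.exp (-t)) f) Filter.atTop
      (nhds (a * discDeriv f ∅ - b * f ∅)) := by
  have he : Filter.Tendsto (fun t : ℝ => Real.exp (-t)) Filter.atTop (nhds 0) :=
    Real.tendsto_exp_neg_atTop_nhds_zero
  have h1 := ((continuous_bernAvg f).tendsto 0).comp he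
  have h2 := ((continuous_bernAvg (discDeriv f)).tendsto 0).comp he
  rw [bernAvg_zero] at h1 h2
  have := ((((he.const_mul b).const_add a).mul h2).sub (h1.const_mul b))
  simpa using this

theorem integrableOn_curvRate_mul {f : Finset ι → ℝ} (hf : ∀ U, 0 ≤ curvature f U) {a b : ℝ}
    (hab : ∀ t, 0 < t → 0 ≤ a * Real.exp t + b) :
    MeasureTheory.IntegrableOn (fun t => (a * Real.exp t + b) * curvRate f t) (Set.Ioi 0) :=
  MeasureTheory.integrableOn_Ioi_deriv_of_nonneg'
    (fun t _ => hasDerivAt_curvRate_primitive f a b t)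
    (fun t (ht : 0 < t) => mul_nonneg (hab t ht) (curvRate_nonneg hf ht.le))
    (tendsto_curvRate_primitive f a b)

/-- The boundary terms sit at p = 1 (t = 0) and p = 0 (t = ∞). The choices (a, b) = (0, 1) and (1,
-1), i.e. the weights 1 and e^t - 1, produce the dual total correlation and the total correlation.
-/
theorem integral_curvRate_mul {f : Finset ι → ℝ} (hf : ∀ U, 0 ≤ curvature f U) {a b : ℝ}
    (hab : ∀ t, 0 < t → 0 ≤ a * Real.exp t + b) :
    ∫ t in Set.Ioi 0, (a * Real.exp t + b) * curvRate f t =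
      a * discDeriv f ∅ - b * f ∅ - ((a + b) * discDeriv f Finset.univ - b * f Finset.univ) := by
  rw [MeasureTheory.integral_Ioi_of_hasDerivAt_of_nonneg'
    (fun t _ => hasDerivAt_curvRate_primitive f a b t)
    (fun t (ht : 0 < t) => mul_nonneg (hab t ht) (curvRate_nonneg hf ht.le))
    (tendsto_curvRate_primitive f a b)]
  simp [bernAvg_one]

theorem integrableOn_curvRate {f : Finset ι → ℝ} (hf : ∀ U, 0 ≤ curvature f U) :
    MeasureTheory.IntegrableOn (curvRate f) (Set.Ioi 0) := by
  simpa using integrableOn_curvRate_mul (a := 0) (b := 1) hf (by simp)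

theorem integral_curvRate {f : Finset ι → ℝ} (hf : ∀ U, 0 ≤ curvature f U) :
    ∫ t in Set.Ioi 0, curvRate f t = f Finset.univ - f ∅ - discDeriv f Finset.univ := by
  have := integral_curvRate_mul (a := 0) (b := 1) hf (by simp)
  simp only [zero_mul, zero_add, one_mul] at this
  rw [this]
  ring

theorem integrableOn_min_mul_curvRate {f : Finset ι → ℝ} (hf : ∀ U, 0 ≤ curvature f U) :
    MeasureTheory.IntegrableOn (fun t => min 1 t * curvRate f t) (Set.Ioi 0) := by
  refine (integrableOn_curvRate hf).mono' ?_ ?_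
  · exact ((continuous_const.min continuous_id).mul (continuous_curvRate f)).aestronglyMeasurable
  · refine (MeasureTheory.ae_restrict_iff' measurableSet_Ioi).2 (.of_forall fun t (ht : 0 < t) => ?_)
    have h1 := curvRate_nonneg hf ht.le
    rw [Real.norm_of_nonneg (mul_nonneg (le_min zero_le_one ht.le) h1)]
    exact mul_le_of_le_one_left h1 (min_le_left _ _)

theorem integral_min_mul_curvRate_le_left {f : Finset ι → ℝ} (hf : ∀ U, 0 ≤ curvature f U) :
    ∫ t in Set.Ioi 0, min 1 t * curvRate f t ≤
      f Finset.univ - f ∅ - discDeriv f Finset.univ := by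
  rw [← integral_curvRate hf]
  refine MeasureTheory.setIntegral_mono_on (integrableOn_min_mul_curvRate hf)
    (integrableOn_curvRate hf) measurableSet_Ioi fun t (ht : 0 < t) => ?_
  exact mul_le_of_le_one_left (curvRate_nonneg hf ht.le) (min_le_left _ _)

/-- Here min(1, t) ≤ t ≤ e^t - 1, and the weight e^t - 1 has an exactly computable integral. -/
theorem integral_min_mul_curvRate_le_right {f : Finset ι → ℝ} (hf : ∀ U, 0 ≤ curvature f U) :
    ∫ t in Set.Ioi 0, min 1 t * curvRate f t ≤
      discDeriv f ∅ + f ∅ - f Finset.univ := by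
  have h0 : ∀ t : ℝ, 0 < t → 0 ≤ 1 * Real.exp t + -1 := fun t ht => by
    have := Real.add_one_le_exp t
    linarith
  have := integral_curvRate_mul (a := 1) (b := -1) hf h0
  calc _ ≤ ∫ t in Set.Ioi 0, (1 * Real.exp t + -1) * curvRate f t := by
        refine MeasureTheory.setIntegral_mono_on (integrableOn_min_mul_curvRate hf)
          (integrableOn_curvRate_mul hf h0) measurableSet_Ioi fun t (ht : 0 < t) => ?_
        refine mul_le_mul_of_nonneg_right ?_ (curvRate_nonneg hf ht.le)
        have := Real.add_one_le_exp t
        exact (min_le_right _ _).trans (by linarith)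
    _ = _ := by rw [this]; ring

end Bernoulli

/-! ### The marginals of the masking process -/

section Marginal

variable {d S : ℕ}

theorem massOf_nonneg (q : PMF (Fin d → Fin S)) (z : Fin d → Fin S) : 0 ≤ massOf q z :=
  ENNReal.toReal_nonneg

theorem sum_massOf (q : PMF (Fin d → Fin S)) : ∑ z, massOf q z = 1 := by
  simp only [massOf]
  rw [← ENNReal.toReal_sum fun z _ => q.apply_ne_top z, ← tsum_fintype (L := .unconditional _),
    q.tsum_coe, ENNReal.toReal_one]

/-- The state showing the entries of `z` in `U` and masks elsewhere. -/
def reveal (U : Finset (Fin d)) (z : Fin d → Fin S) : State d S :=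
  fun i => if i ∈ U then some (z i) else none

/-- The unmasked coordinates of a state. -/
def unmasked (x : State d S) : Finset (Fin d) := Finset.univ.filter fun i => x i ≠ none

@[simp]
theorem mem_unmasked (x : State d S) (i : Fin d) : i ∈ unmasked x ↔ x i ≠ none := by
  simp [unmasked]

@[simp]
theorem unmasked_reveal (U : Finset (Fin d)) (z : Fin d → Fin S) : unmasked (reveal U z) = U := by
  ext i
  simp [reveal]

theorem reveal_of_mem {U : Finset (Fin d)} {i : Fin d} (h : i ∈ U) (z : Fin d → Fin S) :
    reveal U z i = some (z i) := if_pos h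

theorem reveal_of_notMem {U : Finset (Fin d)} {i : Fin d} (h : i ∉ U) (z : Fin d → Fin S) :
    reveal U z i = none := if_neg h

theorem reveal_eq_iff (U V : Finset (Fin d)) (z z' : Fin d → Fin S) :
    reveal U z = reveal V z' ↔ U = V ∧ ∀ i ∈ U, z i = z' i := by
  constructor
  · intro h
    have : U = V := by rw [← unmasked_reveal U z, h, unmasked_reveal]
    subst this
    refine ⟨rfl, fun i hi => ?_⟩
    have := congrFun h i
    rw [reveal_of_mem hi, reveal_of_mem hi] at this
    exact Option.some_injective _ this
  · rintro ⟨rfl, h⟩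
    funext i
    by_cases hi : i ∈ U
    · rw [reveal_of_mem hi, reveal_of_mem hi, h i hi]
    · rw [reveal_of_notMem hi, reveal_of_notMem hi]

theorem reveal_insert (U : Finset (Fin d)) (i : Fin d) (z : Fin d → Fin S) :
    reveal (insert i U) z = Function.update (reveal U z) i (some (z i)) := by
  funext j
  by_cases h : j = i
  · subst h
    simp [reveal]
  · simp [reveal, h]

/-- The law of a noised token that was `c`, if tokens are kept with probability `p`. -/
def tokenLaw (p : ℝ) (c : Fin S) (b : Option (Fin S)) : ℝ :=
  if b = none then 1 - p else if b = some c then p else 0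

/-- The joint mass function of the data and of the random set of coordinates that are kept. -/
def jointMass (q : PMF (Fin d → Fin S)) (p : ℝ) (ω : (Fin d → Fin S) × Finset (Fin d)) : ℝ :=
  massOf q ω.1 * bern p ω.2

/-- The law of the state in which each token of the data is kept with probability `p`. -/
def keptMass (q : PMF (Fin d → Fin S)) (p : ℝ) (x : State d S) : ℝ :=
  ∑ z, massOf q z * ∏ i, tokenLaw p (z i) (x i)

theorem prod_tokenLaw (p : ℝ) (z : Fin d → Fin S) (x : State d S) :
    ∏ i, tokenLaw p (z i) (x i) =
      if reveal (unmasked x) z = x then bern p (unmasked x) else 0 := by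
  split_ifs with h
  · refine Finset.prod_congr rfl fun i _ => ?_
    by_cases hi : i ∈ unmasked x
    · have h1 : x i = some (z i) := by rw [← h, reveal_of_mem hi]
      simp [tokenLaw, h1]
    · have h1 : x i = none := by simpa using hi
      simp [tokenLaw, h1]
  · obtain ⟨i, hi⟩ : ∃ i, reveal (unmasked x) z i ≠ x i := by
      by_contra! hc
      exact h (funext hc)
    refine Finset.prod_eq_zero (Finset.mem_univ i) ?_
    by_cases h1 : x i = none
    · exact absurd (by rw [h1, reveal_of_notMem (by simpa using h1)]) hi
    · rw [reveal_of_mem (by simpa using h1)] at hi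
      simp [tokenLaw, h1, Ne.symm hi]

theorem keptMass_eq (q : PMF (Fin d → Fin S)) (p : ℝ) (x : State d S) :
    keptMass q p x = bern p (unmasked x) * law (massOf q) (reveal (unmasked x)) x := by
  simp only [keptMass, prod_tokenLaw, law_eq, Finset.mul_sum]
  refine Finset.sum_congr rfl fun z _ => ?_
  split_ifs <;> ring

theorem law_jointMass (q : PMF (Fin d → Fin S)) (p : ℝ) (x : State d S) :
    law (jointMass q p) (fun ω => reveal ω.2 ω.1) x = keptMass q p x := by
  rw [keptMass_eq, law_eq, law_eq, Fintype.sum_prod_type_right, Finset.mul_sum,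
    Finset.sum_eq_single (unmasked x)]
  · refine Finset.sum_congr rfl fun z _ => ?_
    simp only [jointMass]
    split_ifs <;> ring
  · intro U _ hU
    refine Finset.sum_eq_zero fun z _ => if_neg fun h => hU ?_
    rw [← h, unmasked_reveal]
  · simp

theorem jointMass_nonneg (q : PMF (Fin d → Fin S)) {p : ℝ} (h0 : 0 ≤ p) (h1 : p ≤ 1)
    (ω : (Fin d → Fin S) × Finset (Fin d)) : 0 ≤ jointMass q p ω :=
  mul_nonneg (massOf_nonneg q _) (bern_nonneg h0 h1 _)

theorem keptMass_nonneg (q : PMF (Fin d → Fin S)) {p : ℝ} (h0 : 0 ≤ p) (h1 : p ≤ 1)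
    (x : State d S) : 0 ≤ keptMass q p x := by
  rw [← law_jointMass]
  exact law_nonneg (jointMass_nonneg q h0 h1) _ _

theorem sum_keptMass_mul (q : PMF (Fin d → Fin S)) (p : ℝ) (g : State d S → ℝ) :
    ∑ x, keptMass q p x * g x = ∑ z, massOf q z * ∑ U, bern p U * g (reveal U z) := by
  have := sum_law_mul (jointMass q p) (fun ω => reveal ω.2 ω.1) g
  simp only [law_jointMass] at this
  rw [this, Fintype.sum_prod_type]
  simp only [jointMass, Finset.mul_sum]
  exact Finset.sum_congr rfl fun z _ => Finset.sum_congr rfl fun U _ => by ring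

theorem sum_keptMass (q : PMF (Fin d → Fin S)) (p : ℝ) : ∑ x, keptMass q p x = 1 := by
  simpa [sum_bern, sum_massOf] using sum_keptMass_mul q p fun _ => 1

theorem keptMass_one (q : PMF (Fin d → Fin S)) : keptMass q 1 = dataMass q := by
  funext x
  simp only [keptMass, dataMass]
  refine Finset.sum_congr rfl fun z _ => ?_
  split_ifs with h
  · subst h
    simp [tokenLaw]
  · obtain ⟨i, hi⟩ : ∃ i, x i ≠ some (z i) := by
      by_contra! hc
      exact h (funext hc)
    rw [Finset.prod_eq_zero (Finset.mem_univ i) (by simp [tokenLaw, hi]), mul_zero]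

/-! ### The generator in coordinates and the forward equation -/

theorem sum_ite_eq_off {M : Type*} [AddCommMonoid M] (y : State d S) (i : Fin d)
    (g : State d S → M) :
    ∑ x : State d S, (if ∀ j, j ≠ i → x j = y j then g x else 0) =
      ∑ b, g (Function.update y i b) := by
  rw [← Finset.sum_filter]
  refine Finset.sum_nbij' (fun x => x i) (fun b => Function.update y i b) ?_ ?_ ?_ ?_ ?_
  · intro x _; simp
  · intro b _
    simp +contextual [Function.update_of_ne]
  · intro x hx
    simp only [Finset.mem_filter, Finset.mem_univ, true_and] at hx
    funext j
    by_cases h : j = i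
    · subst h; simp
    · rw [Function.update_of_ne h, hx j h]
  · intro b _; simp
  · intro x hx
    simp only [Finset.mem_filter, Finset.mem_univ, true_and] at hx
    congr 1
    funext j
    by_cases h : j = i
    · subst h; simp
    · rw [Function.update_of_ne h, hx j h]

/-- Replacing the Hamming distance condition by a sum over the jumping coordinate exhibits Q as a
sum of single-coordinate generators. -/
theorem offDiagRate_eq (x y : State d S) : offDiagRate x y =
    ∑ i, if ∀ j, j ≠ i → x j = y j then (if y i = none ∧ x i ≠ none then 1 else 0) else 0 := by
  rw [offDiagRate]
  split_ifs with h
  · obtain ⟨i, hi⟩ := Finset.card_eq_one.1 h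
    have h1 : ∀ j, x j ≠ y j ↔ j = i := fun j => by
      simpa using congrArg (fun s => j ∈ s) hi
    rw [hi, Finset.sum_singleton, Finset.sum_eq_single i]
    · rw [if_pos fun j hj => by by_contra hc; exact hj ((h1 j).1 hc), tokenRate]
      simp only [and_comm]
    · intro k _ hk
      rw [if_neg]
      intro hc
      exact (h1 i).2 rfl (hc i hk.symm)
    · simp
  · symm
    refine Finset.sum_eq_zero fun i _ => ?_
    split_ifs with h1 h2
    · refine absurd (Finset.card_eq_one.2 ⟨i, ?_⟩) h
      ext j
      simp only [Finset.mem_filter, Finset.mem_univ, true_and, Finset.mem_singleton]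
      refine ⟨fun hj => by by_contra hc; exact hj (h1 j hc), ?_⟩
      rintro rfl
      rw [h2.1]
      exact h2.2
    · rfl
    · rfl

theorem offDiagRate_self (x : State d S) : offDiagRate x x = 0 := by simp [offDiagRate]

theorem sum_mul_offDiagRate (f : State d S → ℝ) (y : State d S) :
    ∑ x, f x * offDiagRate x y =
      ∑ i, if y i = none then ∑ a, f (Function.update y i (some a)) else 0 := by
  simp only [offDiagRate_eq, Finset.mul_sum]
  rw [Finset.sum_comm]
  refine Finset.sum_congr rfl fun i _ => ?_
  simp only [mul_ite, mul_zero, mul_one]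
  rw [sum_ite_eq_off y i fun x => if y i = none ∧ x i ≠ none then f x else 0,
    Fintype.sum_option]
  by_cases h : y i = none <;> simp [h]

theorem sum_offDiagRate (x : State d S) : ∑ y, offDiagRate x y = ∑ i, if x i = none then 0 else 1 := by
  simp only [offDiagRate_eq]
  rw [Finset.sum_comm]
  refine Finset.sum_congr rfl fun i _ => ?_
  have := sum_ite_eq_off x i fun y => if y i = none ∧ x i ≠ none then (1 : ℝ) else 0
  simp only [eq_comm (b := x _)] at this
  rw [this, Fintype.sum_option]
  by_cases h : x i = none <;> simp [h]

theorem sum_mul_rateMatrix (f : State d S → ℝ) (y : State d S) :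
    ∑ x, f x * rateMatrix d S x y =
      ∑ i, if y i = none then ∑ a, f (Function.update y i (some a)) else -f y := by
  have h1 : ∀ x, f x * rateMatrix d S x y = f x * offDiagRate x y -
      if x = y then f y * ∑ i, (if y i = none then (0 : ℝ) else 1) else 0 := by
    intro x
    simp only [rateMatrix, Matrix.of_apply]
    split_ifs with h
    · subst h
      rw [offDiagRate_self, ← sum_offDiagRate, ← Finset.add_sum_erase _ _ (Finset.mem_univ x),
        offDiagRate_self, Finset.filter_ne']
      ring
    · ring
  simp only [h1, Finset.sum_sub_distrib, sum_mul_offDiagRate, Finset.sum_ite_eq', Finset.mem_univ,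
    if_true, Finset.mul_sum]
  rw [← Finset.sum_sub_distrib]
  refine Finset.sum_congr rfl fun i _ => ?_
  split_ifs <;> simp

theorem keptMass_update (q : PMF (Fin d → Fin S)) (p : ℝ) (y : State d S) (i : Fin d)
    (b : Option (Fin S)) : keptMass q p (Function.update y i b) =
      ∑ z, massOf q z * (tokenLaw p (z i) b *
        ∏ j ∈ Finset.univ.erase i, tokenLaw p (z j) (y j)) := by
  refine Finset.sum_congr rfl fun z _ => ?_
  rw [← Finset.mul_prod_erase _ _ (Finset.mem_univ i), Function.update_self]
  congr 2
  exact Finset.prod_congr rfl fun j hj => by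
    rw [Function.update_of_ne (Finset.ne_of_mem_erase hj)]

/-- By the product rule it is enough that each token law solves the forward equation of one
coordinate: the mask gains the mass e^{-t} that the token loses. -/
theorem hasDerivAt_keptMass (q : PMF (Fin d → Fin S)) (y : State d S) (t : ℝ) :
    HasDerivAt (fun t => keptMass q (Real.exp (-t)) y)
      (∑ x, keptMass q (Real.exp (-t)) x * rateMatrix d S x y) t := by
  have he : HasDerivAt (fun t : ℝ => Real.exp (-t)) (-Real.exp (-t)) t := by
    simpa using (hasDerivAt_neg t).exp
  have h1 : ∀ (c : Fin S) (b : Option (Fin S)), HasDerivAt (fun t => tokenLaw (Real.exp (-t)) c b)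
      (if b = none then Real.exp (-t) else -tokenLaw (Real.exp (-t)) c b) t := by
    intro c b
    simp only [tokenLaw]
    split_ifs
    · simpa using he.const_sub 1
    · exact he
    · simpa using hasDerivAt_const t (0 : ℝ)
  have h2 := HasDerivAt.fun_sum (u := Finset.univ) fun (z : Fin d → Fin S) _ =>
    (HasDerivAt.fun_finsetProd (u := Finset.univ) fun i _ => h1 (z i) (y i)).const_mul (massOf q z)
  refine h2.congr_deriv ?_
  rw [sum_mul_rateMatrix]
  simp only [Finset.mul_sum]
  rw [Finset.sum_comm]
  refine Finset.sum_congr rfl fun i _ => ?_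
  split_ifs with h
  · simp only [keptMass_update]
    rw [Finset.sum_comm]
    refine Finset.sum_congr rfl fun z _ => ?_
    rw [← Finset.mul_sum, ← Finset.sum_mul]
    simp [tokenLaw, mul_comm]
  · have := keptMass_update q (Real.exp (-t)) y i (y i)
    rw [Function.update_eq_self] at this
    rw [this, ← Finset.sum_neg_distrib]
    refine Finset.sum_congr rfl fun z _ => ?_
    rw [smul_eq_mul]
    ring

open scoped Matrix.Norms.Operator in
/-- The marginal at time `t` is the law of the data with tokens kept with probability `e^{-t}`. -/
theorem marginal_eq (q : PMF (Fin d → Fin S)) (t : ℝ) :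
    marginal q t = keptMass q (Real.exp (-t)) := by
  set Q := rateMatrix d S with hQ
  have hE : ∀ (t : ℝ) (x y : State d S),
      HasDerivAt (fun u : ℝ => NormedSpace.exp (u • (-Q)) x y)
        ((-Q * NormedSpace.exp (t • (-Q))) x y) t := by
    intro t x y
    have h := hasDerivAt_exp_smul_const' (𝕂 := ℝ) (-Q) t
    exact ((Matrix.entryLinearMap ℝ ℝ x y).toContinuousLinearMap.hasFDerivAt
      (x := NormedSpace.exp (t • (-Q)))).comp_hasDerivAt t h
  -- Two solutions of the forward equation are compared by undoing the flow: the law multiplied by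
  -- exp(-uQ) has derivative zero, so it stays equal to the data law.
  have hD : ∀ (y : State d S) (t : ℝ), HasDerivAt (fun u : ℝ =>
      Matrix.vecMul (keptMass q (Real.exp (-u))) (NormedSpace.exp (u • (-Q))) y) 0 t := by
    intro y t
    have h := HasDerivAt.fun_sum (u := Finset.univ) fun (x : State d S) _ =>
      (hasDerivAt_keptMass q x t).mul (hE t x y)
    refine h.congr_deriv ?_
    rw [Finset.sum_add_distrib]
    have e1 : ∑ x, (∑ x', keptMass q (Real.exp (-t)) x' * Q x' x) *
        NormedSpace.exp (t • (-Q)) x y =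
        Matrix.vecMul (Matrix.vecMul (keptMass q (Real.exp (-t))) Q)
          (NormedSpace.exp (t • (-Q))) y := rfl
    have e2 : ∑ x, keptMass q (Real.exp (-t)) x * (-Q * NormedSpace.exp (t • (-Q))) x y =
        Matrix.vecMul (keptMass q (Real.exp (-t))) (-Q * NormedSpace.exp (t • (-Q))) y := rfl
    rw [e1, e2, Matrix.vecMul_vecMul, neg_mul, Matrix.vecMul_neg]
    simp
  have hc : Matrix.vecMul (keptMass q (Real.exp (-t))) (NormedSpace.exp (t • (-Q))) =
      dataMass q := by
    funext y
    have := is_const_of_deriv_eq_zero (fun u => (hD y u).differentiableAt)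
      (fun u => (hD y u).deriv) t 0
    refine this.trans ?_
    rw [zero_smul, NormedSpace.exp_zero, neg_zero, Real.exp_zero, Matrix.vecMul_one, keptMass_one]
  rw [marginal, ← hc, Matrix.vecMul_vecMul, smul_neg, ← Matrix.exp_add_of_commute]
  · rw [neg_add_cancel, NormedSpace.exp_zero, Matrix.vecMul_one]
  · exact (Commute.refl _).neg_left

end Marginal

/-! ### Correlation functionals as functionals of the entropies of subsets of coordinates -/

section Correlation

variable {d S : ℕ}

theorem law_law {Ω α β : Type*} [Fintype Ω] [Fintype α] (μ : Ω → ℝ) (f : Ω → α) (g : α → β)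
    (b : β) : law (law μ f) g b = law μ (fun ω => g (f ω)) b := by
  classical
  rw [law_eq, law_eq]
  simpa using sum_law_mul μ f fun a => if g a = b then 1 else 0

theorem entropy_law {Ω α β : Type*} [Fintype Ω] [Fintype α] [Fintype β] (μ : Ω → ℝ) (f : Ω → α)
    (g : α → β) : entropy (law μ f) g = entropy μ (fun ω => g (f ω)) := by
  simp only [entropy, law_law]

/-- The entropy of the coordinates in `U`. -/
noncomputable def revealEntropy (q : PMF (Fin d → Fin S)) (U : Finset (Fin d)) : ℝ :=
  entropy (massOf q) (reveal U)

theorem reveal_eq_reveal_iff (U : Finset (Fin d)) (z z' : Fin d → Fin S) :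
    reveal U z = reveal U z' ↔ ∀ i ∈ U, z i = z' i := by
  simp [reveal_eq_iff]

theorem reveal_inter_eq_iff (U V W : Finset (Fin d)) (z z' : Fin d → Fin S) :
    reveal (U ∩ W) z = reveal (V ∩ W) z' ↔ ∀ k ∈ W, reveal U z k = reveal V z' k := by
  have : ∀ (U : Finset (Fin d)) (z : Fin d → Fin S) (k : Fin d),
      reveal (U ∩ W) z k = if k ∈ W then reveal U z k else none := by
    intro U z k
    by_cases h : k ∈ W <;> simp [reveal, h]
  rw [funext_iff]
  simp only [this]
  refine forall_congr' fun k => ?_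
  by_cases h : k ∈ W <;> simp [h]

/-- This is the nonnegativity of the mutual information of the coordinates `i` and `j` given those
of `U` other than them. -/
theorem secondDiff_revealEntropy_nonneg (q : PMF (Fin d → Fin S)) (i j : Fin d)
    (U : Finset (Fin d)) : 0 ≤ secondDiff (revealEntropy q) i j U := by
  have := entropy_submodular (massOf_nonneg q) (F := reveal (insert i (insert j U)))
    (A := reveal (insert i (U.erase j))) (B := reveal (insert j (U.erase i)))
    (C := reveal ((U.erase i).erase j))
    (by
      intro z z'
      simp only [reveal_eq_reveal_iff]
      intro h1 h2 k hk
      by_cases hki : k = i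
      · exact h1 k (by simp [hki])
      · by_cases hkj : k = j
        · exact h2 k (by simp [hkj])
        · exact h1 k (by simp_all))
    (by
      intro z z'
      simp only [reveal_eq_reveal_iff]
      exact fun h k hk => h k (by simp_all))
    (by
      intro z z'
      simp only [reveal_eq_reveal_iff]
      exact fun h k hk => h k (by simp_all))
  simp only [secondDiff, revealEntropy]
  linarith

theorem curvature_revealEntropy_nonneg (q : PMF (Fin d → Fin S)) (U : Finset (Fin d)) :
    0 ≤ curvature (revealEntropy q) U :=
  Finset.sum_nonneg fun i _ => Finset.sum_nonneg fun j _ => by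
    split_ifs with h
    · exact secondDiff_revealEntropy_nonneg q i j U
    · exact le_rfl

theorem revealEntropy_empty (q : PMF (Fin d → Fin S)) : revealEntropy q ∅ = 0 :=
  entropy_const (sum_massOf q) fun z z' => by simp [reveal_eq_reveal_iff]

theorem revealEntropy_nonneg (q : PMF (Fin d → Fin S)) (U : Finset (Fin d)) :
    0 ≤ revealEntropy q U :=
  entropy_nonneg (massOf_nonneg q) (sum_massOf q) _

theorem revealEntropy_mono (q : PMF (Fin d → Fin S)) {U V : Finset (Fin d)} (h : U ⊆ V) :
    revealEntropy q U ≤ revealEntropy q V := by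
  refine entropy_mono (massOf_nonneg q) fun z z' => ?_
  simp only [reveal_eq_reveal_iff]
  exact fun h1 k hk => h1 k (h hk)

theorem revealEntropy_insert_le (q : PMF (Fin d → Fin S)) (hS : 1 ≤ S) (U : Finset (Fin d))
    (i : Fin d) : revealEntropy q (insert i U) - revealEntropy q (U.erase i) ≤ Real.log S := by
  have : Nonempty (Fin S) := ⟨⟨0, hS⟩⟩
  have h := entropy_le_add_log_card (massOf_nonneg q) (F := reveal (insert i U))
    (C := reveal (U.erase i)) (a := fun z : Fin d → Fin S => z i)
    (by
      intro z z' h1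
      simp only [reveal_eq_reveal_iff]
      intro h2 k hk
      by_cases hki : k = i
      · rw [hki, h1]
      · exact h2 k (by simp_all))
  rw [sum_massOf, Fintype.card_fin] at h
  simp only [revealEntropy]
  linarith

theorem discDeriv_revealEntropy_nonneg (q : PMF (Fin d → Fin S)) (U : Finset (Fin d)) :
    0 ≤ discDeriv (revealEntropy q) U :=
  Finset.sum_nonneg fun i _ => sub_nonneg.2 <| revealEntropy_mono q <|
    (Finset.erase_subset i U).trans (Finset.subset_insert i U)

theorem discDeriv_revealEntropy_le (q : PMF (Fin d → Fin S)) (hS : 1 ≤ S) (U : Finset (Fin d)) :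
    discDeriv (revealEntropy q) U ≤ d * Real.log S :=
  (Finset.sum_le_sum fun i _ => revealEntropy_insert_le q hS U i).trans (by simp)

theorem entropy_id_eq (q : PMF (Fin d → Fin S)) :
    entropy (massOf q) (fun z => z) = revealEntropy q Finset.univ :=
  entropy_congr fun z z' => by
    rw [reveal_eq_reveal_iff, funext_iff]
    simp

/-- In terms of the averaged entropy φ this is φ'(0) + φ(0) - φ(1): the gap at 1 between φ and its
tangent at 0. -/
theorem totalCorrelation_eq (q : PMF (Fin d → Fin S)) : totalCorrelation q =
    discDeriv (revealEntropy q) ∅ + revealEntropy q ∅ - revealEntropy q Finset.univ := by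
  have : ∀ i, entropy (massOf q) (fun z => z i) = revealEntropy q {i} := fun i =>
    entropy_congr fun z z' => by simp [reveal_eq_reveal_iff]
  simp only [totalCorrelation, this, entropy_id_eq, discDeriv]
  simp [revealEntropy_empty]

/-- In terms of φ this is φ(1) - φ(0) - φ'(1): the gap at 0 between φ and its tangent at 1. -/
theorem dualTotalCorrelation_eq (q : PMF (Fin d → Fin S)) : dualTotalCorrelation q =
    revealEntropy q Finset.univ - revealEntropy q ∅ -
      discDeriv (revealEntropy q) Finset.univ := by
  have : ∀ i, condEntropy (massOf q) (fun z => z i)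
      (fun z => fun j : {j : Fin d // j ≠ i} => z j) =
      revealEntropy q Finset.univ - revealEntropy q (Finset.univ.erase i) := by
    intro i
    rw [condEntropy_eq (massOf_nonneg q)]
    congr 1
    · refine entropy_congr fun z z' => ?_
      rw [reveal_eq_reveal_iff, Prod.mk.injEq, funext_iff]
      constructor
      · rintro ⟨h1, h2⟩ k -
        by_cases hk : k = i
        · rw [hk, h1]
        · exact h2 ⟨k, hk⟩
      · exact fun h => ⟨h i (Finset.mem_univ i), fun k => h k (Finset.mem_univ _)⟩
    · refine entropy_congr fun z z' => ?_
      rw [reveal_eq_reveal_iff, funext_iff]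
      simp
  simp only [dualTotalCorrelation, this, entropy_id_eq, discDeriv, revealEntropy_empty]
  simp

/-! ### Entropies and mutual informations of the partially masked state -/

theorem sum_bern_inter (p : ℝ) (V W : Finset (Fin d)) :
    ∑ U : Finset (Fin d), (if U ∩ W = V ∩ W then bern p U else 0) =
      ∏ i ∈ W, if i ∈ V then p else 1 - p := by
  -- Choices contradicting `V` on `W` are given the factor 0, which turns the restricted sum into a
  -- full product expansion.
  have h1 : ∀ U : Finset (Fin d), (if U ∩ W = V ∩ W then bern p U else 0) =
      ∏ i, if i ∈ U then (if i ∈ W ∧ i ∉ V then 0 else p) else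
        (if i ∈ W ∧ i ∈ V then 0 else 1 - p) := by
    intro U
    split_ifs with h
    · refine Finset.prod_congr rfl fun i _ => ?_
      have : i ∈ W → (i ∈ U ↔ i ∈ V) := fun hi => by
        simpa [hi] using congrArg (fun s => i ∈ s) h
      by_cases hW : i ∈ W <;> by_cases hU : i ∈ U <;> simp_all
    · obtain ⟨i, hi⟩ : ∃ i, ¬(i ∈ U ∩ W ↔ i ∈ V ∩ W) := by
        by_contra! hc
        exact h (Finset.ext hc)
      symm
      refine Finset.prod_eq_zero (Finset.mem_univ i) ?_
      simp only [Finset.mem_inter] at hi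
      by_cases hW : i ∈ W <;> by_cases hU : i ∈ U <;> simp_all
  simp only [h1]
  rw [sum_prod_ite_mem, ← Finset.prod_subset (Finset.subset_univ W)]
  · refine Finset.prod_congr rfl fun i hi => ?_
    by_cases hV : i ∈ V <;> simp [hi, hV]
  · intro i _ hi
    simp [hi]

/-- The masked state on `W` shows its own mask pattern. Its entropy is therefore that of the
pattern, one binary entropy per coordinate of `W`, plus the average data entropy given the pattern.
For 0 < p < 1 all factors are nonzero, so the logarithm splits. -/
theorem entropy_jointMass (q : PMF (Fin d → Fin S)) {p : ℝ} (h0 : 0 < p) (h1 : p < 1)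
    (W : Finset (Fin d)) :
    entropy (jointMass q p) (fun ω => reveal (ω.2 ∩ W) ω.1) =
      ∑ _i ∈ W, -(p * Real.log p + (1 - p) * Real.log (1 - p)) +
      ∑ U, bern p U * revealEntropy q (U ∩ W) := by
  have hlaw : ∀ ω : (Fin d → Fin S) × Finset (Fin d),
      law (jointMass q p) (fun ω => reveal (ω.2 ∩ W) ω.1) (reveal (ω.2 ∩ W) ω.1) =
      (∏ i ∈ W, if i ∈ ω.2 then p else 1 - p) *
        law (massOf q) (reveal (ω.2 ∩ W)) (reveal (ω.2 ∩ W) ω.1) := by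
    rintro ⟨z, V⟩
    rw [← sum_bern_inter, law_eq, law_eq, Fintype.sum_prod_type_right, Finset.sum_mul_sum]
    refine Finset.sum_congr rfl fun U _ => Finset.sum_congr rfl fun z' _ => ?_
    simp only [jointMass, reveal_eq_iff]
    by_cases h : U ∩ W = V ∩ W
    · simp only [h, true_and]
      split_ifs <;> ring
    · simp [h]
  rw [entropy_eq]
  have hlog : ∀ (z : Fin d → Fin S) (U : Finset (Fin d)), jointMass q p (z, U) *
      Real.log (law (jointMass q p) (fun ω => reveal (ω.2 ∩ W) ω.1) (reveal (U ∩ W) z)) =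
      massOf q z * (∑ i ∈ W, bern p U * (if i ∈ U then Real.log p else Real.log (1 - p))) +
      bern p U * (massOf q z *
        Real.log (law (massOf q) (reveal (U ∩ W)) (reveal (U ∩ W) z))) := by
    intro z U
    rcases (massOf_nonneg q z).eq_or_lt with hm | hm
    · simp [jointMass, ← hm]
    · have hp : ∀ i ∈ W, (if i ∈ U then p else 1 - p) ≠ 0 := fun i _ => by
        split_ifs <;> linarith
      rw [hlaw (z, U), Real.log_mul (Finset.prod_ne_zero_iff.2 hp)
        (law_pos (massOf_nonneg q) _ hm).ne', Real.log_prod hp, jointMass, mul_add,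
        ← Finset.mul_sum]
      simp only [apply_ite Real.log]
      ring
  simp only [Fintype.sum_prod_type, hlog, Finset.sum_add_distrib]
  rw [neg_add]
  congr 1
  · have hin : ∑ U : Finset (Fin d), ∑ i ∈ W,
        bern p U * (if i ∈ U then Real.log p else Real.log (1 - p)) =
        ∑ _i ∈ W, (p * Real.log p + (1 - p) * Real.log (1 - p)) := by
      rw [Finset.sum_comm]
      simp only [sum_bern_mul_ite]
    simp only [← Finset.mul_sum (s := Finset.univ (α := Finset (Fin d))), hin,
      Finset.sum_neg_distrib]
    rw [← Finset.sum_mul (f := massOf q), sum_massOf, one_mul]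
  · rw [Finset.sum_comm, ← Finset.sum_neg_distrib]
    refine Finset.sum_congr rfl fun U _ => ?_
    rw [revealEntropy, entropy_eq, ← Finset.mul_sum]
    ring

theorem sum_bern_mul_of_eq_zero {ι : Type*} [Fintype ι] [DecidableEq ι] (p : ℝ) (i : ι)
    {f : Finset ι → ℝ} (hf : ∀ U, i ∉ U → f U = 0) :
    ∑ U, bern p U * f U = p * ∑ U, bern p U * f (insert i U) := by
  rw [sum_finset_eq_sum_notMem i, sum_finset_eq_sum_notMem i, Finset.mul_sum]
  refine Finset.sum_congr rfl fun U hU => ?_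
  simp only [Finset.mem_filter, Finset.mem_univ, true_and] at hU
  have e : ∏ j ∈ Finset.univ.erase i, (if j ∈ insert i U then p else 1 - p) =
      ∏ j ∈ Finset.univ.erase i, (if j ∈ U then p else 1 - p) :=
    Finset.prod_congr rfl fun j hj => by simp [Finset.ne_of_mem_erase hj]
  rw [bern_eq_mul p i U, bern_eq_mul p i (insert i U), e]
  simp only [hU, hf U hU, Finset.mem_insert_self, if_true, if_false, Finset.insert_idem]
  ring

/-- The mask pattern entropies cancel in the alternating sum of the four joint entropies. The
remaining combination of data entropies vanishes unless both `i` and `j` are unmasked; conditioning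
on this event gives the factor p² and inserts `i` and `j` into the random set. -/
theorem condMutualInfo_keptMass (q : PMF (Fin d → Fin S)) {p : ℝ} (h0 : 0 < p) (h1 : p < 1)
    {i j : Fin d} (hij : i ≠ j) :
    condMutualInfo (keptMass q p) (fun x => x i) (fun x => x j)
      (fun x => fun k : {k : Fin d // k ≠ i ∧ k ≠ j} => x k) =
      p ^ 2 * bernAvg p (secondDiff (revealEntropy q) i j) := by
  have hk : keptMass q p = law (jointMass q p) (fun ω => reveal ω.2 ω.1) :=
    funext fun x => (law_jointMass q p x).symm
  have hent : ∀ {β : Type} [Fintype β] (g : State d S → β) (W : Finset (Fin d)),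
      (∀ x y, g y = g x ↔ ∀ k ∈ W, y k = x k) → entropy (keptMass q p) g =
      ∑ _i ∈ W, -(p * Real.log p + (1 - p) * Real.log (1 - p)) +
      ∑ U, bern p U * revealEntropy q (U ∩ W) := by
    intro β _ g W hg
    rw [hk, entropy_law, ← entropy_jointMass q h0 h1 W]
    exact entropy_congr fun ω ω' => by rw [hg, reveal_inter_eq_iff]
  have hn := keptMass_nonneg q h0.le h1.le
  rw [condMutualInfo, condEntropy_eq hn, condEntropy_eq hn,
    hent (fun x => (x i, fun k : {k : Fin d // k ≠ i ∧ k ≠ j} => x k)) (Finset.univ.erase j) ?_,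
    hent (fun x => fun k : {k : Fin d // k ≠ i ∧ k ≠ j} => x k)
      ((Finset.univ.erase j).erase i) ?_,
    hent (fun x => (x i, x j, fun k : {k : Fin d // k ≠ i ∧ k ≠ j} => x k)) Finset.univ ?_,
    hent (fun x => (x j, fun k : {k : Fin d // k ≠ i ∧ k ≠ j} => x k)) (Finset.univ.erase i) ?_]
  · rw [Finset.sum_erase_eq_sub (Finset.mem_univ j), Finset.sum_erase_eq_sub (Finset.mem_univ i),
      Finset.sum_erase_eq_sub (by simp [hij]), Finset.sum_erase_eq_sub (Finset.mem_univ j)]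
    set c := -(p * Real.log p + (1 - p) * Real.log (1 - p))
    set φ : Finset (Fin d) → ℝ := fun U => revealEntropy q (U.erase j) +
      revealEntropy q (U.erase i) - revealEntropy q ((U.erase j).erase i) - revealEntropy q U
      with hφ
    have e1 : ∑ U, bern p U * φ U = p ^ 2 * bernAvg p (secondDiff (revealEntropy q) i j) := by
      rw [sum_bern_mul_of_eq_zero p i, sum_bern_mul_of_eq_zero p j, ← mul_assoc, ← pow_two,
        bernAvg]
      · congr 1
        refine Finset.sum_congr rfl fun U _ => ?_
        have a1 : (insert i (insert j U)).erase j = insert i (U.erase j) := by grind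
        have a2 : (insert i (insert j U)).erase i = insert j (U.erase i) := by grind
        have a3 : (insert i (U.erase j)).erase i = (U.erase i).erase j := by grind
        simp only [hφ, secondDiff, a1, a2, a3]
      · intro U hU
        have a1 : (insert i U).erase j = insert i U := by grind
        simp only [hφ, a1]
        ring
      · intro U hU
        have a1 : (U.erase j).erase i = U.erase j := by grind
        simp only [hφ, a1, Finset.erase_eq_of_notMem hU]
        ring
    rw [← e1]
    have a1 : ∀ (U : Finset (Fin d)) k, U ∩ Finset.univ.erase k = U.erase k := by
      intro U k; grind
    have a2 : ∀ (U : Finset (Fin d)), U ∩ (Finset.univ.erase j).erase i = (U.erase j).erase i := by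
      intro U; grind
    simp only [a1, a2, Finset.inter_univ, hφ, mul_add, mul_sub, Finset.sum_add_distrib,
      Finset.sum_sub_distrib]
    ring
  · intro x y
    rw [Prod.mk.injEq, funext_iff]
    constructor
    · rintro ⟨h1, h2⟩ k hk
      by_cases hkj : k = j
      · rw [hkj, h1]
      · exact h2 ⟨k, Finset.ne_of_mem_erase hk, hkj⟩
    · exact fun h => ⟨h j (by simp [hij.symm]), fun k => h k (by simp [k.2.1])⟩
  · intro x y
    rw [Prod.mk.injEq, Prod.mk.injEq, funext_iff]
    constructor
    · rintro ⟨h1, h2, h3⟩ k hk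
      by_cases hki : k = i
      · rw [hki, h1]
      · by_cases hkj : k = j
        · rw [hkj, h2]
        · exact h3 ⟨k, hki, hkj⟩
    · exact fun h => ⟨h i (by simp), h j (by simp), fun k => h k (by simp)⟩
  · intro x y
    rw [funext_iff]
    constructor
    · intro h k hk
      exact h ⟨k, by simp_all⟩
    · exact fun h k => h k (by simp [k.2.1, k.2.2])
  · intro x y
    rw [Prod.mk.injEq, funext_iff]
    constructor
    · rintro ⟨h1, h2⟩ k hk
      by_cases hki : k = i
      · rw [hki, h1]
      · exact h2 ⟨k, hki, Finset.ne_of_mem_erase hk⟩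
    · exact fun h => ⟨h i (by simp [hij]), fun k => h k (by simp [k.2.2])⟩

theorem infoAt_eq (q : PMF (Fin d → Fin S)) {t : ℝ} (ht : 0 < t) :
    infoAt q t = curvRate (revealEntropy q) t := by
  have h1 : Real.exp (-t) < 1 := by simpa using ht
  rw [infoAt, curvRate, bernAvg, marginal_eq]
  simp only [curvature, Finset.mul_sum]
  symm
  rw [Finset.sum_comm]
  refine Finset.sum_congr rfl fun i _ => ?_
  rw [Finset.sum_comm]
  refine Finset.sum_congr rfl fun j _ => ?_
  split_ifs with hij
  · rw [condMutualInfo_keptMass q (Real.exp_pos _) h1 hij, bernAvg, Finset.mul_sum]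
  · simp

theorem effectiveTotalCorrelation_eq (q : PMF (Fin d → Fin S)) :
    effectiveTotalCorrelation q =
      ∫ t in Set.Ioi (0 : ℝ), min 1 t * curvRate (revealEntropy q) t :=
  MeasureTheory.setIntegral_congr_fun measurableSet_Ioi fun t ht => by
    rw [infoAt_eq q ht]

theorem integrableOn_effectiveTotalCorrelation (q : PMF (Fin d → Fin S)) :
    MeasureTheory.IntegrableOn (fun t : ℝ => min 1 t * infoAt q t) (Set.Ioi 0) :=
  (integrableOn_min_mul_curvRate (curvature_revealEntropy_nonneg q)).congr_fun
    (fun t ht => by rw [infoAt_eq q ht]) measurableSet_Ioi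

theorem effectiveTotalCorrelation_le (q : PMF (Fin d → Fin S)) :
    effectiveTotalCorrelation q ≤ min (dualTotalCorrelation q) (totalCorrelation q) := by
  rw [effectiveTotalCorrelation_eq, dualTotalCorrelation_eq, totalCorrelation_eq]
  exact le_min (integral_min_mul_curvRate_le_left (curvature_revealEntropy_nonneg q))
    (integral_min_mul_curvRate_le_right (curvature_revealEntropy_nonneg q))

end Correlation

/-! ### Existence of exponential-then-constant schedules -/

section Schedule

/-- The remaining time, as a function of a parameter in which the schedule is equidistant. -/
noncomputable def expThenLinear (z : ℝ) : ℝ := if z ≤ 0 then Real.exp z else 1 + z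

theorem expThenLinear_pos (z : ℝ) : 0 < expThenLinear z := by
  unfold expThenLinear
  split_ifs
  · exact Real.exp_pos z
  · linarith

/-- On the exponential branch this is an equality; across the junction 1 + (w + s) ≤ e^{w+s} is
used, and on the linear branch s ≤ e^s - 1. -/
theorem expThenLinear_add_sub_le {w s : ℝ} (hs : 0 < s) :
    expThenLinear (w + s) - expThenLinear w ≤ (Real.exp s - 1) * min 1 (expThenLinear w) := by
  have h1 := Real.add_one_le_exp s
  have h2 := Real.add_one_le_exp (w + s)
  rw [Real.exp_add] at h2
  unfold expThenLinear
  by_cases hw : w ≤ 0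
  · rw [if_pos hw, min_eq_right (Real.exp_le_one_iff.2 hw)]
    split_ifs
    · rw [Real.exp_add]
      linarith
    · linarith
  · rw [if_neg hw, if_neg (by linarith), min_eq_left (by linarith)]
    linarith

theorem expThenLinear_lt_add {w s : ℝ} (hs : 0 < s) :
    expThenLinear w < expThenLinear (w + s) := by
  unfold expThenLinear
  by_cases hw : w ≤ 0
  · rw [if_pos hw]
    split_ifs
    · exact Real.exp_lt_exp.2 (by linarith)
    · have := Real.exp_le_one_iff.2 hw
      linarith
  · rw [if_neg hw, if_neg (by linarith)]
    linarith

/-- The bound z ≤ T - 1 is more than needed to start the grid at T: it leaves a slack of 1 in the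
parameter length z + T ≤ 2T - 1, which later absorbs the rounding errors. -/
theorem exists_expThenLinear_eq {T : ℝ} (hT : 0 < T) (h : Real.exp (-T) < T) :
    ∃ z, expThenLinear z = T ∧ z ≤ T - 1 ∧ 0 < z + T := by
  by_cases h1 : T ≤ 1
  · refine ⟨Real.log T, ?_, Real.log_le_sub_one_of_pos hT, ?_⟩
    · rw [expThenLinear, if_pos (Real.log_nonpos hT.le h1), Real.exp_log hT]
    · have := (Real.lt_log_iff_exp_lt hT).2 h
      linarith
  · exact ⟨T - 1, by rw [expThenLinear, if_neg (by linarith)]; ring, le_rfl, by linarith⟩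

theorem exists_isExpConstSchedule {T : ℝ} {N : ℕ} (hT : 0 < T) (h : Real.exp (-T) < T)
    (hN : 4 * (1 + T) ^ 2 ≤ N) :
    ∃ t : ℕ → ℝ, IsTimeGrid N T t ∧ (∀ k < N, t (k + 1) - t k ≤ 1) ∧
      IsExpConstSchedule N T ((T + T) / N) (Real.exp (-T)) t := by
  obtain ⟨z, hz, hz1, hz2⟩ := exists_expThenLinear_eq hT h
  have hN1 : (4 : ℝ) < N := lt_of_lt_of_le (by nlinarith) hN
  have hN2 : 1 ≤ N := by
    have : (1 : ℝ) ≤ N := by linarith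
    exact_mod_cast this
  have hcast : ((N - 1 : ℕ) : ℝ) = (N : ℝ) - 1 := by push_cast [hN2]; ring
  set M : ℝ := (N : ℝ) - 1 with hM
  have hM0 : 0 < M := by rw [hM]; linarith
  -- N - 1 equal parameter steps lead from `z`, where the remaining time is T, to -T, where it is
  -- e^{-T}.
  set s : ℝ := (z + T) / M with hs
  have hs0 : 0 < s := div_pos hz2 hM0
  have hMT : 4 * (1 + T) ^ 2 - 1 ≤ M := by rw [hM]; linarith
  have hs1 : s ≤ 1 := by
    rw [hs, div_le_one hM0]
    nlinarith
  have hκ : Real.exp s - 1 ≤ (T + T) / N := by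
    have e1 : Real.exp s - 1 ≤ s + s ^ 2 := by
      have := (abs_le.1 (Real.abs_exp_sub_one_sub_id_le (x := s)
        (by rw [abs_of_pos hs0]; exact hs1))).2
      linarith
    have e2 : s + s ^ 2 ≤ (T + T) / N := by
      have hNM : (N : ℝ) = M + 1 := by rw [hM]; ring
      have hsM : s ≤ (2 * T - 1) / M := by
        rw [hs]
        exact div_le_div_of_nonneg_right (by linarith) hM0.le
      have ha : 0 < 2 * T - 1 := by linarith
      -- The quadratic term and the passage from M = N - 1 to N are paid for by the gap between 2T -
      -- 1 and 2T, because M is at least 4(1+T)² - 1.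
      calc s + s ^ 2 ≤ (2 * T - 1) / M + ((2 * T - 1) / M) ^ 2 := by gcongr
        _ = ((2 * T - 1) * M + (2 * T - 1) ^ 2) / M ^ 2 := by field_simp
        _ ≤ (T + T) / N := by
          rw [hNM, div_le_div_iff₀ (by positivity) (by positivity)]
          nlinarith [mul_le_mul_of_nonneg_right hMT hM0.le, mul_pos ha hM0, sq_nonneg (2 * T - 1)]
    linarith
  have hκ1 : (T + T) / N ≤ 1 := by
    rw [div_le_one (by linarith)]
    nlinarith
  have hE1 : Real.exp (-T) ≤ 1 := Real.exp_le_one_iff.2 (by linarith)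
  -- The parametrized remaining time is always positive, so the endpoint at index N has to be set by
  -- hand.
  set t : ℕ → ℝ := fun k => if k < N then T - expThenLinear (z - k * s) else T with ht
  have hlast : t (N - 1) = T - Real.exp (-T) := by
    have : z - ((N - 1 : ℕ) : ℝ) * s = -T := by
      rw [hcast, hs]
      field_simp
      ring
    simp only [ht]
    rw [if_pos (by omega), this, expThenLinear, if_pos (by linarith)]
  have hstep : ∀ k, k + 1 < N → 0 < t (k + 1) - t k ∧
      t (k + 1) - t k ≤ (T + T) / N * min 1 (T - t (k + 1)) := by
    intro k hk
    simp only [ht]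
    rw [if_pos hk, if_pos (by omega)]
    have e : z - (k : ℝ) * s = (z - ((k + 1 : ℕ) : ℝ) * s) + s := by push_cast; ring
    rw [e, sub_sub_cancel]
    set w := z - ((k + 1 : ℕ) : ℝ) * s
    have a1 := expThenLinear_lt_add (w := w) hs0
    have a2 := expThenLinear_add_sub_le (w := w) hs0
    refine ⟨by linarith, ?_⟩
    calc _ = expThenLinear (w + s) - expThenLinear w := by ring
      _ ≤ _ := a2
      _ ≤ _ := mul_le_mul_of_nonneg_right hκ (le_min zero_le_one (expThenLinear_pos w).le)
  have hN0 : t N = T := by simp [ht]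
  have hcases : ∀ k < N, 0 < t (k + 1) - t k ∧ t (k + 1) - t k ≤ 1 := by
    intro k hk
    by_cases hk1 : k + 1 < N
    · obtain ⟨a, b⟩ := hstep k hk1
      refine ⟨a, b.trans ?_⟩
      calc _ ≤ (T + T) / N * 1 :=
            mul_le_mul_of_nonneg_left (min_le_left _ _) (by positivity)
        _ ≤ 1 := by rw [mul_one]; exact hκ1
    · obtain rfl : k = N - 1 := by omega
      have : N - 1 + 1 = N := by omega
      rw [this, hN0, hlast]
      exact ⟨by linarith [Real.exp_pos (-T)], by linarith⟩
  refine ⟨t, ⟨?_, hN0, fun k hk => by linarith [(hcases k hk).1]⟩, fun k hk => (hcases k hk).2,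
    fun k hk => (hstep k hk).2, by rw [hlast]; ring⟩
  simp only [ht]
  rw [if_pos (by omega)]
  simp [hz]

end Schedule

/-! ### One step of the reverse process against a sampler with independent coordinates -/

section Step

/-- Tower property: A is first averaged given X. Where the law of X vanishes so does the joint law,
and the quotient 0/0 = 0 is harmless. -/
theorem sum_mul_eq_sum_cond {Ω α β : Type*} [Fintype Ω] [Fintype α] [Fintype β] {μ : Ω → ℝ}
    (hμ : ∀ ω, 0 ≤ μ ω) (X : Ω → α) (A : Ω → β) (g : α → β → ℝ) :
    ∑ ω, μ ω * g (X ω) (A ω) =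
      ∑ ω, μ ω * ∑ a, law μ (fun ω => (X ω, A ω)) (X ω, a) / law μ X (X ω) * g (X ω) a := by
  have h1 := sum_law_mul μ (fun ω => (X ω, A ω)) fun z => g z.1 z.2
  have h2 := sum_law_mul μ X fun x =>
    ∑ a, law μ (fun ω => (X ω, A ω)) (x, a) / law μ X x * g x a
  rw [← h1, ← h2, Fintype.sum_prod_type]
  refine Finset.sum_congr rfl fun x _ => ?_
  rw [Finset.mul_sum]
  refine Finset.sum_congr rfl fun a _ => ?_
  rcases eq_or_ne (law μ X x) 0 with h0 | h0
  · have : law μ (fun ω => (X ω, A ω)) (x, a) = 0 :=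
      le_antisymm (h0 ▸ law_mono hμ fun ω h => (Prod.mk.inj h).1) (law_nonneg hμ _ _)
    simp [this]
  · field_simp

variable {d S : ℕ}

/-- The joint law of the sets of coordinates kept with probabilities `p` and `r`, where the first
one is a subset of the second one. -/
def bernPair (p r : ℝ) (U V : Finset (Fin d)) : ℝ :=
  ∏ i, if i ∈ V then (if i ∈ U then p else r - p) else (if i ∈ U then 0 else 1 - r)

theorem bernPair_nonneg {p r : ℝ} (h0 : 0 ≤ p) (hpr : p ≤ r) (hr : r ≤ 1)
    (U V : Finset (Fin d)) : 0 ≤ bernPair p r U V :=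
  Finset.prod_nonneg fun i _ => by split_ifs <;> linarith

theorem sum_bernPair_right (p r : ℝ) (U : Finset (Fin d)) :
    ∑ V, bernPair p r U V = bern p U := by
  simp only [bernPair]
  rw [sum_prod_ite_mem]
  exact Finset.prod_congr rfl fun i _ => by split_ifs <;> ring

theorem sum_bernPair_left (p r : ℝ) (V : Finset (Fin d)) :
    ∑ U, bernPair p r U V = bern r V := by
  have : ∀ U : Finset (Fin d), bernPair p r U V = ∏ i, if i ∈ U then (if i ∈ V then p else 0)
      else (if i ∈ V then r - p else 1 - r) := fun U =>
    Finset.prod_congr rfl fun i _ => by split_ifs <;> rfl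
  simp only [this]
  rw [sum_prod_ite_mem]
  exact Finset.prod_congr rfl fun i _ => by split_ifs <;> ring

/-- A coordinate still masked at the first level is revealed at the second with conditional
probability (r-p)/(1-p), and stays masked with probability (1-r)/(1-p). -/
theorem sum_bernPair_mul_ite {p : ℝ} (r : ℝ) (hp : p < 1) {U : Finset (Fin d)} {i : Fin d}
    (hi : i ∉ U) (a b : ℝ) : ∑ V, bernPair p r U V * (if i ∈ V then a else b) =
      bern p U * ((r - p) / (1 - p) * a + (1 - r) / (1 - p) * b) := by
  have h1 : 1 - p ≠ 0 := by linarith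
  simp only [bernPair]
  rw [sum_prod_ite_mem_mul, bern_eq_mul p i, if_neg hi, if_neg hi, if_neg hi]
  have : ∏ j ∈ Finset.univ.erase i, ((if j ∈ U then p else r - p) + (if j ∈ U then 0 else 1 - r)) =
      ∏ j ∈ Finset.univ.erase i, (if j ∈ U then p else 1 - p) :=
    Finset.prod_congr rfl fun j _ => by split_ifs <;> ring
  rw [this]
  field_simp

/-- The joint mass function of the data and the two random sets of kept coordinates. -/
def tripleMass (q : PMF (Fin d → Fin S)) (p r : ℝ)
    (ω : (Fin d → Fin S) × Finset (Fin d) × Finset (Fin d)) : ℝ :=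
  massOf q ω.1 * bernPair p r ω.2.1 ω.2.2

theorem sum_tripleMass_mul_left (q : PMF (Fin d → Fin S)) (p r : ℝ)
    (g : (Fin d → Fin S) → Finset (Fin d) → ℝ) :
    ∑ ω, tripleMass q p r ω * g ω.1 ω.2.1 = ∑ z, massOf q z * ∑ U, bern p U * g z U := by
  simp only [Fintype.sum_prod_type, tripleMass, Finset.mul_sum]
  refine Finset.sum_congr rfl fun z _ => Finset.sum_congr rfl fun U _ => ?_
  rw [← sum_bernPair_right p r U, Finset.sum_mul, Finset.mul_sum]
  exact Finset.sum_congr rfl fun V _ => by ring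

theorem sum_tripleMass_mul_right (q : PMF (Fin d → Fin S)) (p r : ℝ)
    (g : (Fin d → Fin S) → Finset (Fin d) → ℝ) :
    ∑ ω, tripleMass q p r ω * g ω.1 ω.2.2 = ∑ z, massOf q z * ∑ V, bern r V * g z V := by
  simp only [Fintype.sum_prod_type, tripleMass, Finset.mul_sum]
  refine Finset.sum_congr rfl fun z _ => ?_
  rw [Finset.sum_comm]
  refine Finset.sum_congr rfl fun V _ => ?_
  rw [← sum_bernPair_left p r V, Finset.sum_mul, Finset.mul_sum]
  exact Finset.sum_congr rfl fun V _ => by ring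

theorem law_tripleMass_left (q : PMF (Fin d → Fin S)) (p r : ℝ) (x : State d S) :
    law (tripleMass q p r) (fun ω => reveal ω.2.1 ω.1) x = keptMass q p x := by
  have h1 := sum_tripleMass_mul_left q p r fun z U => if reveal U z = x then 1 else 0
  have h2 := sum_keptMass_mul q p fun y => if y = x then 1 else 0
  simp only [mul_ite, mul_one, mul_zero, Finset.sum_ite_eq', Finset.mem_univ, if_true] at h1 h2
  rw [law_eq]
  exact h1.trans h2.symm

theorem law_tripleMass_right (q : PMF (Fin d → Fin S)) (p r : ℝ) (x : State d S) :
    law (tripleMass q p r) (fun ω => reveal ω.2.2 ω.1) x = keptMass q r x := by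
  have h1 := sum_tripleMass_mul_right q p r fun z U => if reveal U z = x then 1 else 0
  have h2 := sum_keptMass_mul q r fun y => if y = x then 1 else 0
  simp only [mul_ite, mul_one, mul_zero, Finset.sum_ite_eq', Finset.mem_univ, if_true] at h1 h2
  rw [law_eq]
  exact h1.trans h2.symm

theorem law_tripleMass_pair (q : PMF (Fin d → Fin S)) (p r : ℝ) {U V : Finset (Fin d)}
    (h : U ⊆ V) (z : Fin d → Fin S) :
    law (tripleMass q p r) (fun ω => (reveal ω.2.1 ω.1, reveal ω.2.2 ω.1))
      (reveal U z, reveal V z) =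
      bernPair p r U V * law (massOf q) (reveal V) (reveal V z) := by
  rw [law_eq, law_eq, Fintype.sum_prod_type, Finset.mul_sum]
  refine Finset.sum_congr rfl fun z' _ => ?_
  rw [Fintype.sum_prod_type, Finset.sum_eq_single U, Finset.sum_eq_single V]
  · simp only [Prod.mk.injEq, reveal_eq_iff, true_and, tripleMass]
    by_cases hz : ∀ i ∈ V, z' i = z i
    · rw [if_pos ⟨fun i hi => hz i (h hi), hz⟩, if_pos hz, mul_comm]
    · rw [if_neg fun hc => hz hc.2, if_neg hz, mul_zero]
  · intro V' _ hV
    simp [reveal_eq_iff, hV]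
  · simp
  · intro U' _ hU
    refine Finset.sum_eq_zero fun V' _ => ?_
    simp [reveal_eq_iff, hU]
  · simp

/-- The conditional probability that the data have entry `a` in coordinate `i`, given the unmasked
entries of `x`. -/
noncomputable def tokenCond (q : PMF (Fin d → Fin S)) (x : State d S) (i : Fin d) (a : Fin S) : ℝ :=
  law (massOf q) (fun z => (reveal (unmasked x) z, z i)) (x, a) /
    law (massOf q) (reveal (unmasked x)) x

theorem tokenCond_nonneg (q : PMF (Fin d → Fin S)) (x : State d S) (i : Fin d) (a : Fin S) :
    0 ≤ tokenCond q x i a :=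
  div_nonneg (law_nonneg (massOf_nonneg q) _ _) (law_nonneg (massOf_nonneg q) _ _)

theorem law_pair_eq (q : PMF (Fin d → Fin S)) (U : Finset (Fin d)) (i : Fin d)
    (z : Fin d → Fin S) :
    law (massOf q) (fun z => (reveal U z, z i)) (reveal U z, z i) =
      law (massOf q) (reveal (insert i U)) (reveal (insert i U) z) := by
  refine law_congr fun z' => ?_
  rw [Prod.mk.injEq, reveal_eq_reveal_iff, reveal_eq_reveal_iff, Finset.forall_mem_insert, and_comm]

theorem keptMass_pos_iff (q : PMF (Fin d → Fin S)) {p : ℝ} (h0 : 0 < p) (h1 : p < 1)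
    (x : State d S) : 0 < keptMass q p x ↔ 0 < law (massOf q) (reveal (unmasked x)) x := by
  rw [keptMass_eq, mul_pos_iff_of_pos_left (bern_pos h0 h1 _)]

theorem sum_tokenCond (q : PMF (Fin d → Fin S)) {x : State d S} (i : Fin d)
    (hx : 0 < law (massOf q) (reveal (unmasked x)) x) : ∑ a, tokenCond q x i a = 1 := by
  simp only [tokenCond, ← Finset.sum_div]
  rw [div_eq_one_iff_eq hx.ne', ← sum_law_pair (massOf q) (fun z => z i) (reveal (unmasked x)) x]
  exact Finset.sum_congr rfl fun a _ => law_congr fun z => by simp [and_comm]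

/-- The relative entropy of two mass functions. -/
noncomputable def relEntropy {α : Type*} [Fintype α] (μ P : α → ℝ) : ℝ :=
  ∑ x, μ x * Real.log (μ x / P x)

/-- The event that `i` is missing has probability 1 - p and is independent of the first difference
in direction `i`. -/
theorem sum_bern_mul_sum_notMem (p : ℝ) (f : Finset (Fin d) → ℝ) :
    ∑ U, bern p U * ∑ i, (if i ∈ U then 0 else f (insert i U) - f U) =
      (1 - p) * bernAvg p (discDeriv f) := by
  simp only [bernAvg, discDeriv, Finset.mul_sum]
  rw [Finset.sum_comm]
  symm
  rw [Finset.sum_comm]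
  refine Finset.sum_congr rfl fun i _ => ?_
  rw [sum_finset_eq_sum_notMem i, sum_finset_eq_sum_notMem i]
  refine Finset.sum_congr rfl fun U hU => ?_
  simp only [Finset.mem_filter, Finset.mem_univ, true_and] at hU
  have e : ∏ j ∈ Finset.univ.erase i, (if j ∈ insert i U then p else 1 - p) =
      ∏ j ∈ Finset.univ.erase i, (if j ∈ U then p else 1 - p) :=
    Finset.prod_congr rfl fun j hj => by simp [Finset.ne_of_mem_erase hj]
  rw [bern_eq_mul p i U, bern_eq_mul p i (insert i U), e]
  simp only [hU, Finset.mem_insert_self, if_true, if_false, Finset.insert_idem,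
    Finset.erase_insert hU, Finset.erase_eq_of_notMem hU]
  ring

theorem sum_massOf_mul_log_tokenCond (q : PMF (Fin d → Fin S)) (U : Finset (Fin d)) (i : Fin d) :
    ∑ z, massOf q z * Real.log (tokenCond q (reveal U z) i (z i)) =
      -(revealEntropy q (insert i U) - revealEntropy q U) := by
  simp only [revealEntropy, entropy_eq]
  rw [neg_sub_neg, neg_sub, ← Finset.sum_sub_distrib]
  refine Finset.sum_congr rfl fun z _ => ?_
  rcases (massOf_nonneg q z).eq_or_lt with h0 | h0
  · simp [← h0]
  · rw [tokenCond, unmasked_reveal, law_pair_eq,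
      Real.log_div (law_pos (massOf_nonneg q) _ h0).ne' (law_pos (massOf_nonneg q) _ h0).ne',
      mul_sub]

/-- If the tokens kept with probability `p` are revealed further, to be kept with probability
`r > p`, the relative entropy to a sampler with independent coordinate laws `K` grows at most by
the dependence of the newly revealed tokens and by the errors of the coordinate laws. -/
theorem relEntropy_step_le (q : PMF (Fin d → Fin S)) {p r : ℝ} (h0 : 0 < p) (hpr : p < r)
    (hr : r ≤ 1) {P : State d S → ℝ} (hP : ∀ x, 0 ≤ P x) (hPac : ∀ x, 0 < keptMass q p x → 0 < P x)
    {K : State d S → Fin d → Option (Fin S) → ℝ} (hK : ∀ x i b, 0 ≤ K x i b)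
    (hKsome : ∀ x i c, x i = some c → K x i (some c) = 1)
    (hKpos : ∀ x i a, 0 < keptMass q p x → x i = none → 0 < tokenCond q x i a → 0 < K x i (some a))
    (hKnone : ∀ x i, 0 < keptMass q p x → x i = none → r < 1 → 0 < K x i none)
    {C : State d S → Fin d → ℝ}
    (hC : ∀ x i, 0 < keptMass q p x → x i = none →
      (r - p) / (1 - p) * ∑ a, tokenCond q x i a *
        Real.log ((r - p) / (1 - p) * tokenCond q x i a / K x i (some a)) +
      (1 - r) / (1 - p) * Real.log ((1 - r) / (1 - p) / K x i none) ≤ C x i) :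
    (∀ y, 0 < keptMass q r y → 0 < ∑ x, P x * ∏ i, K x i (y i)) ∧
    relEntropy (keptMass q r) (fun y => ∑ x, P x * ∏ i, K x i (y i)) ≤
      relEntropy (keptMass q p) P +
      ((r - p) * bernAvg p (discDeriv (revealEntropy q)) -
        (bernAvg r (revealEntropy q) - bernAvg p (revealEntropy q))) +
      ∑ x, keptMass q p x * ∑ i, (if x i = none then C x i else 0) := by
  have hp1 : p < 1 := hpr.trans_le hr
  have h1p : 0 < 1 - p := by linarith
  set α := (r - p) / (1 - p) with hα
  have hα0 : 0 < α := div_pos (by linarith) h1p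
  set β := (1 - r) / (1 - p) with hβ
  set w := tripleMass q p r with hw
  have hw0 : ∀ ω, 0 ≤ w ω := fun ω =>
    mul_nonneg (massOf_nonneg q _) (bernPair_nonneg h0.le hpr.le hr _ _)
  have hwm : ∀ ω, 0 < w ω → 0 < massOf q ω.1 := fun ω h =>
    (massOf_nonneg q _).lt_of_ne' (left_ne_zero_of_mul h.ne')
  have hwf : ∀ ω, 0 < w ω → ∀ i, (if i ∈ ω.2.2 then (if i ∈ ω.2.1 then p else r - p) else
      (if i ∈ ω.2.1 then 0 else 1 - r)) ≠ 0 := fun ω h i =>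
    Finset.prod_ne_zero_iff.1 (right_ne_zero_of_mul h.ne') i (Finset.mem_univ i)
  have hsub : ∀ ω, 0 < w ω → ω.2.1 ⊆ ω.2.2 := by
    intro ω h i hi
    by_contra hc
    exact hwf ω h i (by simp [hc, hi])
  have hr1 : ∀ ω, 0 < w ω → ∀ i, i ∉ ω.2.2 → r < 1 := by
    intro ω h i hi
    have := hwf ω h i
    have hiU : i ∉ ω.2.1 := fun hc => hi (hsub ω h hc)
    simp only [hi, hiU, if_false] at this
    exact lt_of_le_of_ne hr fun hc => this (by linarith)
  have hlawpos : ∀ z, 0 < massOf q z → ∀ U : Finset (Fin d),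
      0 < law (massOf q) (reveal U) (reveal U z) := fun z hz U => law_pos (massOf_nonneg q) _ hz
  have hkept : ∀ z, 0 < massOf q z → ∀ U : Finset (Fin d), 0 < keptMass q p (reveal U z) := by
    intro z hz U
    rw [keptMass_pos_iff q h0 hp1, unmasked_reveal]
    exact hlawpos z hz U
  have hcondpos : ∀ z, 0 < massOf q z → ∀ (U : Finset (Fin d)) i,
      0 < tokenCond q (reveal U z) i (z i) := by
    intro z hz U i
    rw [tokenCond, unmasked_reveal, law_pair_eq]
    exact div_pos (hlawpos z hz _) (hlawpos z hz _)
  have hKi : ∀ ω, 0 < w ω → ∀ i, 0 < K (reveal ω.2.1 ω.1) i (reveal ω.2.2 ω.1 i) := by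
    intro ω h i
    by_cases hU : i ∈ ω.2.1
    · rw [reveal_of_mem (hsub ω h hU), hKsome _ _ _ (reveal_of_mem hU _)]
      exact zero_lt_one
    · by_cases hV : i ∈ ω.2.2
      · rw [reveal_of_mem hV]
        exact hKpos _ _ _ (hkept _ (hwm ω h) _) (reveal_of_notMem hU _)
          (hcondpos _ (hwm ω h) _ _)
      · rw [reveal_of_notMem hV]
        exact hKnone _ _ (hkept _ (hwm ω h) _) (reveal_of_notMem hU _) (hr1 ω h i hV)
  have hL : ∀ x y : State d S, 0 ≤ ∏ i, K x i (y i) := fun x y =>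
    Finset.prod_nonneg fun i _ => hK _ _ _
  have hac : ∀ ω, 0 < w ω → 0 < P (reveal ω.2.1 ω.1) ∧
      0 < ∏ i, K (reveal ω.2.1 ω.1) i (reveal ω.2.2 ω.1 i) := fun ω h =>
    ⟨hPac _ (hkept _ (hwm ω h) _), Finset.prod_pos fun i _ => hKi ω h i⟩
  refine ⟨fun y hy => ?_, ?_⟩
  · rw [← law_tripleMass_right q p r] at hy
    obtain ⟨ω, rfl, hω⟩ := exists_of_law_ne_zero hy.ne'
    have h := hac ω ((hw0 ω).lt_of_ne' hω)
    exact (mul_pos h.1 h.2).trans_le (Finset.single_le_sum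
      (f := fun x => P x * ∏ i, K x i (reveal ω.2.2 ω.1 i))
      (fun x _ => mul_nonneg (hP x) (hL x _)) (Finset.mem_univ _))
  have main := sum_log_div_step_le hw0 (fun ω => reveal ω.2.1 ω.1) (fun ω => reveal ω.2.2 ω.1)
    hP hL hac
  rw [hw] at main
  simp only [law_tripleMass_left, law_tripleMass_right] at main
  have eL := sum_law_mul w (fun ω => reveal ω.2.2 ω.1) fun y : State d S =>
    Real.log (keptMass q r y / ∑ x, P x * ∏ i, K x i (y i))
  have eR := sum_law_mul w (fun ω => reveal ω.2.1 ω.1) fun x : State d S =>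
    Real.log (keptMass q p x / P x)
  rw [hw] at eL eR
  simp only [law_tripleMass_left] at eR
  simp only [law_tripleMass_right] at eL
  rw [← eL, ← eR] at main
  rw [relEntropy, relEntropy]
  refine main.trans ?_
  rw [add_assoc]
  refine add_le_add_right ?_ _
  -- Logarithmic likelihood ratio of coordinate `i`, without the data probabilities: already
  -- revealed coordinates contribute nothing, since both the true and the sampled transition keep
  -- them.
  set c : (Fin d → Fin S) → Finset (Fin d) → Finset (Fin d) → Fin d → ℝ := fun z U V i =>
    if i ∈ U then 0 else if i ∈ V then Real.log (α / K (reveal U z) i (some (z i))) else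
      Real.log (β / K (reveal U z) i none) with hc
  have hdecomp : ∀ ω, tripleMass q p r ω * Real.log (law (tripleMass q p r)
      (fun ω => (reveal ω.2.1 ω.1, reveal ω.2.2 ω.1)) (reveal ω.2.1 ω.1, reveal ω.2.2 ω.1) /
      (keptMass q p (reveal ω.2.1 ω.1) * ∏ i, K (reveal ω.2.1 ω.1) i (reveal ω.2.2 ω.1 i))) =
      tripleMass q p r ω * Real.log (law (massOf q) (reveal ω.2.2) (reveal ω.2.2 ω.1)) -
      tripleMass q p r ω * Real.log (law (massOf q) (reveal ω.2.1) (reveal ω.2.1 ω.1)) +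
      tripleMass q p r ω * ∑ i, c ω.1 ω.2.1 ω.2.2 i := by
    intro ω
    rcases (hw0 ω).eq_or_lt with hz | hz
    · rw [hw] at hz
      simp [← hz]
    have hUV := hsub ω hz
    have hm := hwm ω hz
    have hf := hwf ω hz
    have hk := hKi ω hz
    have hr' := hr1 ω hz
    obtain ⟨z, U, V⟩ := ω
    dsimp only at hUV hm hf hk hr' ⊢
    rw [law_tripleMass_pair q p r hUV, keptMass_eq, unmasked_reveal]
    have e1 : bernPair p r U V * law (massOf q) (reveal V) (reveal V z) /
        (bern p U * law (massOf q) (reveal U) (reveal U z) * ∏ i, K (reveal U z) i (reveal V z i)) =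
        law (massOf q) (reveal V) (reveal V z) / law (massOf q) (reveal U) (reveal U z) *
        ∏ i, ((if i ∈ V then (if i ∈ U then p else r - p) else (if i ∈ U then 0 else 1 - r)) /
          ((if i ∈ U then p else 1 - p) * K (reveal U z) i (reveal V z i))) := by
      rw [Finset.prod_div_distrib, Finset.prod_mul_distrib, bernPair, bern]
      ring
    have hfac : ∀ i ∈ Finset.univ, ((if i ∈ V then (if i ∈ U then p else r - p) else
        (if i ∈ U then 0 else 1 - r)) /
          ((if i ∈ U then p else 1 - p) * K (reveal U z) i (reveal V z i))) ≠ 0 := fun i _ =>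
      div_ne_zero (hf i) (mul_ne_zero (by split_ifs <;> linarith) (hk i).ne')
    rw [e1, Real.log_mul (div_pos (hlawpos z hm V) (hlawpos z hm U)).ne'
      (Finset.prod_ne_zero_iff.2 hfac), Real.log_prod hfac,
      Real.log_div (hlawpos z hm V).ne' (hlawpos z hm U).ne', mul_add, mul_sub]
    congr 2
    refine Finset.sum_congr rfl fun i _ => ?_
    simp only [hc]
    by_cases hU : i ∈ U
    · have hV := hUV hU
      simp only [hU, hV, if_true]
      rw [reveal_of_mem hV, hKsome _ _ _ (reveal_of_mem hU z), mul_one, div_self h0.ne',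
        Real.log_one]
    · by_cases hV : i ∈ V
      · simp only [hU, hV, if_true, if_false]
        rw [reveal_of_mem hV, ← div_div]
      · simp only [hU, hV, if_false]
        rw [reveal_of_notMem hV, ← div_div]
  rw [Finset.sum_congr rfl fun ω _ => hdecomp ω, Finset.sum_add_distrib, Finset.sum_sub_distrib,
    sum_tripleMass_mul_right q p r fun z V => Real.log (law (massOf q) (reveal V) (reveal V z)),
    sum_tripleMass_mul_left q p r fun z V => Real.log (law (massOf q) (reveal V) (reveal V z))]
  have hF : ∀ s : ℝ, ∑ z, massOf q z * ∑ U : Finset (Fin d),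
      bern s U * Real.log (law (massOf q) (reveal U) (reveal U z)) =
      -bernAvg s (revealEntropy q) := by
    intro s
    simp only [Finset.mul_sum, bernAvg, revealEntropy, entropy_eq]
    rw [Finset.sum_comm, ← Finset.sum_neg_distrib]
    refine Finset.sum_congr rfl fun U _ => ?_
    rw [mul_neg, neg_neg, Finset.mul_sum]
    exact Finset.sum_congr rfl fun z _ => by ring
  rw [hF, hF]
  -- Given `U`, the set `V` is averaged out coordinate by coordinate, with the weights α (revealed)
  -- and β (still masked).
  have hrest : ∑ ω, tripleMass q p r ω * ∑ i, c ω.1 ω.2.1 ω.2.2 i =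
      ∑ U, bern p U * ∑ i, if i ∈ U then 0 else
        ∑ z, massOf q z * (α * Real.log (α / K (reveal U z) i (some (z i))) +
          β * Real.log (β / K (reveal U z) i none)) := by
    rw [Fintype.sum_prod_type_right, Fintype.sum_prod_type]
    refine Finset.sum_congr rfl fun U _ => ?_
    rw [Finset.sum_comm]
    have : ∀ z, ∑ V, tripleMass q p r (z, U, V) * ∑ i, c z U V i =
        ∑ i, bern p U * if i ∈ U then 0 else
          massOf q z * (α * Real.log (α / K (reveal U z) i (some (z i))) +
          β * Real.log (β / K (reveal U z) i none)) := by
      intro z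
      simp only [Finset.mul_sum]
      rw [Finset.sum_comm]
      refine Finset.sum_congr rfl fun i _ => ?_
      by_cases hU : i ∈ U
      · simp [hc, hU]
      · simp only [hc, hU, if_false, tripleMass, mul_assoc]
        rw [← Finset.mul_sum, sum_bernPair_mul_ite r hp1 hU]
        ring
    rw [Finset.sum_congr rfl fun z _ => this z, Finset.sum_comm, Finset.mul_sum]
    refine Finset.sum_congr rfl fun i _ => ?_
    rw [← Finset.mul_sum]
    split_ifs
    · simp
    · rfl
  rw [hrest]
  -- The conditional token probability is inserted into the logarithm, which makes it the relative
  -- entropy of one coordinate law. The compensating term averages to a conditional entropy; summed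
  -- over masked coordinates and averaged over `U`, it yields the tangent term (r-p)φ'(p).
  have hbound : ∀ (U : Finset (Fin d)) i, i ∉ U →
      ∑ z, massOf q z * (α * Real.log (α / K (reveal U z) i (some (z i))) +
          β * Real.log (β / K (reveal U z) i none)) ≤
      α * (revealEntropy q (insert i U) - revealEntropy q U) +
        ∑ z, massOf q z * C (reveal U z) i := by
    intro U i hi
    have e1 : ∀ z, massOf q z * (α * Real.log (α / K (reveal U z) i (some (z i))) +
          β * Real.log (β / K (reveal U z) i none)) =
        massOf q z * (α * Real.log (α * tokenCond q (reveal U z) i (z i) /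
          K (reveal U z) i (some (z i))) + β * Real.log (β / K (reveal U z) i none)) -
        α * (massOf q z * Real.log (tokenCond q (reveal U z) i (z i))) := by
      intro z
      rcases (massOf_nonneg q z).eq_or_lt with hz | hz
      · simp [← hz]
      · have hk := hKpos _ i _ (hkept z hz U) (reveal_of_notMem hi z) (hcondpos z hz U i)
        rw [Real.log_div hα0.ne' hk.ne', Real.log_div (mul_pos hα0 (hcondpos z hz U i)).ne' hk.ne',
          Real.log_mul hα0.ne' (hcondpos z hz U i).ne']
        ring
    rw [Finset.sum_congr rfl fun z _ => e1 z, Finset.sum_sub_distrib, ← Finset.mul_sum,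
      sum_massOf_mul_log_tokenCond]
    have e2 := sum_mul_eq_sum_cond (massOf_nonneg q) (reveal U) (fun z => z i) fun x a =>
      α * Real.log (α * tokenCond q x i a / K x i (some a)) + β * Real.log (β / K x i none)
    rw [e2]
    have e3 : ∑ z, massOf q z * ∑ a, law (massOf q) (fun z => (reveal U z, z i)) (reveal U z, a) /
        law (massOf q) (reveal U) (reveal U z) *
        (α * Real.log (α * tokenCond q (reveal U z) i a / K (reveal U z) i (some a)) +
          β * Real.log (β / K (reveal U z) i none)) ≤ ∑ z, massOf q z * C (reveal U z) i := by
      refine Finset.sum_le_sum fun z _ => ?_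
      rcases (massOf_nonneg q z).eq_or_lt with hz | hz
      · simp [← hz]
      refine mul_le_mul_of_nonneg_left ?_ hz.le
      refine le_trans (le_of_eq ?_) (hC _ i (hkept z hz U) (reveal_of_notMem hi z))
      have hs := sum_tokenCond q (x := reveal U z) i
        (by rw [unmasked_reveal]; exact hlawpos z hz U)
      have e4 : ∀ a, law (massOf q) (fun z => (reveal U z, z i)) (reveal U z, a) /
        law (massOf q) (reveal U) (reveal U z) = tokenCond q (reveal U z) i a := fun a => by
        rw [tokenCond, unmasked_reveal]
      simp only [e4, mul_add, Finset.sum_add_distrib, ← Finset.sum_mul, hs, one_mul]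
      rw [Finset.mul_sum]
      congr 1
      exact Finset.sum_congr rfl fun a _ => by ring
    linarith
  have hfin : ∑ U, bern p U * ∑ i, (if i ∈ U then 0 else
        ∑ z, massOf q z * (α * Real.log (α / K (reveal U z) i (some (z i))) +
          β * Real.log (β / K (reveal U z) i none))) ≤
      α * ∑ U, bern p U * ∑ i, (if i ∈ U then 0 else
        revealEntropy q (insert i U) - revealEntropy q U) +
      ∑ U, bern p U * ∑ i, (if i ∈ U then 0 else ∑ z, massOf q z * C (reveal U z) i) := by
    rw [Finset.mul_sum, ← Finset.sum_add_distrib]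
    refine Finset.sum_le_sum fun U _ => ?_
    rw [mul_left_comm, ← mul_add, Finset.mul_sum _ _ α, ← Finset.sum_add_distrib]
    refine mul_le_mul_of_nonneg_left (Finset.sum_le_sum fun i _ => ?_) (bern_pos h0 hp1 U).le
    split_ifs with hi
    · simp
    · exact hbound U i hi
  rw [sum_bern_mul_sum_notMem] at hfin
  have hαp : α * ((1 - p) * bernAvg p (discDeriv (revealEntropy q))) =
      (r - p) * bernAvg p (discDeriv (revealEntropy q)) := by
    rw [hα]
    field_simp
  have hCx : ∑ U, bern p U * ∑ i, (if i ∈ U then 0 else ∑ z, massOf q z * C (reveal U z) i) =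
      ∑ x, keptMass q p x * ∑ i, (if x i = none then C x i else 0) := by
    rw [sum_keptMass_mul]
    simp only [Finset.mul_sum]
    rw [Finset.sum_comm' (t' := Finset.univ) (s' := fun _ => Finset.univ) (by simp)]
    rw [Finset.sum_comm]
    symm
    rw [Finset.sum_comm]
    refine Finset.sum_congr rfl fun U _ => ?_
    rw [Finset.sum_comm]
    refine Finset.sum_congr rfl fun i _ => ?_
    by_cases hi : i ∈ U
    · simp [hi, reveal]
    · simp only [hi, if_false, reveal_of_notMem hi, if_true, Finset.mul_sum]
      exact Finset.sum_congr rfl fun z _ => by ring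
  rw [hαp, hCx] at hfin
  linarith

end Step

/-! ### The error of a single coordinate -/

section Coordinate

/-- The tangent line inequality for the convex function `x ↦ log ((1 - e^{-x}) / x)`. -/
theorem one_sub_exp_neg_div_ge {h x : ℝ} (hh : 0 < h) (hx : 0 < x) :
    Real.exp (-((x - h) * (1 / h - Real.exp (-h) / (1 - Real.exp (-h))))) *
      ((1 - Real.exp (-h)) / h) ≤ (1 - Real.exp (-x)) / x := by
  have h1 : 0 < 1 - Real.exp (-h) := by
    have : Real.exp (-h) < 1 := by simpa using hh
    linarith
  -- The mean of the density proportional to e^{-hs} on [0,1], and minus the slope of x ↦ log((1 -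
  -- e^{-x})/x) at h.
  set m := 1 / h - Real.exp (-h) / (1 - Real.exp (-h)) with hm
  set c := Real.exp (-((x - h) * m)) with hc
  have hexp : ∀ k s : ℝ, HasDerivAt (fun s : ℝ => Real.exp (-(k * s))) (-k * Real.exp (-(k * s))) s := by
    intro k s
    have := ((hasDerivAt_id s).const_mul k).neg.exp
    simpa [mul_comm] using this
  -- Since (1 - e^{-x})/x is the integral of e^{-xs} over [0,1], the claim is Jensen's inequality
  -- for the density above. The explicit primitive belongs to e^{-xs} minus its pointwise lower
  -- bound from e^y ≥ 1 + y; the linear part of this bound integrates to zero by the choice of m.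
  have hderiv : ∀ s : ℝ, HasDerivAt (fun s : ℝ => -Real.exp (-(x * s)) / x -
      c * (-Real.exp (-(h * s)) / h * (1 - (x - h) * (s - m)) + (x - h) * Real.exp (-(h * s)) / h ^ 2))
      (Real.exp (-(x * s)) - c * (Real.exp (-(h * s)) * (1 - (x - h) * (s - m)))) s := by
    intro s
    have a1 := ((hexp x s).neg.div_const x)
    have a2 := ((hexp h s).neg.div_const h)
    have a3 : HasDerivAt (fun s : ℝ => 1 - (x - h) * (s - m)) (-(x - h)) s := by
      simpa using (((hasDerivAt_id s).sub_const m).const_mul (x - h)).const_sub 1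
    have a4 := ((hexp h s).const_mul (x - h)).div_const (h ^ 2)
    refine (a1.sub (((a2.mul a3).add a4).const_mul c)).congr_deriv ?_
    simp only [Pi.neg_apply]
    field_simp
    ring
  have hnn : ∀ s : ℝ, 0 ≤ Real.exp (-(x * s)) -
      c * (Real.exp (-(h * s)) * (1 - (x - h) * (s - m))) := by
    intro s
    have b1 := Real.add_one_le_exp (-((x - h) * (s - m)))
    have b2 : Real.exp (-(x * s)) =
        c * (Real.exp (-(h * s)) * Real.exp (-((x - h) * (s - m)))) := by
      rw [hc, ← Real.exp_add, ← Real.exp_add]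
      congr 1
      ring
    rw [b2, ← mul_sub, ← mul_sub]
    exact mul_nonneg (Real.exp_pos _).le (mul_nonneg (Real.exp_pos _).le (by linarith))
  have hint := intervalIntegral.integral_eq_sub_of_hasDerivAt (a := 0) (b := 1)
    (fun s _ => hderiv s) (Continuous.intervalIntegrable (by fun_prop) _ _)
  have hpos := intervalIntegral.integral_nonneg (μ := MeasureTheory.volume) zero_le_one
    fun s (_ : s ∈ Set.Icc (0 : ℝ) 1) => hnn s
  rw [hint] at hpos
  clear_value m c
  have key : (1 - Real.exp (-x)) / x - c * ((1 - Real.exp (-h)) / h) =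
      -Real.exp (-(x * 1)) / x - c * (-Real.exp (-(h * 1)) / h * (1 - (x - h) * (1 - m)) +
        (x - h) * Real.exp (-(h * 1)) / h ^ 2) - (-Real.exp (-(x * 0)) / x -
      c * (-Real.exp (-(h * 0)) / h * (1 - (x - h) * (0 - m)) +
        (x - h) * Real.exp (-(h * 0)) / h ^ 2)) := by
    have hmm : m * h * (1 - Real.exp (-h)) = 1 - Real.exp (-h) - h * Real.exp (-h) := by
      rw [hm]
      field_simp
    simp only [mul_one, mul_zero, neg_zero, Real.exp_zero]
    field_simp
    linear_combination ((x - h) * c * x) * hmm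
  linarith

/-- Comparison of truncated exponential waiting times with rates `1` and `l`. -/
theorem stay_move_log_le {h l : ℝ} (hh : 0 < h) (hl : 0 < l) :
    (1 - Real.exp (-h)) * (Real.log l +
        Real.log ((1 - Real.exp (-h)) / (1 - Real.exp (-(l * h))))) +
      Real.exp (-h) * Real.log (Real.exp (-h) / Real.exp (-(l * h))) ≤
      (1 - Real.exp (-h)) * (l - 1) := by
  have hlh : 0 < l * h := mul_pos hl hh
  have h1 : 0 < 1 - Real.exp (-h) := by
    have : Real.exp (-h) < 1 := by simpa using hh
    linarith
  have h2 : 0 < 1 - Real.exp (-(l * h)) := by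
    have : Real.exp (-(l * h)) < 1 := by simpa using hlh
    linarith
  have key := Real.log_le_log (mul_pos (Real.exp_pos _) (div_pos h1 hh))
    (one_sub_exp_neg_div_ge hh hlh)
  rw [Real.log_mul (Real.exp_pos _).ne' (div_pos h1 hh).ne', Real.log_exp,
    Real.log_div h1.ne' hh.ne', Real.log_div h2.ne' hlh.ne', Real.log_mul hl.ne' hh.ne'] at key
  rw [Real.log_div h1.ne' h2.ne', ← Real.exp_sub, Real.log_exp]
  have e : (1 - Real.exp (-h)) * ((l * h - h) * (1 / h - Real.exp (-h) / (1 - Real.exp (-h)))) =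
      (l - 1) * (1 - Real.exp (-h)) - (l - 1) * h * Real.exp (-h) := by
    field_simp
  nlinarith [mul_le_mul_of_nonneg_left key h1.le]

/-- The real-valued version of `weightedBregman`. -/
noncomputable def bregmanGap (a b : ℝ) : ℝ := a - b - b * Real.log (a / b)

theorem bregmanGap_le {a b : ℝ} (ha : 0 ≤ a) (hb : 0 ≤ b) :
    bregmanGap a b ≤ (weightedBregman a b).toReal := by
  unfold weightedBregman bregmanGap
  split_ifs with h1 h2
  · simp [h1, ENNReal.toReal_ofReal ha]
  · simp [h2, hb]
  · have hb' : 0 < b := hb.lt_of_ne' h1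
    -- Truncation at 0 can only increase the value, so the sign of the gap is not needed here.
    refine le_trans (le_of_eq ?_) (ENNReal.toReal_ofReal' ▸ le_max_left _ _)
    rw [bregman]
    field_simp

/-- The relative entropy of the law of one coordinate after one step is controlled by the score
entropy loss. -/
theorem coord_log_le {α : Type*} [Fintype α] {ρ s : α → ℝ} {E a b P : ℝ} (hρ : ∀ c, 0 ≤ ρ c)
    (hρ1 : ∑ c, ρ c = 1) (hs : ∀ c, 0 ≤ s c) (hsupp : ∀ c, 0 < ρ c → 0 < s c) (hE : 0 < E)
    (ha : 0 < a) (hP : P < 1)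
    (hscalar : a * (Real.log (E * ∑ c, s c) + Real.log (a / (1 - P))) + b * Real.log (b / P) ≤
      a * (E * ∑ c, s c - 1)) :
    a * ∑ c, ρ c * Real.log (a * ρ c / (s c / (∑ c, s c) * (1 - P))) + b * Real.log (b / P) ≤
      a * E * ∑ c, bregmanGap (s c) (ρ c / E) := by
  have h1P : 0 < 1 - P := by linarith
  obtain ⟨c₀, hc0⟩ : ∃ c, 0 < ρ c := by
    by_contra! hc
    have : ∑ c, ρ c ≤ 0 := Finset.sum_nonpos fun c _ => hc c
    linarith
  have hΛ : 0 < ∑ c, s c :=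
    (hsupp c₀ hc0).trans_le (Finset.single_le_sum (fun c _ => hs c) (Finset.mem_univ c₀))
  set L := ∑ c, s c with hL
  -- The logarithm splits into a part common to all tokens and the part comparing `s c` with the
  -- true score ρ(c)/E. The latter occurs identically in the Bregman gap, whose true scores sum to
  -- 1/E, so only the scalar inequality `hscalar` is left.
  have e1 : ∀ c, ρ c * Real.log (a * ρ c / (s c / L * (1 - P))) =
      ρ c * (Real.log (E * L) + Real.log (a / (1 - P))) - ρ c * Real.log (s c / (ρ c / E)) := by
    intro c
    rcases (hρ c).eq_or_lt with h0 | h0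
    · simp [← h0]
    · have hsc := hsupp c h0
      rw [← Real.log_mul (mul_pos hE hΛ).ne' (div_pos ha h1P).ne', ← mul_sub,
        ← Real.log_div (mul_pos (mul_pos hE hΛ) (div_pos ha h1P)).ne'
          (div_pos hsc (div_pos h0 hE)).ne']
      congr 2
      field_simp
  have e2 : ∑ c, bregmanGap (s c) (ρ c / E) =
      L - 1 / E - (∑ c, ρ c * Real.log (s c / (ρ c / E))) / E := by
    simp only [bregmanGap, Finset.sum_sub_distrib, ← Finset.sum_div, hρ1, ← hL]
    congr 1
    rw [Finset.sum_div]
    exact Finset.sum_congr rfl fun c _ => by ring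
  rw [Finset.sum_congr rfl fun c _ => e1 c, Finset.sum_sub_distrib, ← Finset.sum_mul, hρ1, e2]
  have e3 : a * E * (L - 1 / E - (∑ c, ρ c * Real.log (s c / (ρ c / E))) / E) =
      a * (E * L - 1) - a * ∑ c, ρ c * Real.log (s c / (ρ c / E)) := by
    field_simp
  rw [e3]
  linarith

end Coordinate

/-! ### The score and the score entropy loss -/

section Loss

variable {d S : ℕ}

/-- Unmasking one coordinate multiplies the mask weight by e^{-t}/(1 - e^{-t}) = 1/(e^t - 1). What
remains is a conditional probability under the data, which does not depend on time. -/
theorem score_eq (q : PMF (Fin d → Fin S)) {t : ℝ} (ht : 0 < t) {x : State d S} {i : Fin d}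
    (hi : x i = none) (a : Fin S) :
    score q t (Function.update x i (some a)) x = tokenCond q x i a / (Real.exp t - 1) := by
  have hU : unmasked (Function.update x i (some a)) = insert i (unmasked x) := by
    ext j
    by_cases h : j = i
    · subst h; simp
    · simp [h]
  have hiU : i ∉ unmasked x := by simp [hi]
  have hlaw : law (massOf q) (reveal (insert i (unmasked x))) (Function.update x i (some a)) =
      law (massOf q) (fun z => (reveal (unmasked x) z, z i)) (x, a) := by
    refine law_congr fun z => ?_
    rw [Prod.mk.injEq, reveal_insert]
    constructor
    · intro h
      have h1 := congrFun h i
      simp only [Function.update_self, Option.some.injEq] at h1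
      refine ⟨?_, h1⟩
      funext j
      by_cases hj : j = i
      · rw [hj, hi, reveal_of_notMem hiU]
      · have := congrFun h j
        rwa [Function.update_of_ne hj, Function.update_of_ne hj] at this
    · rintro ⟨h1, h2⟩
      rw [h1, h2]
  have hb : bern (Real.exp (-t)) (insert i (unmasked x)) * (Real.exp t - 1) =
      bern (Real.exp (-t)) (unmasked x) := by
    have e : ∏ j ∈ Finset.univ.erase i, (if j ∈ insert i (unmasked x) then Real.exp (-t)
        else 1 - Real.exp (-t)) = ∏ j ∈ Finset.univ.erase i,
          (if j ∈ unmasked x then Real.exp (-t) else 1 - Real.exp (-t)) :=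
      Finset.prod_congr rfl fun j hj => by
        simp only [Finset.mem_insert, Finset.ne_of_mem_erase hj, false_or]
    have e2 : Real.exp (-t) * Real.exp t = 1 := by rw [← Real.exp_add]; simp
    rw [bern_eq_mul _ i, bern_eq_mul _ i (unmasked x), e, if_pos (Finset.mem_insert_self _ _),
      if_neg hiU]
    linear_combination (∏ j ∈ Finset.univ.erase i,
          (if j ∈ unmasked x then Real.exp (-t) else 1 - Real.exp (-t))) * e2
  have hE : Real.exp t - 1 ≠ 0 := by
    have := Real.one_lt_exp_iff.2 ht
    linarith
  have hpos : bern (Real.exp (-t)) (insert i (unmasked x)) ≠ 0 :=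
    (bern_pos (Real.exp_pos _) (by simpa using ht) _).ne'
  rw [score, marginal_eq, keptMass_eq, keptMass_eq, hU, hlaw, ← hb, tokenCond, div_div, mul_assoc,
    mul_div_mul_left _ _ hpos, mul_comm (Real.exp t - 1)]

theorem sum_rateMatrix_mul (f : State d S → ℝ≥0∞) (x : State d S) :
    ∑ y with y ≠ x, ENNReal.ofReal (rateMatrix d S y x) * f y =
      ∑ i, if x i = none then ∑ a, f (Function.update x i (some a)) else 0 := by
  have h1 : ∑ y with y ≠ x, ENNReal.ofReal (rateMatrix d S y x) * f y =
      ∑ y, ENNReal.ofReal (offDiagRate y x) * f y := by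
    rw [Finset.sum_filter]
    refine Finset.sum_congr rfl fun y _ => ?_
    by_cases h : y = x
    · subst h
      simp [offDiagRate_self]
    · rw [if_pos h, rateMatrix, Matrix.of_apply, if_neg h]
  have h2 : ∀ y, ENNReal.ofReal (offDiagRate y x) * f y = ∑ i, if ∀ j, j ≠ i → y j = x j then
      (if x i = none ∧ y i ≠ none then f y else 0) else 0 := by
    intro y
    rw [offDiagRate_eq, ENNReal.ofReal_sum_of_nonneg fun i _ => by split_ifs <;> norm_num,
      Finset.sum_mul]
    refine Finset.sum_congr rfl fun i _ => ?_
    split_ifs <;> simp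
  rw [h1, Finset.sum_congr rfl fun y _ => h2 y, Finset.sum_comm]
  refine Finset.sum_congr rfl fun i _ => ?_
  rw [sum_ite_eq_off x i fun y => if x i = none ∧ y i ≠ none then f y else 0, Fintype.sum_option]
  by_cases h : x i = none <;> simp [h]

/-- Finiteness of the loss forces positive rates of all possible tokens, and the loss dominates
its real-valued version. -/
theorem scoreEntropyLoss_spec (q : PMF (Fin d → Fin S)) {t : ℝ} (ht : 0 < t)
    {sHat : State d S → State d S → ℝ≥0} (h : scoreEntropyLoss q t sHat ≠ ⊤) :
    (∀ x i a, 0 < keptMass q (Real.exp (-t)) x → x i = none → 0 < tokenCond q x i a →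
      0 < unmaskRate sHat x i a) ∧
    ∑ x, keptMass q (Real.exp (-t)) x * ∑ i, (if x i = none then
      ∑ a, bregmanGap (unmaskRate sHat x i a) (tokenCond q x i a / (Real.exp t - 1)) else 0) ≤
      (scoreEntropyLoss q t sHat).toReal := by
  have hE : 0 < Real.exp t - 1 := by
    have := Real.one_lt_exp_iff.2 ht
    linarith
  set g : State d S → Fin d → ℝ≥0∞ := fun x i => if x i = none then
    ∑ a, weightedBregman (sHat (Function.update x i (some a)) x)
      (score q t (Function.update x i (some a)) x) else 0 with hg
  have hloss : scoreEntropyLoss q t sHat =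
      ∑ x, ENNReal.ofReal (keptMass q (Real.exp (-t)) x) * ∑ i, g x i := by
    simp only [scoreEntropyLoss, marginal_eq, hg]
    refine Finset.sum_congr rfl fun x _ => ?_
    rw [sum_rateMatrix_mul fun y => weightedBregman (sHat y x) (score q t y x)]
  rw [hloss] at h ⊢
  have hx : ∀ x, ENNReal.ofReal (keptMass q (Real.exp (-t)) x) * ∑ i, g x i ≠ ⊤ := fun x =>
    ENNReal.sum_ne_top.1 h x (Finset.mem_univ x)
  have hxg : ∀ x, 0 < keptMass q (Real.exp (-t)) x → ∀ i, g x i ≠ ⊤ := by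
    intro x hpos i
    have h1 : ∑ i, g x i ≠ ⊤ := fun hc => hx x (by
      rw [hc]
      exact ENNReal.mul_top (ENNReal.ofReal_pos.2 hpos).ne')
    exact ENNReal.sum_ne_top.1 h1 i (Finset.mem_univ i)
  have hxa : ∀ x, 0 < keptMass q (Real.exp (-t)) x → ∀ i, x i = none → ∀ a,
      weightedBregman (sHat (Function.update x i (some a)) x)
        (tokenCond q x i a / (Real.exp t - 1)) ≠ ⊤ := by
    intro x hpos i hi a
    have h1 := hxg x hpos i
    simp only [hg, hi, if_true] at h1
    have h2 := ENNReal.sum_ne_top.1 h1 a (Finset.mem_univ a)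
    rwa [score_eq q ht hi] at h2
  constructor
  · intro x i a hpos hi ha
    have h1 := hxa x hpos i hi a
    have h2 : tokenCond q x i a / (Real.exp t - 1) ≠ 0 := (div_pos ha hE).ne'
    by_contra hc
    have h3 : unmaskRate sHat x i a = 0 := le_antisymm (not_lt.1 hc) (NNReal.coe_nonneg _)
    refine h1 ?_
    rw [unmaskRate] at h3
    rw [weightedBregman, if_neg h2, if_pos h3]
  · rw [ENNReal.toReal_sum fun x _ => hx x]
    refine Finset.sum_le_sum fun x _ => ?_
    rw [ENNReal.toReal_mul]
    rcases (keptMass_nonneg q (Real.exp_pos (-t)).le (by simpa using ht.le) x).eq_or_lt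
      with h0 | h0
    · simp [← h0]
    rw [ENNReal.toReal_ofReal h0.le, ENNReal.toReal_sum fun i _ => hxg x h0 i]
    refine mul_le_mul_of_nonneg_left (Finset.sum_le_sum fun i _ => ?_) h0.le
    by_cases hi : x i = none
    · simp only [hg, hi, if_true, score_eq q ht hi]
      rw [ENNReal.toReal_sum fun a _ => hxa x h0 i hi a]
      exact Finset.sum_le_sum fun a _ => bregmanGap_le (NNReal.coe_nonneg _)
        (div_nonneg (tokenCond_nonneg q x i a) hE.le)
    · simp [hg, hi]

end Loss

/-! ### The relative entropy of mass functions -/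

section MassMeasure

open MeasureTheory

/-- The density is μ/P explicitly and every function on a finite space is integrable; as both total
masses are 1, the mass correction in `klDiv` cancels. -/
theorem klDiv_massMeasure {Ω : Type*} [Fintype Ω] {μ P : Ω → ℝ} (hμ : ∀ x, 0 ≤ μ x)
    (hP : ∀ x, 0 ≤ P x) (hμ1 : ∑ x, μ x = 1) (hP1 : ∑ x, P x = 1)
    (hac : ∀ x, 0 < μ x → 0 < P x) :
    @InformationTheory.klDiv Ω ⊤ (massMeasure μ) (massMeasure P) =
      ENNReal.ofReal (relEntropy μ P) := by
  let _ : MeasurableSpace Ω := ⊤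
  have hprob : ∀ ν : Ω → ℝ, (∀ x, 0 ≤ ν x) → ∑ x, ν x = 1 →
      IsProbabilityMeasure (massMeasure ν) := by
    intro ν hν hν1
    refine ⟨?_⟩
    simp only [massMeasure, Measure.coe_finsetSum, Finset.sum_apply, Measure.smul_apply,
      measure_univ, smul_eq_mul, mul_one]
    rw [← ENNReal.ofReal_sum_of_nonneg fun x _ => hν x, hν1, ENNReal.ofReal_one]
  have := hprob μ hμ hμ1
  have := hprob P hP hP1
  have hint : ∀ f : Ω → ℝ, ∫ x, f x ∂(massMeasure μ) = ∑ x, μ x * f x := by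
    intro f
    rw [massMeasure, integral_finsetSum_measure]
    · refine Finset.sum_congr rfl fun x _ => ?_
      rw [integral_smul_measure, integral_dirac, ENNReal.toReal_ofReal (hμ x), smul_eq_mul]
    · intro x _
      exact (integrable_dirac (by simp)).smul_measure ENNReal.ofReal_ne_top
  have hwd : massMeasure μ = (massMeasure P).withDensity fun x => ENNReal.ofReal (μ x / P x) := by
    rw [massMeasure, massMeasure]
    ext s hs
    rw [withDensity_apply _ hs, ← lintegral_indicator hs, lintegral_finsetSum_measure]
    simp only [Measure.coe_finsetSum, Finset.sum_apply, Measure.smul_apply, smul_eq_mul,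
      lintegral_smul_measure, lintegral_dirac]
    refine Finset.sum_congr rfl fun x _ => ?_
    rw [Measure.dirac_apply' _ hs]
    by_cases hxs : x ∈ s
    · simp only [Set.indicator_of_mem hxs, Pi.one_apply, mul_one]
      rw [← ENNReal.ofReal_mul (hP x)]
      congr 1
      rcases (hμ x).eq_or_lt with h0 | h0
      · simp [← h0]
      · have := (hac x h0).ne'
        field_simp
    · simp [Set.indicator_of_notMem hxs]
  have hacm : massMeasure μ ≪ massMeasure P := by
    rw [hwd]
    exact withDensity_absolutelyContinuous _ _
  have hrn : (massMeasure μ).rnDeriv (massMeasure P) =ᵐ[massMeasure μ]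
      fun x => ENNReal.ofReal (μ x / P x) := by
    refine hacm.ae_eq ?_
    conv_lhs => rw [hwd]
    exact Measure.rnDeriv_withDensity _ (measurable_from_top)
  have hI : Integrable (llr (massMeasure μ) (massMeasure P)) (massMeasure μ) :=
    .of_finite
  rw [InformationTheory.klDiv_of_ac_of_integrable hacm hI]
  simp only [probReal_univ, add_sub_cancel_right]
  congr 1
  rw [relEntropy, ← hint]
  refine integral_congr_ae ?_
  filter_upwards [hrn] with x hx
  rw [llr, hx, ENNReal.toReal_ofReal (div_nonneg (hμ x) (hP x))]

end MassMeasure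

/-! ### The sampler -/

section Sampler

variable {d S : ℕ}

theorem sum_prod_coord (f : Fin d → Option (Fin S) → ℝ) :
    ∑ y : State d S, ∏ i, f i (y i) = ∏ i, ∑ b, f i b := by
  rw [Finset.prod_univ_sum, Fintype.piFinset_univ]

theorem initMass_eq (T : ℝ) (x : State d S) : initMass d S T x =
    bern (Real.exp (-T)) (unmasked x) * (S : ℝ)⁻¹ ^ (unmasked x).card := by
  have h1 : (S : ℝ)⁻¹ ^ (unmasked x).card = ∏ i, if i ∈ unmasked x then (S : ℝ)⁻¹ else 1 := by
    rw [Finset.prod_ite_mem, Finset.univ_inter, Finset.prod_const]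
  rw [h1, initMass, bern, ← Finset.prod_mul_distrib]
  refine Finset.prod_congr rfl fun i _ => ?_
  rcases h : x i with _ | c
  · simp [h]
  · simp [h, mul_comm]

theorem initMass_pos (hS : 1 ≤ S) {T : ℝ} (hT : 0 < T) (x : State d S) : 0 < initMass d S T x := by
  rw [initMass_eq]
  have : (0 : ℝ) < S := by exact_mod_cast hS
  exact mul_pos (bern_pos (Real.exp_pos _) (by simpa using hT) _) (by positivity)

theorem sum_initMass (hS : 1 ≤ S) (T : ℝ) : ∑ x, initMass d S T x = 1 := by
  have hS' : (S : ℝ) ≠ 0 := by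
    have : (0 : ℝ) < S := by exact_mod_cast hS
    exact this.ne'
  have := sum_prod_coord (d := d) (S := S) fun _ b => match b with
    | none => 1 - Real.exp (-T)
    | some _ => (S : ℝ)⁻¹ * Real.exp (-T)
  simp only [initMass]
  refine this.trans (Finset.prod_eq_one fun i _ => ?_)
  rw [Fintype.sum_option]
  simp [hS']

/-- The initialization error. -/
theorem relEntropy_initMass_le (q : PMF (Fin d → Fin S)) (hS : 1 ≤ S) {T : ℝ} (hT : 0 < T) :
    relEntropy (keptMass q (Real.exp (-T))) (initMass d S T) ≤
      Real.exp (-T) * (d * Real.log S) := by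
  have hp1 : Real.exp (-T) < 1 := by simpa using hT
  set p := Real.exp (-T) with hp
  have hp0 : 0 < p := Real.exp_pos _
  have hS' : (0 : ℝ) < S := by exact_mod_cast hS
  rw [relEntropy, sum_keptMass_mul q p fun x => Real.log (keptMass q p x / initMass d S T x)]
  have h1 : ∀ z, massOf q z * ∑ U, bern p U *
      Real.log (keptMass q p (reveal U z) / initMass d S T (reveal U z)) =
      massOf q z * (Real.log S * bernAvg p (fun U : Finset (Fin d) => (U.card : ℝ))) +
      ∑ U, bern p U * (massOf q z * Real.log (law (massOf q) (reveal U) (reveal U z))) := by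
    intro z
    rcases (massOf_nonneg q z).eq_or_lt with h0 | h0
    · simp [← h0]
    rw [bernAvg, Finset.mul_sum, Finset.mul_sum, Finset.mul_sum, ← Finset.sum_add_distrib]
    refine Finset.sum_congr rfl fun U _ => ?_
    have hl := law_pos (massOf_nonneg q) (reveal U) h0
    rw [initMass_eq, keptMass_eq, unmasked_reveal, ← hp,
      mul_div_mul_left _ _ (bern_pos hp0 hp1 U).ne', Real.log_div hl.ne' (by positivity),
      Real.log_pow, Real.log_inv]
    ring
  rw [Finset.sum_congr rfl fun z _ => h1 z, Finset.sum_add_distrib, ← Finset.sum_mul, sum_massOf,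
    one_mul, bernAvg_card, Fintype.card_fin, Finset.sum_comm]
  have h2 : ∑ U, ∑ z, bern p U *
      (massOf q z * Real.log (law (massOf q) (reveal U) (reveal U z))) =
      -bernAvg p (revealEntropy q) := by
    rw [bernAvg, ← Finset.sum_neg_distrib]
    refine Finset.sum_congr rfl fun U _ => ?_
    rw [revealEntropy, entropy_eq, ← Finset.mul_sum]
    ring
  rw [h2]
  have := bernAvg_nonneg hp0.le hp1.le (revealEntropy_nonneg q)
  nlinarith

/-! ### Transition laws of the sampler and the error of one step -/

variable {N : ℕ} {T : ℝ} {t : ℕ → ℝ} {sHat : State d S → State d S → ℝ≥0} {k : ℕ}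
  {x : State d S} {i : Fin d}

theorem coordLaw_of_some {c : Fin S} (h : x i = some c) (b : Option (Fin S)) :
    coordLaw N T t sHat k x i b = if b = some c then 1 else 0 := by
  simp only [coordLaw, h]

theorem coordLaw_none (h : x i = none) :
    coordLaw N T t sHat k x i none = stayProb N T t sHat k x i := by
  simp only [coordLaw, h]

theorem coordLaw_some (h : x i = none) (a : Fin S) : coordLaw N T t sHat k x i (some a) =
    (if ∑ c, unmaskRate sHat x i c = 0 then (S : ℝ)⁻¹
      else unmaskRate sHat x i a / ∑ c, unmaskRate sHat x i c) *
      (1 - stayProb N T t sHat k x i) := by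
  simp only [coordLaw, h]

theorem unmaskRate_nonneg (sHat : State d S → State d S → ℝ≥0) (x : State d S) (i : Fin d)
    (a : Fin S) : 0 ≤ unmaskRate sHat x i a := NNReal.coe_nonneg _

theorem sum_coordLaw (hS : 1 ≤ S) : ∑ b, coordLaw N T t sHat k x i b = 1 := by
  have hS' : (S : ℝ) ≠ 0 := by
    have : (0 : ℝ) < S := by exact_mod_cast hS
    exact this.ne'
  rcases h : x i with _ | c
  · rw [Fintype.sum_option, coordLaw_none h]
    simp only [coordLaw_some h]
    rw [← Finset.sum_mul]
    split_ifs with h1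
    · simp [hS']
    · rw [← Finset.sum_div, div_self h1]
      ring
  · simp only [coordLaw_of_some h]
    simp

theorem stayProb_nonneg : 0 ≤ stayProb N T t sHat k x i := by
  unfold stayProb
  split_ifs
  · exact (Real.exp_pos _).le
  · exact le_rfl

theorem IsTimeGrid.lt (h : IsTimeGrid N T t) (hk : k < N) : t k < T := by
  have : ∀ m, k + m + 1 ≤ N → t k < t (k + m + 1) := by
    intro m
    induction m with
    | zero => exact fun hm => h.2.2 k hk
    | succ m ih => exact fun hm => (ih (by omega)).trans (h.2.2 _ (by omega))
  have h1 := this (N - k - 1) (by omega)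
  rwa [show k + (N - k - 1) + 1 = N by omega, h.2.1] at h1

theorem IsTimeGrid.le (h : IsTimeGrid N T t) (hk : k ≤ N) : t k ≤ T := by
  rcases hk.eq_or_lt with rfl | h1
  · exact h.2.1.le
  · exact (h.lt h1).le

/-- e^{-η} is the true conditional probability that a masked coordinate stays masked in this step.
The exact rates sum to 1/(e^{T-t_k} - 1), so this weight makes the sampler reproduce e^{-η} when the
score is exact. -/
theorem stepWeight_eq (h : IsTimeGrid N T t) (hk : k + 1 < N) :
    ∃ η, 0 < η ∧ stepWeight T t k = (Real.exp (T - t k) - 1) * η ∧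
      Real.exp (-η) = (1 - Real.exp (-(T - t (k + 1)))) / (1 - Real.exp (-(T - t k))) := by
  have h1 := Real.exp_lt_exp.2 (h.lt hk)
  have h2 := Real.exp_lt_exp.2 (h.2.2 k (by omega))
  have hT := Real.exp_pos T
  refine ⟨_, Real.log_pos ?_, rfl, ?_⟩
  · rw [one_lt_div (by linarith)]
    linarith
  · rw [← Real.log_inv, Real.exp_log (inv_pos.2 (div_pos (by linarith) (by linarith))), inv_div]
    simp only [neg_sub, Real.exp_sub]
    have : Real.exp T - Real.exp (t k) ≠ 0 := by linarith
    field_simp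

theorem stayProb_le_one (h : IsTimeGrid N T t) (hk : k < N) :
    stayProb N T t sHat k x i ≤ 1 := by
  unfold stayProb
  split_ifs with hk1
  · obtain ⟨η, hη, he, -⟩ := stepWeight_eq h hk1
    rw [he, Real.exp_le_one_iff, neg_mul, neg_nonpos]
    have : 1 ≤ Real.exp (T - t k) := Real.one_le_exp (by linarith [h.lt hk])
    exact mul_nonneg (Finset.sum_nonneg fun a _ => unmaskRate_nonneg _ _ _ _)
      (mul_nonneg (by linarith) hη.le)
  · exact zero_le_one

theorem coordLaw_nonneg (h : IsTimeGrid N T t) (hk : k < N) (b : Option (Fin S)) :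
    0 ≤ coordLaw N T t sHat k x i b := by
  rcases hx : x i with _ | c
  · rcases b with _ | a
    · rw [coordLaw_none hx]
      exact stayProb_nonneg
    · rw [coordLaw_some hx]
      refine mul_nonneg ?_ (by linarith [stayProb_le_one (sHat := sHat) (x := x) (i := i) h hk])
      split_ifs
      · positivity
      · exact div_nonneg (unmaskRate_nonneg _ _ _ _)
          (Finset.sum_nonneg fun a _ => unmaskRate_nonneg _ _ _ _)
  · rw [coordLaw_of_some hx]
    split_ifs <;> norm_num

theorem samplerMass_nonneg (hS : 1 ≤ S) (hT : 0 < T) (h : IsTimeGrid N T t)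
    (sHat : ℝ → State d S → State d S → ℝ≥0) {k : ℕ} (hk : k ≤ N) (x : State d S) :
    0 ≤ samplerMass N T t sHat k x := by
  induction k generalizing x with
  | zero => exact (initMass_pos hS hT x).le
  | succ k ih =>
    exact Finset.sum_nonneg fun y _ => mul_nonneg (ih (by omega) y)
      (Finset.prod_nonneg fun i _ => coordLaw_nonneg h (by omega) _)

theorem sum_samplerMass (hS : 1 ≤ S) (sHat : ℝ → State d S → State d S → ℝ≥0) (k : ℕ) :
    ∑ x, samplerMass N T t sHat k x = 1 := by
  induction k with
  | zero => exact sum_initMass hS T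
  | succ k ih =>
    simp only [samplerMass]
    rw [Finset.sum_comm]
    simp only [← Finset.mul_sum]
    rw [← ih]
    refine Finset.sum_congr rfl fun x _ => ?_
    rw [sum_prod_coord fun i b => coordLaw N T t (sHat (T - t k)) k x i b]
    simp only [sum_coordLaw hS]
    simp

/-- One step of the sampler. -/
theorem relEntropy_samplerMass_succ_le (q : PMF (Fin d → Fin S)) (hS : 1 ≤ S) (hT : 0 < T)
    (h : IsTimeGrid N T t) (sHat : ℝ → State d S → State d S → ℝ≥0) {k : ℕ} (hk : k < N)
    (hloss : scoreEntropyLoss q (T - t k) (sHat (T - t k)) ≠ ⊤)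
    (hac : ∀ x, 0 < keptMass q (Real.exp (-(T - t k))) x → 0 < samplerMass N T t sHat k x) :
    (∀ x, 0 < keptMass q (Real.exp (-(T - t (k + 1)))) x →
      0 < samplerMass N T t sHat (k + 1) x) ∧
    relEntropy (keptMass q (Real.exp (-(T - t (k + 1))))) (samplerMass N T t sHat (k + 1)) ≤
      relEntropy (keptMass q (Real.exp (-(T - t k)))) (samplerMass N T t sHat k) +
      (∫ s in (T - t (k + 1))..(T - t k),
        (Real.exp (s - (T - t (k + 1))) - 1) * curvRate (revealEntropy q) s) +
      (Real.exp (t (k + 1) - t k) - 1) *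
        (scoreEntropyLoss q (T - t k) (sHat (T - t k))).toReal := by
  have hu : 0 < T - t k := by linarith [h.lt hk]
  have hv : 0 ≤ T - t (k + 1) := by linarith [h.le (k := k + 1) hk]
  have htk := h.2.2 k hk
  set u := T - t k with hu_def
  set v := T - t (k + 1) with hv_def
  have hvu : v < u := by linarith
  obtain ⟨hsupp, hlossle⟩ := scoreEntropyLoss_spec q hu hloss
  set p := Real.exp (-u) with hp
  set r := Real.exp (-v) with hr
  have hp0 : 0 < p := Real.exp_pos _
  have hpr : p < r := Real.exp_lt_exp.2 (by linarith)
  have hr1 : r ≤ 1 := Real.exp_le_one_iff.2 (by linarith)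
  have hp1 : p < 1 := hpr.trans_le hr1
  have hE : 0 < Real.exp u - 1 := by
    have := Real.one_lt_exp_iff.2 hu
    linarith
  set K : State d S → Fin d → Option (Fin S) → ℝ :=
    fun x i b => coordLaw N T t (sHat u) k x i b with hK
  have hstay : ∀ x i, 0 < ∑ a, unmaskRate (sHat u) x i a → stayProb N T t (sHat u) k x i < 1 := by
    intro x i hΛ
    unfold stayProb
    split_ifs with hk1
    · obtain ⟨η, hη, he, -⟩ := stepWeight_eq h hk1
      rw [he, Real.exp_lt_one_iff, neg_mul, neg_lt_zero]
      exact mul_pos hΛ (mul_pos hE hη)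
    · exact zero_lt_one
  have hΛpos : ∀ x i, 0 < keptMass q p x → x i = none → ∀ a, 0 < tokenCond q x i a →
      0 < ∑ a, unmaskRate (sHat u) x i a := fun x i hx hi a ha =>
    (hsupp x i a hx hi ha).trans_le (Finset.single_le_sum
      (fun c _ => unmaskRate_nonneg (sHat u) x i c) (Finset.mem_univ a))
  have key := relEntropy_step_le q hp0 hpr hr1
    (samplerMass_nonneg hS hT h sHat hk.le) hac (K := K)
    (fun x i b => coordLaw_nonneg h hk b)
    (fun x i c hc => by simp only [hK]; rw [coordLaw_of_some hc, if_pos rfl])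
    (fun x i a hx hi ha => by
      have hΛ := hΛpos x i hx hi a ha
      simp only [hK]
      rw [coordLaw_some hi, if_neg hΛ.ne']
      exact mul_pos (div_pos (hsupp x i a hx hi ha) hΛ) (by linarith [hstay x i hΛ]))
    -- r < 1 rules out the last step, the only one in which staying masked is impossible.
    (fun x i hx hi hrlt => by
      simp only [hK]
      rw [coordLaw_none hi, stayProb, if_pos]
      · exact Real.exp_pos _
      · by_contra hc
        have : k + 1 = N := by omega
        rw [hr, hv_def, this, h.2.1] at hrlt
        simp at hrlt)
    (C := fun x i => (r - p) / (1 - p) * (Real.exp u - 1) *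
      ∑ a, bregmanGap (unmaskRate (sHat u) x i a) (tokenCond q x i a / (Real.exp u - 1)))
    (fun x i hx hi => by
      have hρ1 := sum_tokenCond q i ((keptMass_pos_iff q hp0 hp1 x).1 hx)
      obtain ⟨c₀, hc0⟩ : ∃ c, 0 < tokenCond q x i c := by
        by_contra! hc
        have : ∑ c, tokenCond q x i c ≤ 0 := Finset.sum_nonpos fun c _ => hc c
        linarith
      have hΛ := hΛpos x i hx hi c₀ hc0
      have hP := hstay x i hΛ
      simp only [hK]
      simp only [coordLaw_some hi, coordLaw_none hi, if_neg hΛ.ne']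
      refine coord_log_le (tokenCond_nonneg q x i) hρ1 (unmaskRate_nonneg (sHat u) x i)
        (fun c hc => hsupp x i c hx hi hc) hE (div_pos (by linarith) (by linarith)) hP ?_
      set L := ∑ c, unmaskRate (sHat u) x i c with hL
      by_cases hk1 : k + 1 < N
      · obtain ⟨η, hη, he, hexp⟩ := stepWeight_eq h hk1
        have hstayeq : stayProb N T t (sHat u) k x i =
            Real.exp (-((Real.exp u - 1) * L * η)) := by
          rw [stayProb, if_pos hk1, he]
          congr 1
          ring
        have hb : (1 - r) / (1 - p) = Real.exp (-η) := hexp.symm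
        have ha : (r - p) / (1 - p) = 1 - Real.exp (-η) := by
          rw [← hb]
          have : 1 - p ≠ 0 := by linarith
          field_simp
          ring
        rw [hstayeq, hb, ha]
        exact stay_move_log_le hη (mul_pos hE hΛ)
      -- In the last step unmasking is certain for process and sampler: the staying term has
      -- coefficient 0, and log x ≤ x - 1 suffices.
      · have hkN : k + 1 = N := by omega
        have hr' : r = 1 := by rw [hr, hv_def, hkN, h.2.1]; simp
        have hp' : 1 - p ≠ 0 := by linarith
        rw [hr', div_self hp', stayProb, if_neg hk1]
        simp only [sub_self, zero_div, zero_mul, sub_zero, div_one, Real.log_one, add_zero, one_mul]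
        exact Real.log_le_sub_one_of_pos (mul_pos hE hΛ))
  have hsm : samplerMass N T t sHat (k + 1) = fun y => ∑ x, samplerMass N T t sHat k x *
      ∏ i, K x i (y i) := rfl
  rw [hsm]
  refine ⟨key.1, key.2.trans ?_⟩
  -- As e^u = 1/p, the coefficient is (r-p)/p = e^{u-v} - 1.
  have hcoef : (r - p) / (1 - p) * (Real.exp u - 1) = Real.exp (t (k + 1) - t k) - 1 := by
    have e1 : p * Real.exp u = 1 := by rw [hp, ← Real.exp_add]; simp
    have e2 : r = p * Real.exp (t (k + 1) - t k) := by
      rw [hp, hr, ← Real.exp_add]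
      congr 1
      rw [hu_def, hv_def]
      ring
    have hp' : 1 - p ≠ 0 := by linarith
    rw [e2]
    field_simp
    linear_combination (Real.exp (t (k + 1) - t k) - 1) * e1
  have hcnn : 0 ≤ Real.exp (t (k + 1) - t k) - 1 := by
    have := Real.add_one_le_exp (t (k + 1) - t k)
    linarith
  rw [integral_curvRate_step, ← hp, ← hr]
  refine add_le_add_right ?_ _
  refine le_trans (le_of_eq ?_) (mul_le_mul_of_nonneg_left hlossle hcnn)
  rw [Finset.mul_sum]
  refine Finset.sum_congr rfl fun x _ => ?_
  rw [mul_left_comm]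
  congr 1
  rw [Finset.mul_sum]
  refine Finset.sum_congr rfl fun i _ => ?_
  rw [hcoef]
  split_ifs <;> simp

end Sampler

/-! ### Summation over the steps -/

section Total

variable {d S N : ℕ} {T : ℝ} {t : ℕ → ℝ}

theorem exp_sub_one_le {h Δ : ℝ} (hΔ : h ≤ Δ) (h0 : 0 ≤ h) :
    Real.exp h - 1 ≤ h * Real.exp Δ := by
  have h1 := Real.add_one_le_exp (-h)
  have h2 : Real.exp (-h) * Real.exp h = 1 := by rw [← Real.exp_add]; simp
  have h3 := Real.exp_le_exp.2 hΔ
  nlinarith [mul_le_mul_of_nonneg_right h1 (Real.exp_pos h).le, mul_le_mul_of_nonneg_left h3 h0]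

theorem relEntropy_samplerMass_le (q : PMF (Fin d → Fin S)) (hS : 1 ≤ S) (hT : 0 < T)
    (h : IsTimeGrid N T t) (sHat : ℝ → State d S → State d S → ℝ≥0)
    (hloss : ∀ k < N, scoreEntropyLoss q (T - t k) (sHat (T - t k)) ≠ ⊤) {k : ℕ} (hk : k ≤ N) :
    (∀ x, 0 < keptMass q (Real.exp (-(T - t k))) x → 0 < samplerMass N T t sHat k x) ∧
    relEntropy (keptMass q (Real.exp (-(T - t k)))) (samplerMass N T t sHat k) ≤
      Real.exp (-T) * (d * Real.log S) +
      ∑ j ∈ Finset.range k, ((∫ s in (T - t (j + 1))..(T - t j),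
        (Real.exp (s - (T - t (j + 1))) - 1) * curvRate (revealEntropy q) s) +
      (Real.exp (t (j + 1) - t j) - 1) *
        (scoreEntropyLoss q (T - t j) (sHat (T - t j))).toReal) := by
  induction k with
  | zero =>
    refine ⟨fun x _ => initMass_pos hS hT x, ?_⟩
    rw [h.1, sub_zero, Finset.sum_range_zero, add_zero]
    exact relEntropy_initMass_le q hS hT
  | succ k ih =>
    obtain ⟨h1, h2⟩ := ih (by omega)
    obtain ⟨h3, h4⟩ := relEntropy_samplerMass_succ_le q hS hT h sHat (by omega)
      (hloss k (by omega)) h1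
    refine ⟨h3, h4.trans ?_⟩
    rw [Finset.sum_range_succ]
    linarith

/-- The error bound for a general time grid, with the discretization error as an integral. -/
theorem outputKL_le (q : PMF (Fin d → Fin S)) (hS : 1 ≤ S) (hT : 0 < T) (h : IsTimeGrid N T t)
    (sHat : ℝ → State d S → State d S → ℝ≥0) {Δ e : ℝ} (he : 0 ≤ e)
    (hΔ : ∀ k < N, t (k + 1) - t k ≤ Δ) (hloss : totalScoreError q N T t sHat ≤ ENNReal.ofReal e) :
    outputKL q N T t sHat ≤ ENNReal.ofReal (Real.exp (-T) * (d * Real.log S) +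
      ∑ k ∈ Finset.range N, (∫ s in (T - t (k + 1))..(T - t k),
        (Real.exp (s - (T - t (k + 1))) - 1) * curvRate (revealEntropy q) s) +
      Real.exp Δ * e) := by
  have hstep : ∀ k < N, 0 < t (k + 1) - t k := fun k hk => by linarith [h.2.2 k hk]
  have htop : totalScoreError q N T t sHat ≠ ⊤ := ne_top_of_le_ne_top ENNReal.ofReal_ne_top hloss
  have hterm : ∀ k ∈ Finset.range N, ENNReal.ofReal (t (k + 1) - t k) *
      scoreEntropyLoss q (T - t k) (sHat (T - t k)) ≠ ⊤ := ENNReal.sum_ne_top.1 htop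
  have hne : ∀ k < N, scoreEntropyLoss q (T - t k) (sHat (T - t k)) ≠ ⊤ := by
    intro k hk hc
    refine hterm k (Finset.mem_range.2 hk) ?_
    rw [hc]
    exact ENNReal.mul_top (ENNReal.ofReal_pos.2 (hstep k hk)).ne'
  have hsum : ∑ k ∈ Finset.range N, (t (k + 1) - t k) *
      (scoreEntropyLoss q (T - t k) (sHat (T - t k))).toReal ≤ e := by
    have h1 := ENNReal.toReal_mono ENNReal.ofReal_ne_top hloss
    rw [ENNReal.toReal_ofReal he, totalScoreError, ENNReal.toReal_sum hterm] at h1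
    refine le_trans (le_of_eq ?_) h1
    refine Finset.sum_congr rfl fun k hk => ?_
    rw [ENNReal.toReal_mul, ENNReal.toReal_ofReal (hstep k (Finset.mem_range.1 hk)).le]
  obtain ⟨hac, hle⟩ := relEntropy_samplerMass_le q hS hT h sHat hne le_rfl
  have h1 : keptMass q (Real.exp (-(T - t N))) = dataMass q := by
    rw [h.2.1, sub_self, neg_zero, Real.exp_zero, keptMass_one]
  rw [h1] at hac hle
  have hd0 : ∀ x, 0 ≤ dataMass q x := fun x => by
    rw [← keptMass_one]
    exact keptMass_nonneg q zero_le_one le_rfl x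
  have hd1 : ∑ x, dataMass q x = 1 := by
    rw [← keptMass_one]
    exact sum_keptMass q 1
  rw [outputKL, klDiv_massMeasure hd0 (samplerMass_nonneg hS hT h sHat le_rfl) hd1
    (sum_samplerMass hS sHat N) hac]
  refine ENNReal.ofReal_le_ofReal (hle.trans ?_)
  rw [Finset.sum_add_distrib, add_assoc]
  refine add_le_add_right (add_le_add_right ?_ _) _
  calc _ ≤ ∑ k ∈ Finset.range N, Real.exp Δ * ((t (k + 1) - t k) *
      (scoreEntropyLoss q (T - t k) (sHat (T - t k))).toReal) := by
        refine Finset.sum_le_sum fun k hk => ?_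
        have hk := Finset.mem_range.1 hk
        rw [← mul_assoc, mul_comm (Real.exp Δ)]
        exact mul_le_mul_of_nonneg_right (exp_sub_one_le (hΔ k hk) (hstep k hk).le)
          ENNReal.toReal_nonneg
    _ ≤ Real.exp Δ * e := by
        rw [← Finset.mul_sum]
        exact mul_le_mul_of_nonneg_left hsum (Real.exp_pos _).le

/-- In reversed time the steps tile an interval inside [0, T], so a nonnegative integrand adds up to
at most its integral over the half-line. -/
theorem sum_integral_steps_le {g : ℝ → ℝ} (hg : Continuous g) (hg0 : ∀ s, 0 < s → 0 ≤ g s)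
    (hint : MeasureTheory.IntegrableOn g (Set.Ioi 0)) (h : IsTimeGrid N T t) {n : ℕ} (hn : n ≤ N) :
    ∑ k ∈ Finset.range n, (∫ s in (T - t (k + 1))..(T - t k), g s) ≤ ∫ s in Set.Ioi 0, g s := by
  have h1 := intervalIntegral.sum_integral_adjacent_intervals (f := g)
    (μ := MeasureTheory.volume) (a := fun k => T - t k) (n := n)
    fun k _ => hg.intervalIntegrable _ _
  have h2 : ∑ k ∈ Finset.range n, (∫ s in (T - t (k + 1))..(T - t k), g s) =
      ∫ s in (T - t n)..T, g s := by
    rw [intervalIntegral.integral_symm, ← sub_zero T, ← h.1]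
    simp only [h.1, sub_zero] at h1 ⊢
    rw [← h1, ← Finset.sum_neg_distrib]
    exact Finset.sum_congr rfl fun k _ => intervalIntegral.integral_symm _ _
  have hn0 : 0 ≤ T - t n := by linarith [h.le hn]
  have hnT : T - t n ≤ T := by
    have : 0 ≤ t n := by
      rw [← h.1]
      have : ∀ m ≤ N, t 0 ≤ t m := by
        intro m
        induction m with
        | zero => exact fun _ => le_rfl
        | succ m ih => exact fun hm => (ih (by omega)).trans (h.2.2 m (by omega)).le
      exact this n hn
    linarith
  rw [h2, intervalIntegral.integral_of_le hnT]
  refine MeasureTheory.setIntegral_mono_set hint ?_ ?_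
  · exact (MeasureTheory.ae_restrict_iff' measurableSet_Ioi).2 (.of_forall fun s hs => hg0 s hs)
  · exact .of_forall fun s (hs : s ∈ Set.Ioc _ _) => hn0.trans_lt hs.1

/-- On the step e^{s-v} - 1 ≤ (u-v)e^Δ. The weight `m` is the one of the target functional: 1 for
the dual total correlation, min(1, s) for the effective one. -/
theorem integral_step_le {f : Finset (Fin d) → ℝ} (hf : ∀ U, 0 ≤ curvature f U) {u v Δ c : ℝ}
    {m : ℝ → ℝ} (hm : Continuous m) (hv : 0 ≤ v) (hvu : v ≤ u) (hΔ : u - v ≤ Δ)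
    (hc : ∀ s ∈ Set.Icc v u, (u - v) * Real.exp Δ ≤ c * m s) :
    ∫ s in v..u, (Real.exp (s - v) - 1) * curvRate f s ≤ c * ∫ s in v..u, m s * curvRate f s := by
  have hcont := continuous_curvRate f
  rw [← intervalIntegral.integral_const_mul]
  refine intervalIntegral.integral_mono_on hvu (Continuous.intervalIntegrable (by fun_prop) _ _)
    (Continuous.intervalIntegrable (by fun_prop) _ _) fun s hs => ?_
  rw [← mul_assoc]
  refine mul_le_mul_of_nonneg_right (le_trans ?_ (hc s hs)) (curvRate_nonneg hf (hv.trans hs.1))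
  refine le_trans ?_ (exp_sub_one_le hΔ (by linarith))
  have := Real.exp_le_exp.2 (sub_le_sub_right hs.2 v)
  linarith

/-- The discretization error of constant step sizes. -/
theorem sum_integral_constant_le (q : PMF (Fin d → Fin S)) (h : IsTimeGrid N T t) {Δ : ℝ}
    (hT : 0 ≤ T) (hΔ : ∀ k < N, t (k + 1) - t k ≤ Δ) (hconst : IsConstantSchedule N T t) :
    ∑ k ∈ Finset.range N, (∫ s in (T - t (k + 1))..(T - t k),
        (Real.exp (s - (T - t (k + 1))) - 1) * curvRate (revealEntropy q) s) ≤
      T / N * Real.exp Δ * dualTotalCorrelation q := by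
  have hf := curvature_revealEntropy_nonneg q
  calc _ ≤ ∑ k ∈ Finset.range N, T / N * Real.exp Δ *
        ∫ s in (T - t (k + 1))..(T - t k), curvRate (revealEntropy q) s := by
        refine Finset.sum_le_sum fun k hk => ?_
        have hk := Finset.mem_range.1 hk
        have h1 := h.2.2 k hk
        have := integral_step_le hf (u := T - t k) (v := T - t (k + 1)) (Δ := Δ)
          (c := T / N * Real.exp Δ) (m := fun _ => 1) continuous_const
          (by linarith [h.le (k := k + 1) hk]) (by linarith) (by linarith [hΔ k hk])
          (fun s _ => by rw [← hconst k hk, mul_one, sub_sub_sub_cancel_left])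
        simpa using this
    _ ≤ _ := by
        rw [← Finset.mul_sum, dualTotalCorrelation_eq, ← integral_curvRate hf]
        refine mul_le_mul_of_nonneg_left (sum_integral_steps_le (continuous_curvRate _)
          (fun s hs => curvRate_nonneg hf hs.le) (integrableOn_curvRate hf) h le_rfl) ?_
        positivity

/-- The discretization error of the last step. -/
theorem integral_last_step_le (q : PMF (Fin d → Fin S)) (hS : 1 ≤ S) {u : ℝ} (hu : 0 ≤ u) :
    ∫ s in (0 : ℝ)..u, (Real.exp (s - 0) - 1) * curvRate (revealEntropy q) s ≤
      u * (d * Real.log S) := by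
  have hp1 : Real.exp (-u) ≤ 1 := Real.exp_le_one_iff.2 (by linarith)
  have hp0 := (Real.exp_pos (-u)).le
  rw [integral_curvRate_step, neg_zero, Real.exp_zero, bernAvg_one]
  have h1 : bernAvg (Real.exp (-u)) (revealEntropy q) ≤ revealEntropy q Finset.univ :=
    (bernAvg_mono hp0 hp1 fun U => revealEntropy_mono q (Finset.subset_univ U)).trans_eq
      (bernAvg_const _ _)
  have h2 : bernAvg (Real.exp (-u)) (discDeriv (revealEntropy q)) ≤ d * Real.log S :=
    (bernAvg_mono hp0 hp1 (discDeriv_revealEntropy_le q hS)).trans_eq (bernAvg_const _ _)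
  have h3 := bernAvg_nonneg hp0 hp1 (discDeriv_revealEntropy_nonneg q)
  have h4 := Real.add_one_le_exp (-u)
  have h5 := mul_le_mul_of_nonneg_right (show 1 - Real.exp (-u) ≤ u by linarith) h3
  have h6 := mul_le_mul_of_nonneg_left h2 hu
  linarith

/-- The discretization error of exponential-then-constant step sizes. -/
theorem sum_integral_expConst_le (q : PMF (Fin d → Fin S)) (hS : 1 ≤ S) (hN : 1 ≤ N)
    (h : IsTimeGrid N T t) {Δ κ δ : ℝ} (hκ : 0 ≤ κ) (hδ : 0 ≤ δ)
    (hΔ : ∀ k < N, t (k + 1) - t k ≤ Δ) (hexp : IsExpConstSchedule N T κ δ t) :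
    ∑ k ∈ Finset.range N, (∫ s in (T - t (k + 1))..(T - t k),
        (Real.exp (s - (T - t (k + 1))) - 1) * curvRate (revealEntropy q) s) ≤
      κ * Real.exp Δ * effectiveTotalCorrelation q + δ * (d * Real.log S) := by
  have hf := curvature_revealEntropy_nonneg q
  obtain ⟨n, rfl⟩ : ∃ n, N = n + 1 := ⟨N - 1, by omega⟩
  rw [Finset.sum_range_succ]
  refine add_le_add ?_ ?_
  · calc _ ≤ ∑ k ∈ Finset.range n, κ * Real.exp Δ *
          ∫ s in (T - t (k + 1))..(T - t k), min 1 s * curvRate (revealEntropy q) s := by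
          refine Finset.sum_le_sum fun k hk => ?_
          have hk : k < n := Finset.mem_range.1 hk
          have h1 := h.2.2 k (by omega)
          have h2 := hexp.1 k (by omega)
          refine integral_step_le hf (Δ := Δ) (m := fun s => min 1 s)
            (continuous_const.min continuous_id)
            (by linarith [h.le (k := k + 1) (by omega)]) (by linarith)
            (by linarith [hΔ k (by omega)]) fun s hs => ?_
          rw [sub_sub_sub_cancel_left, mul_right_comm]
          -- The schedule bounds the step by its endpoint nearest to the data, where min(1, ·) is
          -- smallest on the interval.
          refine mul_le_mul_of_nonneg_right (h2.trans ?_) (Real.exp_pos _).le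
          exact mul_le_mul_of_nonneg_left (min_le_min_left 1 hs.1) hκ
      _ ≤ _ := by
          rw [← Finset.mul_sum, effectiveTotalCorrelation_eq]
          refine mul_le_mul_of_nonneg_left (sum_integral_steps_le
            ((continuous_const.min continuous_id).mul (continuous_curvRate _))
            (fun s hs => mul_nonneg (le_min zero_le_one hs.le) (curvRate_nonneg hf hs.le))
            (integrableOn_min_mul_curvRate hf) h (by omega)) ?_
          positivity
  -- The last step ends at remaining time 0, where min(1, ·) vanishes and no step condition could
  -- hold; it is bounded by entropy alone.
  · have h1 : T - t n = δ := hexp.2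
    rw [h1, h.2.1, sub_self]
    exact integral_last_step_le q hS hδ

end Total

end MaskingDiffusion

open MaskingDiffusion in
theorem corollary2 :
    -- the guarantee; the constant `K` depends only on the bound `Δ₀` on the step sizes
    (∀ Δ₀ : ℝ, 0 < Δ₀ → ∃ K : ℝ, 0 < K ∧
      ∀ (d S : ℕ) (q : PMF (Fin d → Fin S)) (ε εscore T : ℝ) (N : ℕ) (t : ℕ → ℝ)
        (sHat : ℝ → State d S → State d S → ℝ≥0),
        1 ≤ d → 2 ≤ S → 0 < ε → ε < d * Real.log S → 0 ≤ εscore →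
        T = Real.log (d * Real.log S / ε) →
        1 ≤ N → IsTimeGrid N T t → (∀ k < N, t (k + 1) - t k ≤ Δ₀) →
        totalScoreError q N T t sHat ≤ ENNReal.ofReal εscore →
        (IsConstantSchedule N T t →
          T * dualTotalCorrelation q / ε ≤ N →
          outputKL q N T t sHat ≤ ENNReal.ofReal (K * (εscore + ε))) ∧
        (IsExpConstSchedule N T ((T + Real.log (ε⁻¹ * d * Real.log S)) / N)
            (ε / (d * Real.log S)) t →
          (T + Real.log (ε⁻¹ * d * Real.log S)) * effectiveTotalCorrelation q / ε ≤ N →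
          outputKL q N T t sHat ≤ ENNReal.ofReal (K * (εscore + ε)))) ∧
    -- the effective total correlation is a convergent integral, at most `min(B, C)`
    (∀ (d S : ℕ) (q : PMF (Fin d → Fin S)),
      MeasureTheory.IntegrableOn (fun t : ℝ => min 1 t * infoAt q t) (Set.Ioi 0) ∧
      effectiveTotalCorrelation q ≤ min (dualTotalCorrelation q) (totalCorrelation q)) ∧
    -- exponential-then-constant schedules exist once `N` exceeds a logarithmic factor
    (∀ (d S : ℕ) (ε T : ℝ) (N : ℕ),
      1 ≤ d → 2 ≤ S → 0 < ε → T = Real.log (d * Real.log S / ε) →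
      ε / (d * Real.log S) < T → 4 * (1 + T) ^ 2 ≤ N →
      ∃ t : ℕ → ℝ, IsTimeGrid N T t ∧ (∀ k < N, t (k + 1) - t k ≤ 1) ∧
        IsExpConstSchedule N T ((T + Real.log (ε⁻¹ * d * Real.log S)) / N)
          (ε / (d * Real.log S)) t) := by
  -- The multiples of ε are 1 for the initial law, e^{Δ₀} for the discretization and 1 for the last
  -- exponential step; the score error enters with e^{Δ₀}.
  refine ⟨fun Δ₀ _ => ⟨Real.exp Δ₀ + 2, by positivity, ?_⟩, fun d S q =>
    ⟨integrableOn_effectiveTotalCorrelation q, effectiveTotalCorrelation_le q⟩, ?_⟩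
  · intro d S q ε εscore T N t sHat hd hS hε hεd hεs hT hN hgrid hΔ hloss
    have hS1 : 1 ≤ S := by omega
    have hM : 0 < d * Real.log S := hε.trans hεd
    have hT0 : 0 < T := by
      rw [hT]
      exact Real.log_pos ((one_lt_div hε).2 hεd)
    have hN0 : (0 : ℝ) < N := by exact_mod_cast hN
    have hlogS : Real.log S ≠ 0 := right_ne_zero_of_mul hM.ne'
    have hexpT : Real.exp (-T) * (d * Real.log S) = ε := by
      rw [hT, Real.exp_neg, Real.exp_log (div_pos hM hε)]
      field_simp
    have hmain := outputKL_le q hS1 hT0 hgrid sHat hεs hΔ hloss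
    rw [hexpT] at hmain
    have hE := Real.exp_pos Δ₀
    refine ⟨fun hconst hNB => ?_, fun hexp hND => ?_⟩
    · refine hmain.trans (ENNReal.ofReal_le_ofReal ?_)
      have h1 := sum_integral_constant_le q hgrid hT0.le hΔ hconst
      have h2 : T / N * dualTotalCorrelation q ≤ ε := by
        rw [div_le_iff₀ hε] at hNB
        rw [div_mul_eq_mul_div, div_le_iff₀ hN0]
        linarith
      nlinarith
    · refine hmain.trans (ENNReal.ofReal_le_ofReal ?_)
      have hlog : Real.log (ε⁻¹ * d * Real.log S) = T := by
        rw [hT]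
        congr 1
        field_simp
      rw [hlog] at hexp hND
      have h1 := sum_integral_expConst_le q hS1 hN hgrid (by positivity) (div_pos hε hM).le hΔ hexp
      rw [div_mul_cancel₀ _ hM.ne'] at h1
      have h2 : (T + T) / N * effectiveTotalCorrelation q ≤ ε := by
        rw [div_le_iff₀ hε] at hND
        rw [div_mul_eq_mul_div, div_le_iff₀ hN0]
        linarith
      nlinarith
  · intro d S ε T N hd hS hε hT hεT hN
    have hM : 0 < d * Real.log S := by
      have h1 : (0 : ℝ) < d := by exact_mod_cast hd
      have h2 : (1 : ℝ) < S := by exact_mod_cast hS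
      exact mul_pos h1 (Real.log_pos h2)
    have hexpT : Real.exp (-T) = ε / (d * Real.log S) := by
      rw [hT, Real.exp_neg, Real.exp_log (div_pos hM hε), inv_div]
    have hlog : Real.log (ε⁻¹ * d * Real.log S) = T := by
      rw [hT]
      congr 1
      field_simp
    rw [hlog, ← hexpT]
    rw [← hexpT] at hεT
    exact exists_isExpConstSchedule ((Real.exp_pos _).trans hεT) hεT hN
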